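/- **Setting.** Let $(\Omega,\mathcal F,P)$ be a probability space with a filtration $(\mathcal F_t)_{0\le t\le T}$ such that $\mathcal F_0$ contains all $P$-null events, and let $(S_t)_{0\le t\le T}$ be an adapted $\mathbb R^d$-valued process. Put $\Delta S_t=S_t-S_{t-1}$ for $1\le t\le T$ and $\Delta S_0=S_0$. Let $\Xi_t$ be the set of $\mathcal F_t$-measurable $\mathbb R^d$-valued random variables, and $\Phi$ the set of strategies $\phi=(\phi_t)_{1\le t\le T}$ with $\phi_t\in\Xi_{t-1}$. For $c\in\mathbb R$ put $V_t^{c,\phi}=c+\sum_{i=1}^t\langle\phi_i,\Delta S_i\rangle$. Let $\mathcal M$ be the set of random variables with finite moments of all orders. Let $D_{t+1}(\omega)$ be the smallest affine subspace of $\mathbb R^d$ containing the support of the regular conditional distribution of $\Delta S_{t+1}$ given $\mathcal F_t$, and let $\tilde\Xi_t$ be the set of $p\in\Xi_t$ with $p\in D_{t+1}$ a.s. and $|p|=1$ a.s. on $\{D_{t+1}\ne\{0\}\}$. **Hypotheses.** 1. $U:\mathbb R\to\mathbb R$ is concave, strictly increasing and continuously differentiable, $U(0)=0$, and at least one of the following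 holds: (a) there are $\tilde x>0$ and $0<\gamma<1$ with $U(\lambda x)\le\lambda^{\gamma}U(x)$ for all $x\ge\tilde x$, $\lambda\ge1$; (b) there are $\tilde x\le0$ and $\alpha>0$ with $U(\lambda x)\le\lambda^{1+\alpha}U(x)$ for all $x\le\tilde x$, $\lambda\ge1$. 2. For some constants $k,l,M,K\ge0$: $U'(x)\le K(|x|^k+1)$ for all $x\in\mathbb R$, and $M|x|^{-l}\le U'(x)$ for all $|x|\ge1$. 3. $|\Delta S_t|\in\mathcal M$ for $0\le t\le T$. 4. (NA) holds: for every $\phi\in\Phi$, if $V_T^{0,\phi}\ge0$ a.s. then $V_T^{0,\phi}=0$ a.s. Moreover, for every $0\le t\le T-1$ there are $\mathcal F_t$-measurable $\beta_t,\kappa_t>0$ with $1/\beta_t,1/\kappa_t\in\mathcal M$ such that, for every $p\in\tilde\Xi_t$, almost surely $$P(\langle p,\Delta S_{t+1}\rangle<-\beta_t\mid\mathcal F_t)\ge\kappa_t\quad\text{on }\{D_{t+1}\ne\{0\}\}.$$ **Conclusions.** (i) The random functions $U_T(x)=U(x)$ and, for $0\le t<T$, $$U_t(x)=\operatorname*{ess\,sup}_{\xi\in\Xi_t}E\big(U_{t+1}(x+\langle\xi,\Delta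 S_{t+1}\rangle)\mid\mathcal F_t\big)$$ are well defined (all these generalized conditional expectations exist, and the $U_t$ have versions that are a.s. finite, nondecreasing and concave in $x$; such versions are used on the right-hand side). In particular $U_t(x)<\infty$ a.s., and $EU_0(x)<\infty$ for all $x\in\mathbb R$. (ii) For every $c\in\mathbb R$ there is an optimal strategy, that is, a $\phi^*\in\Phi(U,c)$ with $$u(c):=\sup_{\phi\in\Phi(U,c)}EU(V_T^{c,\phi})=EU(V_T^{c,\phi^*})<\infty,$$ where $\Phi(U,c)$ is the set of $\phi\in\Phi$ for which $EU(V_T^{c,\phi})$ is well defined in $[-\infty,\infty]$. (iii) For every $c\in\mathbb R$ and every optimal strategy $\phi^*$ for $c$, $U'(V_T^{c,\phi^*})$ is $P$-integrable and $$\frac{dQ}{dP}=\frac{U'(V_T^{c,\phi^*})}{EU'(V_T^{c,\phi^*})}$$ defines a probability measure $Q$ equivalent to $P$ under which $(S_t)_{0\le t\le T}$ is a martingale with respect to $(\mathcal F_t)_{0\le t\le T}$. -/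

import Mathlib

open MeasureTheory ProbabilityTheory
open scoped ENNReal

noncomputable section

namespace UtilityMax

/-! ### Extended expectations and essential suprema -/

/-- The expectation of the real random variable `X` is well defined in `[-∞, ∞]`: at least one of
`E X⁺`, `E X⁻` is finite. -/
def ExpWellDefined {Ω : Type*} {mΩ : MeasurableSpace Ω} (P : Measure Ω) (X : Ω → ℝ) : Prop :=
  ∫⁻ ω, ENNReal.ofReal (X ω) ∂P ≠ ⊤ ∨ ∫⁻ ω, ENNReal.ofReal (-X ω) ∂P ≠ ⊤

/-- The expectation `E X = E X⁺ - E X⁻` in `[-∞, ∞]` (meaningful when `ExpWellDefined`). -/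
def extExp {Ω : Type*} {mΩ : MeasurableSpace Ω} (P : Measure Ω) (X : Ω → ℝ) : EReal :=
  ((∫⁻ ω, ENNReal.ofReal (X ω) ∂P : ℝ≥0∞) : EReal)
    - ((∫⁻ ω, ENNReal.ofReal (-X ω) ∂P : ℝ≥0∞) : EReal)

/-- The generalized conditional expectation of `X` given `m` is well defined: almost surely, at
least one of `E(X⁺ | m)`, `E(X⁻ | m)` is finite. -/
def CondExpWellDefined {Ω : Type*} {mΩ : MeasurableSpace Ω} (P : Measure Ω)
    (m : MeasurableSpace Ω) (X : Ω → ℝ) : Prop :=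
  ∀ᵐ ω ∂P, condLExp m P (fun ω' => ENNReal.ofReal (X ω')) ω ≠ ⊤ ∨
    condLExp m P (fun ω' => ENNReal.ofReal (-X ω')) ω ≠ ⊤

/-- The generalized conditional expectation `E(X | m) = E(X⁺ | m) - E(X⁻ | m)` in `[-∞, ∞]`. -/
def extCondExp {Ω : Type*} {mΩ : MeasurableSpace Ω} (P : Measure Ω)
    (m : MeasurableSpace Ω) (X : Ω → ℝ) (ω : Ω) : EReal :=
  ((condLExp m P (fun ω' => ENNReal.ofReal (X ω')) ω : ℝ≥0∞) : EReal)
    - ((condLExp m P (fun ω' => ENNReal.ofReal (-X ω')) ω : ℝ≥0∞) : EReal)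

/-- `G` is (a version of) the essential supremum of the family `Y i`, `i ∈ I`: it dominates
every member almost surely, and is almost surely below every random variable that does. -/
def IsEssSup {Ω ι : Type*} {mΩ : MeasurableSpace Ω} (P : Measure Ω) (I : Set ι)
    (Y : ι → Ω → EReal) (G : Ω → EReal) : Prop :=
  Measurable G ∧ (∀ i ∈ I, ∀ᵐ ω ∂P, Y i ω ≤ G ω) ∧
    ∀ Z : Ω → EReal, Measurable Z → (∀ i ∈ I, ∀ᵐ ω ∂P, Y i ω ≤ Z ω) → ∀ᵐ ω ∂P, G ω ≤ Z ω

/-- The random variable `X` has finite moments of all orders. -/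
def HasAllMoments {Ω : Type*} {mΩ : MeasurableSpace Ω} (P : Measure Ω) (X : Ω → ℝ) : Prop :=
  ∀ n : ℕ, MemLp X n P

/-! ### The market -/

/-- `ΔS_t = S_t - S_{t-1}` for `t ≥ 1`, with the convention `S_{-1} = 0`, that is `ΔS_0 = S_0`. -/
def increment {Ω : Type*} {d : ℕ} (S : ℕ → Ω → EuclideanSpace ℝ (Fin d)) :
    ℕ → Ω → EuclideanSpace ℝ (Fin d)
  | 0 => S 0
  | t + 1 => fun ω => S (t + 1) ω - S t ω

/-- Predictable trading strategies `(φ_t)_{1 ≤ t ≤ T}`: `φ_{t+1}` is `ℱ_t`-measurable. -/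
def IsStrategy {Ω : Type*} {mΩ : MeasurableSpace Ω} {d : ℕ} (ℱ : Filtration ℕ mΩ) (T : ℕ)
    (φ : ℕ → Ω → EuclideanSpace ℝ (Fin d)) : Prop :=
  ∀ t < T, Measurable[ℱ t] (φ (t + 1))

/-- The value `V_t^{c,φ} = c + ∑_{i=1}^t ⟨φ_i, ΔS_i⟩` of the portfolio `φ`. -/
def wealth {Ω : Type*} {d : ℕ} (S : ℕ → Ω → EuclideanSpace ℝ (Fin d)) (c : ℝ)
    (φ : ℕ → Ω → EuclideanSpace ℝ (Fin d)) (t : ℕ) (ω : Ω) : ℝ :=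
  c + ∑ i ∈ Finset.range t, inner ℝ (φ (i + 1) ω) (increment S (i + 1) ω)

/-- Absence of arbitrage. -/
def NoArbitrage {Ω : Type*} {mΩ : MeasurableSpace Ω} {d : ℕ} (P : Measure Ω)
    (ℱ : Filtration ℕ mΩ) (S : ℕ → Ω → EuclideanSpace ℝ (Fin d)) (T : ℕ) : Prop :=
  ∀ φ : ℕ → Ω → EuclideanSpace ℝ (Fin d), IsStrategy ℱ T φ →
    (∀ᵐ ω ∂P, 0 ≤ wealth S 0 φ T ω) → ∀ᵐ ω ∂P, wealth S 0 φ T ω = 0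

/-- A regular version of the conditional distribution of `Y` given the σ-algebra `m` (the
conditional distribution of `Y` given the identity map into `(Ω, m)`). -/
def condLaw {Ω : Type*} {mΩ : MeasurableSpace Ω} {d : ℕ} (P : Measure Ω) [IsFiniteMeasure P]
    (m : MeasurableSpace Ω) (Y : Ω → EuclideanSpace ℝ (Fin d)) :
    @Kernel Ω (EuclideanSpace ℝ (Fin d)) m _ :=
  @condDistrib Ω Ω (EuclideanSpace ℝ (Fin d)) _ _ _ mΩ m Y id P _

/-- The random set `D_t(ω)` for `t = s + 1`: the smallest affine subspace containing the support of
the conditional distribution of `ΔS_{s+1}` given `ℱ_s`. -/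
def nextSpan {Ω : Type*} {mΩ : MeasurableSpace Ω} {d : ℕ} (P : Measure Ω) [IsFiniteMeasure P]
    (ℱ : Filtration ℕ mΩ) (S : ℕ → Ω → EuclideanSpace ℝ (Fin d)) (s : ℕ) (ω : Ω) :
    AffineSubspace ℝ (EuclideanSpace ℝ (Fin d)) :=
  affineSpan ℝ (condLaw P (ℱ s) (increment S (s + 1)) ω).support

/-- The random set `D_{t+1}` is not reduced to the origin at `ω`. -/
def Nontriv {Ω : Type*} {mΩ : MeasurableSpace Ω} {d : ℕ} (P : Measure Ω) [IsFiniteMeasure P]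
    (ℱ : Filtration ℕ mΩ) (S : ℕ → Ω → EuclideanSpace ℝ (Fin d)) (t : ℕ) (ω : Ω) : Prop :=
  (nextSpan P ℱ S t ω : Set (EuclideanSpace ℝ (Fin d))) ≠ {0}

/-- The `ℱ_t`-measurable fields of directions `p` with `p ∈ D_{t+1}` a.s. and `|p| = 1` on
`{D_{t+1} ≠ {0}}`. -/
def unitDirections {Ω : Type*} {mΩ : MeasurableSpace Ω} {d : ℕ} (P : Measure Ω)
    [IsFiniteMeasure P] (ℱ : Filtration ℕ mΩ) (S : ℕ → Ω → EuclideanSpace ℝ (Fin d)) (t : ℕ) :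
    Set (Ω → EuclideanSpace ℝ (Fin d)) :=
  {p | Measurable[ℱ t] p ∧ (∀ᵐ ω ∂P, p ω ∈ nextSpan P ℱ S t ω) ∧
    ∀ᵐ ω ∂P, Nontriv P ℱ S t ω → ‖p ω‖ = 1}

/-- `β` and `κ` are `ℱ_t`-measurable, positive, and for all `p ∈ unitDirections P ℱ S t`,
`P(⟨p, ΔS_{t+1}⟩ < -β | ℱ_t) ≥ κ` on `{D_{t+1} ≠ {0}}` almost surely. -/
def IsNABound {Ω : Type*} {mΩ : MeasurableSpace Ω} {d : ℕ} (P : Measure Ω) [IsFiniteMeasure P]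
    (ℱ : Filtration ℕ mΩ) (S : ℕ → Ω → EuclideanSpace ℝ (Fin d)) (t : ℕ) (β κ : Ω → ℝ) : Prop :=
  Measurable[ℱ t] β ∧ Measurable[ℱ t] κ ∧ (∀ᵐ ω ∂P, 0 < β ω) ∧ (∀ᵐ ω ∂P, 0 < κ ω) ∧
    ∀ p ∈ unitDirections P ℱ S t, ∀ᵐ ω ∂P, Nontriv P ℱ S t ω →
      κ ω ≤ (P⟦{ω' | inner ℝ (p ω') (increment S (t + 1) ω') < -β ω'} | ℱ t⟧) ω

/-! ### Utility functions -/

/-- Concave nondecreasing, `U 0 = 0`, with reasonable asymptotic elasticity at `+∞`. -/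
def ElasticAtTop (U : ℝ → ℝ) : Prop :=
  ConcaveOn ℝ Set.univ U ∧ Monotone U ∧ U 0 = 0 ∧
    ∃ x₀ > 0, ∃ γ : ℝ, 0 < γ ∧ γ < 1 ∧ ∀ x ≥ x₀, ∀ l : ℝ, 1 ≤ l → U (l * x) ≤ l ^ γ * U x

/-- Concave nondecreasing, `U 0 = 0`, with reasonable asymptotic elasticity at `-∞`. -/
def ElasticAtBot (U : ℝ → ℝ) : Prop :=
  ConcaveOn ℝ Set.univ U ∧ Monotone U ∧ U 0 = 0 ∧
    ∃ x₀ ≤ 0, ∃ α : ℝ, 0 < α ∧ ∀ x ≤ x₀, ∀ l : ℝ, 1 ≤ l → U (l * x) ≤ l ^ (1 + α) * U x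

/-! ### The dynamic value functions -/

/-- `G t x ω` is a regular version of the random functions `U_t(x)`, `0 ≤ t ≤ T`, given by
`U_T = U` and `U_t(x) = ess sup_{ξ ∈ Ξ_t} E(U_{t+1}(x + ⟨ξ, ΔS_{t+1}⟩) | ℱ_t)`. All the
generalized conditional expectations are required to be well defined, all the essential suprema to
be finite, and almost all paths `x ↦ U_t(x)` to be nondecreasing and concave (this makes
`U_{t+1}(x + ⟨ξ, ΔS_{t+1}⟩)` independent of the choice of the version, up to null sets). -/
structure IsValueFunction {Ω : Type*} {mΩ : MeasurableSpace Ω} {d : ℕ} (P : Measure Ω)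
    (ℱ : Filtration ℕ mΩ) (S : ℕ → Ω → EuclideanSpace ℝ (Fin d)) (T : ℕ) (U : ℝ → ℝ)
    (G : ℕ → ℝ → Ω → ℝ) : Prop where
  terminal : ∀ x ω, G T x ω = U x
  measurable : ∀ t ≤ T, ∀ x, Measurable[ℱ t] (G t x)
  regular : ∀ t ≤ T, ∀ᵐ ω ∂P,
    Monotone (fun x => G t x ω) ∧ ConcaveOn ℝ Set.univ (fun x => G t x ω)
  wellDefined : ∀ t < T, ∀ x, ∀ ξ : Ω → EuclideanSpace ℝ (Fin d), Measurable[ℱ t] ξ →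
    CondExpWellDefined P (ℱ t)
      (fun ω => G (t + 1) (x + inner ℝ (ξ ω) (increment S (t + 1) ω)) ω)
  essSup : ∀ t < T, ∀ x,
    IsEssSup P {ξ : Ω → EuclideanSpace ℝ (Fin d) | Measurable[ℱ t] ξ}
      (fun ξ => extCondExp P (ℱ t)
        (fun ω => G (t + 1) (x + inner ℝ (ξ ω) (increment S (t + 1) ω)) ω))
      (fun ω => (G t x ω : EReal))

/-- The value functions `U_t(x)` are well defined and almost surely finite, and `E U_0(x) < ∞`
(that is, `E U_0(x)⁺ < ∞`) for every `x`. -/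
def WellPosed {Ω : Type*} {mΩ : MeasurableSpace Ω} {d : ℕ} (P : Measure Ω)
    (ℱ : Filtration ℕ mΩ) (S : ℕ → Ω → EuclideanSpace ℝ (Fin d)) (T : ℕ) (U : ℝ → ℝ) : Prop :=
  ∃ G : ℕ → ℝ → Ω → ℝ, IsValueFunction P ℱ S T U G ∧
    ∀ x, ∫⁻ ω, ENNReal.ofReal (G 0 x ω) ∂P < ⊤

/-! ### Optimal strategies and the martingale measure -/

/-- `Φ(U, c)`: the strategies for which `E U(V_T^{c,φ})` is well defined. -/
def admissible {Ω : Type*} {mΩ : MeasurableSpace Ω} {d : ℕ} (P : Measure Ω)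
    (ℱ : Filtration ℕ mΩ) (S : ℕ → Ω → EuclideanSpace ℝ (Fin d)) (T : ℕ) (U : ℝ → ℝ) (c : ℝ) :
    Set (ℕ → Ω → EuclideanSpace ℝ (Fin d)) :=
  {φ | IsStrategy ℱ T φ ∧ ExpWellDefined P (fun ω => U (wealth S c φ T ω))}

/-- `u(c) = sup_{φ ∈ Φ(U, c)} E U(V_T^{c,φ})`. -/
def optValue {Ω : Type*} {mΩ : MeasurableSpace Ω} {d : ℕ} (P : Measure Ω)
    (ℱ : Filtration ℕ mΩ) (S : ℕ → Ω → EuclideanSpace ℝ (Fin d)) (T : ℕ) (U : ℝ → ℝ) (c : ℝ) :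
    EReal :=
  ⨆ φ ∈ admissible P ℱ S T U c, extExp P (fun ω => U (wealth S c φ T ω))

/-- `φ` is an optimal strategy with finite value: `φ ∈ Φ(U, c)` and
`u(c) = E U(V_T^{c,φ}) < ∞`. -/
def IsOptimal {Ω : Type*} {mΩ : MeasurableSpace Ω} {d : ℕ} (P : Measure Ω)
    (ℱ : Filtration ℕ mΩ) (S : ℕ → Ω → EuclideanSpace ℝ (Fin d)) (T : ℕ) (U : ℝ → ℝ) (c : ℝ)
    (φ : ℕ → Ω → EuclideanSpace ℝ (Fin d)) : Prop :=
  φ ∈ admissible P ℱ S T U c ∧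
    optValue P ℱ S T U c = extExp P (fun ω => U (wealth S c φ T ω)) ∧
    extExp P (fun ω => U (wealth S c φ T ω)) < ⊤

/-- The measure `Q` with `dQ/dP = U'(V) / E U'(V)`. -/
def marginalMeasure {Ω : Type*} {mΩ : MeasurableSpace Ω} (P : Measure Ω) (U : ℝ → ℝ)
    (V : Ω → ℝ) : Measure Ω :=
  P.withDensity (fun ω => ENNReal.ofReal (deriv U (V ω) / ∫ ω', deriv U (V ω') ∂P))

/-- `Q` is an equivalent martingale measure for `(S_t)_{0 ≤ t ≤ T}`. -/
structure IsEquivMartingaleMeasure {Ω : Type*} {mΩ : MeasurableSpace Ω} {d : ℕ} (P Q : Measure Ω)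
    (ℱ : Filtration ℕ mΩ) (S : ℕ → Ω → EuclideanSpace ℝ (Fin d)) (T : ℕ) : Prop where
  isProbability : IsProbabilityMeasure Q
  absolutelyContinuous : Q ≪ P
  absolutelyContinuous' : P ≪ Q
  integrable : ∀ t ≤ T, Integrable (S t) Q
  martingale : ∀ s t, s ≤ t → t ≤ T → Q[S t | ℱ s] =ᵐ[Q] S s

end UtilityMax

end

/-! The proof is dynamic programming in a class of random utility functions that is stable under one
backward step.

Either elasticity condition, together with concavity and `U 0 = 0`, gives `U (l * x) ≤ l ^ θ * (U x
+ C)` for all `x` and all `l ≥ 1`, with some `θ ≠ 1` (`exists_elasticity`); concavity gives the same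
kind of bound with exponent `1`. Scaling a position by `l` therefore gains at most order `l ^ min 1
θ`, while in a deep enough loss it costs at least order `l ^ max 1 θ`. A `State` is a concave
nondecreasing `g ≥ U` with this elasticity, together with a depth below which `g ≤ -(C + 1)`. States
form a Polish space, so the value function at `t + 1` and the increment have a regular joint
conditional law given `ℱ t`, and for fixed `ω` the one-step problem is deterministic.

In that problem every direction loses a definite amount with a definite probability, so the gap
between the two exponents confines all relevant positions to a ball (`GoodLaw.norm_le_radius`).
Maximizers exist, and the value is again a state (`GoodLaw.next`). All bounds are polynomial in the
constants of the law, so finite moments of all orders pass from `t + 1` to `t` (`ae_goodLaw`,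
`exists_state_stepValue`).

The no-arbitrage bound is assumed for each measurable field of directions, with its own null set. A
countable measurable family, dense in the unit spheres of the conditional spans, makes it hold for
all directions at once (`IsNABound.ae_forall_direction`). That family comes from the second moment
operators of the conditional laws.

Along a strategy whose terminal utility has integrable negative part, the expectation of `U_t(V_t)`
decreases with `t`, so the expected utility is at most `E U_0(c)`. Measurably selected maximizers
attain this bound. Conversely an optimal strategy is optimal at every step, so the a priori bound
gives its wealth finite moments of all orders (`moments_wealth`). This permits differentiating `E
U(V_T + ε Y)` at `ε = 0` for one-period gains `Y`: the density `U'(V_T)` is orthogonal to them,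
which is the martingale property. -/

noncomputable section

namespace UtilityMax

/-! ### Measurable selection of maximizers -/

section Selection

variable {Ω E : Type*} {mΩ : MeasurableSpace Ω} [NormedAddCommGroup E] [NormedSpace ℝ E]
  [FiniteDimensional ℝ E]

/-- For a Carathéodory function, the event that a closed ball contains a maximizer is
measurable. -/
theorem measurableSet_exists_argmax_closedBall (h : Ω → E → ℝ) (hm : ∀ ξ, Measurable (h · ξ))
    (hc : ∀ ω, Continuous (h ω)) (c : E) {r : ℝ} (hr : 0 < r) :
    MeasurableSet {ω | ∃ ξ ∈ Metric.closedBall c r, ∀ η, h ω η ≤ h ω ξ} := by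
  have : ProperSpace E := FiniteDimensional.proper ℝ E
  let q := TopologicalSpace.denseSeq E
  have hq : DenseRange q := TopologicalSpace.denseRange_denseSeq E
  -- By compactness, the ball contains a maximizer iff the supremum over the ball equals the global
  -- one; continuity lets both suprema be computed on a dense sequence.
  have key : {ω | ∃ ξ ∈ Metric.closedBall c r, ∀ η, h ω η ≤ h ω ξ} =
      ⋂ j : ℕ, ⋂ k : ℕ, ⋃ n ∈ {n | q n ∈ Metric.ball c r},
        {ω | h ω (q j) - 1 / ((k : ℝ) + 1) < h ω (q n)} := by
    ext ω
    simp only [Set.mem_ofPred_eq, Set.mem_iInter, Set.mem_iUnion, exists_prop]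
    constructor
    · rintro ⟨ξ, hξ, hξmax⟩ j k
      have hopen : IsOpen {x | h ω ξ - 1 / ((k : ℝ) + 1) < h ω x} :=
        isOpen_lt continuous_const (hc ω)
      have hpos : (0 : ℝ) < 1 / ((k : ℝ) + 1) := by positivity
      have hmem : ξ ∈ closure (Metric.ball c r) := by rwa [closure_ball c hr.ne']
      obtain ⟨y, hy1, hy2⟩ := mem_closure_iff.1 hmem _ hopen
        (by simp only [Set.mem_ofPred_eq]; linarith)
      obtain ⟨n, hn⟩ := hq.exists_mem_open (hopen.inter Metric.isOpen_ball) ⟨y, hy1, hy2⟩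
      refine ⟨n, hn.2, ?_⟩
      have := hn.1
      simp only [Set.mem_ofPred_eq] at this
      linarith [hξmax (q j)]
    · intro hω
      obtain ⟨ξ, hξ, hξmax⟩ := (isCompact_closedBall c r).exists_isMaxOn
        (Metric.nonempty_closedBall.2 hr.le) (hc ω).continuousOn
      refine ⟨ξ, hξ, fun η => ?_⟩
      have hd : ∀ j, h ω (q j) ≤ h ω ξ := by
        intro j
        refine le_of_forall_pos_lt_add fun ε hε => ?_
        obtain ⟨k, hk⟩ := exists_nat_one_div_lt hε
        obtain ⟨n, hn, hlt⟩ := hω j k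
        have := hξmax (Metric.ball_subset_closedBall hn)
        simp only [Set.mem_ofPred_eq] at this
        linarith
      have hclosed : IsClosed {x | h ω x ≤ h ω ξ} := isClosed_le (hc ω) continuous_const
      exact hq.induction_on (p := fun x => h ω x ≤ h ω ξ) η hclosed hd
  rw [key]
  exact MeasurableSet.iInter fun j => MeasurableSet.iInter fun k =>
    MeasurableSet.biUnion (Set.to_countable _) fun n _ =>
      measurableSet_lt ((hm _).sub_const _) (hm _)

/-- A Carathéodory function which attains its maximum has a measurable maximizer. -/
theorem exists_measurable_argmax [MeasurableSpace E] [BorelSpace E] (h : Ω → E → ℝ) (hm : ∀ ξ, Measurable (h · ξ))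
    (hc : ∀ ω, Continuous (h ω)) (hmax : ∀ ω, ∃ ξ, ∀ η, h ω η ≤ h ω ξ) :
    ∃ f : Ω → E, Measurable f ∧ ∀ ω η, h ω η ≤ h ω (f ω) := by
  classical
  have : ProperSpace E := FiniteDimensional.proper ℝ E
  let q := TopologicalSpace.denseSeq E
  have hq : DenseRange q := TopologicalSpace.denseRange_denseSeq E
  let r : ℕ → ℝ := fun k => 2⁻¹ ^ k
  have hr : ∀ k, 0 < r k := fun k => by positivity
  let A : ℕ → E → Ω → Prop := fun k c ω => ∃ ξ ∈ Metric.closedBall c (r k), ∀ η, h ω η ≤ h ω ξ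
  have hA : ∀ k c, MeasurableSet {ω | A k c ω} := fun k c =>
    measurableSet_exists_argmax_closedBall h hm hc c (hr k)
  have near : ∀ (x : E) k, ∃ n, dist x (q n) ≤ r k := fun x k => by
    obtain ⟨n, hn⟩ := hq.exists_dist_lt x (hr k)
    exact ⟨n, hn.le⟩
  have first : ∀ ω, ∃ n, A 0 (q n) ω := fun ω => by
    obtain ⟨ξ, hξ⟩ := hmax ω
    obtain ⟨n, hn⟩ := near ξ 0
    exact ⟨n, ξ, hn, hξ⟩
  -- Successive approximation: a measurable choice within `2⁻¹ ^ k` of some maximizer is refined to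
  -- one twice as close, without moving far. The choices are Cauchy, and nearby maximizers converge
  -- to the same limit.
  have step : ∀ k, ∀ g : {g : Ω → E // Measurable g ∧ ∀ ω, A k (g ω) ω},
      ∃ g' : {g : Ω → E // Measurable g ∧ ∀ ω, A (k + 1) (g ω) ω},
        ∀ ω, dist (g.1 ω) (g'.1 ω) ≤ r k + r (k + 1) := by
    rintro k ⟨g, hg, hgA⟩
    have ex : ∀ ω, ∃ n, A (k + 1) (q n) ω ∧ dist (g ω) (q n) ≤ r k + r (k + 1) := fun ω => by
      obtain ⟨ξ, hξ, hξm⟩ := hgA ω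
      obtain ⟨n, hn⟩ := near ξ (k + 1)
      refine ⟨n, ⟨ξ, hn, hξm⟩, ?_⟩
      rw [Metric.mem_closedBall'] at hξ
      exact (dist_triangle _ ξ _).trans (add_le_add hξ hn)
    refine ⟨⟨fun ω => q (Nat.find (ex ω)), ?_, fun ω => (Nat.find_spec (ex ω)).1⟩,
      fun ω => (Nat.find_spec (ex ω)).2⟩
    refine (measurable_from_nat (f := q)).comp (measurable_find ex fun n => ?_)
    exact (hA (k + 1) (q n)).inter (measurableSet_le (hg.dist measurable_const) measurable_const)
  choose nxt hnxt using step
  let g0 : {g : Ω → E // Measurable g ∧ ∀ ω, A 0 (g ω) ω} :=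
    ⟨fun ω => q (Nat.find (first ω)),
      (measurable_from_nat (f := q)).comp (measurable_find first fun n => hA 0 (q n)),
      fun ω => Nat.find_spec (first ω)⟩
  let G : (k : ℕ) → {g : Ω → E // Measurable g ∧ ∀ ω, A k (g ω) ω} :=
    fun k => Nat.rec g0 (fun k g => nxt k g) k
  have hG : ∀ k ω, dist ((G k).1 ω) ((G (k + 1)).1 ω) ≤ 2 * 2⁻¹ ^ k := fun k ω => by
    refine (hnxt k (G k) ω).trans ?_
    have : (0 : ℝ) < 2⁻¹ ^ k := by positivity
    simp only [r, pow_succ]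
    linarith
  have hcau : ∀ ω, CauchySeq fun k => (G k).1 ω := fun ω =>
    cauchySeq_of_le_geometric _ _ (by norm_num) fun k => hG k ω
  choose f hf using fun ω => cauchySeq_tendsto_of_complete (hcau ω)
  refine ⟨f, measurable_of_tendsto_metrizable (fun k => (G k).2.1) (tendsto_pi_nhds.2 hf),
    fun ω η => ?_⟩
  choose x hx hxm using fun k => (G k).2.2 ω
  have hxf : Filter.Tendsto x Filter.atTop (nhds (f ω)) := by
    refine (hf ω).congr_dist (squeeze_zero (fun _ => dist_nonneg) (g := r) (fun k => ?_) ?_)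
    · exact Metric.mem_closedBall'.1 (hx k)
    · exact tendsto_pow_atTop_nhds_zero_of_lt_one (by norm_num) (by norm_num)
  exact ge_of_tendsto' (((hc ω).tendsto _).comp hxf) fun k => hxm k η
end Selection

/-! ### Random variables with finite moments of all orders -/

section Moments

variable {Ω : Type*} {mΩ : MeasurableSpace Ω} {P : Measure Ω} {X Y : Ω → ℝ}

theorem HasAllMoments.mono (hX : HasAllMoments P X) (hY : AEStronglyMeasurable Y P)
    (h : ∀ᵐ ω ∂P, |Y ω| ≤ |X ω|) : HasAllMoments P Y := fun n =>
  (hX n).mono hY (by simpa [Real.norm_eq_abs] using h)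

theorem HasAllMoments.add (hX : HasAllMoments P X) (hY : HasAllMoments P Y) :
    HasAllMoments P (fun ω => X ω + Y ω) := fun n => (hX n).add (hY n)

theorem HasAllMoments.mul (hX : HasAllMoments P X) (hY : HasAllMoments P Y) :
    HasAllMoments P (fun ω => X ω * Y ω) := fun n => by
  -- Hölder's inequality: order `n` of the product costs order `2 * n` of each factor.
  have : ENNReal.HolderTriple ((2 * n : ℕ) : ℝ≥0∞) ((2 * n : ℕ) : ℝ≥0∞) (n : ℝ≥0∞) := by
    constructor
    push_cast
    rw [ENNReal.mul_inv (by simp) (by simp), ← add_mul, ENNReal.inv_two_add_inv_two, one_mul]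
  exact (hX (2 * n)).mul (hY (2 * n)) (r := (n : ℝ≥0∞)) |>.congr_norm (by
    exact (hX 0).1.mul (hY 0).1) (by simp [mul_comm])

theorem hasAllMoments_const [IsFiniteMeasure P] (c : ℝ) : HasAllMoments P (fun _ => c) :=
  fun _ => memLp_const c

theorem HasAllMoments.pow [IsFiniteMeasure P] (hX : HasAllMoments P X) (j : ℕ) :
    HasAllMoments P (fun ω => X ω ^ j) := by
  induction j with
  | zero => simpa using hasAllMoments_const 1
  | succ j ih => simpa [pow_succ] using ih.mul hX

theorem HasAllMoments.const_mul [IsFiniteMeasure P] (hX : HasAllMoments P X) (c : ℝ) :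
    HasAllMoments P (fun ω => c * X ω) := (hasAllMoments_const c).mul hX

theorem HasAllMoments.abs (hX : HasAllMoments P X) : HasAllMoments P (fun ω => |X ω|) :=
  fun n => (hX n).norm

theorem HasAllMoments.integrable (hX : HasAllMoments P X) : Integrable X P := by
  simpa [memLp_one_iff_integrable] using hX 1

theorem HasAllMoments.condExp [IsFiniteMeasure P] (hX : HasAllMoments P X)
    (m : MeasurableSpace Ω) : HasAllMoments P (P[X|m]) := fun n => by
  rcases Nat.eq_zero_or_pos n with rfl | hn
  · simpa using integrable_condExp.aestronglyMeasurable
  · exact (hX n).condExp (by exact_mod_cast hn)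

end Moments

/-! ### Regular utility functions -/

instance : MeasurableSpace C(ℝ, ℝ) := borel _

instance : BorelSpace C(ℝ, ℝ) := ⟨rfl⟩

/-- A map into the space of continuous functions is measurable as soon as its values at each point
are. -/
theorem measurable_continuousMap_of_eval {Ω : Type*} {mΩ : MeasurableSpace Ω} {f : Ω → C(ℝ, ℝ)}
    (hf : ∀ x, Measurable fun ω => f ω x) : Measurable f := by
  have hcont : Continuous fun (g : C(ℝ, ℝ)) (q : ℚ) => g (q : ℝ) :=
    continuous_pi fun q => continuous_eval_const (q : ℝ)
  have hinj : Function.Injective fun (g : C(ℝ, ℝ)) (q : ℚ) => g (q : ℝ) := fun g₁ g₂ h =>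
    ContinuousMap.coe_injective <| Rat.denseRange_cast.equalizer g₁.continuous g₂.continuous h
  -- A continuous injection between Polish spaces is a measurable embedding (Lusin–Souslin), so
  -- evaluations at rationals generate the Borel sets.
  exact (hcont.measurableEmbedding hinj).measurable_comp_iff.1
    (measurable_pi_iff.2 fun q => hf q)

/-- The parameters of the growth conditions satisfied by `U`: the elasticity exponent `θ` and the
constant `C`, and the polynomial lower bound. -/
structure GrowthData (U : ℝ → ℝ) (θ C L : ℝ) (m : ℕ) : Prop where
  zero : U 0 = 0
  mono : Monotone U
  exponent_pos : 0 < θ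
  exponent_ne_one : θ ≠ 1
  const_nonneg : 0 ≤ C
  lower_nonneg : 0 ≤ L
  lower : ∀ x, -(L * (1 + |x|) ^ m) ≤ U x

/-- The pairs `(g, n)` of a concave nondecreasing function `g ≥ U` of elasticity `θ` and a number
`n ≥ 1` such that `g (-n) ≤ -(C + 1)`. -/
def stateSet (U : ℝ → ℝ) (θ C : ℝ) : Set (C(ℝ, ℝ) × ℝ) :=
  {p | ConcaveOn ℝ Set.univ p.1 ∧ Monotone p.1 ∧ (∀ x, U x ≤ p.1 x) ∧
    (∀ x l : ℝ, 1 ≤ l → p.1 (l * x) ≤ l ^ θ * (p.1 x + C)) ∧ 1 ≤ p.2 ∧ p.1 (-p.2) ≤ -(C + 1)}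

theorem isClosed_stateSet (U : ℝ → ℝ) (θ C : ℝ) : IsClosed (stateSet U θ C) := by
  have ev : ∀ x : ℝ, Continuous fun p : C(ℝ, ℝ) × ℝ => p.1 x := fun x =>
    (continuous_eval_const x).comp continuous_fst
  have h1 : IsClosed {p : C(ℝ, ℝ) × ℝ | ConcaveOn ℝ Set.univ p.1} := by
    simp only [ConcaveOn, convex_univ, true_and, Set.mem_univ, forall_true_left,
      Set.ofPred_forall]
    refine isClosed_iInter fun x => isClosed_iInter fun y => isClosed_iInter fun a =>
      isClosed_iInter fun b => isClosed_iInter fun _ => isClosed_iInter fun _ =>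
      isClosed_iInter fun _ => isClosed_le ?_ (ev _)
    exact ((ev x).const_smul a).add ((ev y).const_smul b)
  have h2 : IsClosed {p : C(ℝ, ℝ) × ℝ | Monotone p.1} := by
    simp only [Monotone, Set.ofPred_forall]
    exact isClosed_iInter fun x => isClosed_iInter fun y => isClosed_iInter fun _ =>
      isClosed_le (ev _) (ev _)
  have h3 : IsClosed {p : C(ℝ, ℝ) × ℝ | ∀ x, U x ≤ p.1 x} := by
    simp only [Set.ofPred_forall]
    exact isClosed_iInter fun x => isClosed_le continuous_const (ev _)
  have h4 : IsClosed {p : C(ℝ, ℝ) × ℝ |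
      ∀ x l : ℝ, 1 ≤ l → p.1 (l * x) ≤ l ^ θ * (p.1 x + C)} := by
    simp only [Set.ofPred_forall]
    exact isClosed_iInter fun x => isClosed_iInter fun l => isClosed_iInter fun _ =>
      isClosed_le (ev _) (((ev _).add continuous_const).const_mul _)
  have h5 : IsClosed {p : C(ℝ, ℝ) × ℝ | 1 ≤ p.2} := isClosed_le continuous_const continuous_snd
  have h6 : IsClosed {p : C(ℝ, ℝ) × ℝ | p.1 (-p.2) ≤ -(C + 1)} :=
    isClosed_le (ContinuousEval.continuous_eval.comp
      (continuous_fst.prodMk continuous_snd.neg)) continuous_const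
  exact h1.inter (h2.inter (h3.inter (h4.inter (h5.inter h6))))

/-- The space of regular utility functions together with a level at which they are below
`-(C + 1)`. -/
abbrev State (U : ℝ → ℝ) (θ C : ℝ) := ↥(stateSet U θ C)

instance (U : ℝ → ℝ) (θ C : ℝ) : PolishSpace (State U θ C) := (isClosed_stateSet U θ C).polishSpace

/-! ### Growth estimates common to all states. -/

namespace State

variable {U : ℝ → ℝ} {θ C L : ℝ} {m : ℕ} (s : State U θ C)

/-- The utility function of a state. -/
abbrev fn : ℝ → ℝ := s.1.1

/-- The level at which the utility is below `-(C + 1)`. -/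
abbrev depth : ℝ := s.1.2

theorem concave : ConcaveOn ℝ Set.univ s.fn := s.2.1

theorem mono : Monotone s.fn := s.2.2.1

theorem le_fn (x : ℝ) : U x ≤ s.fn x := s.2.2.2.1 x

theorem elastic (x : ℝ) {l : ℝ} (hl : 1 ≤ l) : s.fn (l * x) ≤ l ^ θ * (s.fn x + C) :=
  s.2.2.2.2.1 x l hl

theorem one_le_depth : 1 ≤ s.depth := s.2.2.2.2.2.1

theorem fn_neg_depth : s.fn (-s.depth) ≤ -(C + 1) := s.2.2.2.2.2.2

theorem fn_zero_nonneg (hU : GrowthData U θ C L m) : 0 ≤ s.fn 0 := hU.zero.symm.le.trans (s.le_fn 0)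

theorem fn_one_nonneg (hU : GrowthData U θ C L m) : 0 ≤ s.fn 1 :=
  (s.fn_zero_nonneg hU).trans (s.mono zero_le_one)

/-- Concavity on the segment from `0` to `l * x`, where the value at `0` is at least `U 0 = 0`. -/
theorem fn_mul_le (hU : GrowthData U θ C L m) (x : ℝ) {l : ℝ} (hl : 1 ≤ l) :
    s.fn (l * x) ≤ l * s.fn x := by
  have hl0 : 0 < l := by linarith
  have h := s.concave.2 (Set.mem_univ (l * x)) (Set.mem_univ 0) (show (0 : ℝ) ≤ l⁻¹ by positivity)
    (show (0 : ℝ) ≤ 1 - l⁻¹ by linarith [inv_le_one_of_one_le₀ hl]) (by ring)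
  simp only [smul_eq_mul, mul_zero, add_zero] at h
  rw [inv_mul_cancel_left₀ hl0.ne'] at h
  have h0 : 0 ≤ (1 - l⁻¹) * s.fn 0 :=
    mul_nonneg (by linarith [inv_le_one_of_one_le₀ hl]) (s.fn_zero_nonneg hU)
  have h1 : l⁻¹ * s.fn (l * x) ≤ s.fn x := by linarith
  rwa [inv_mul_le_iff₀ hl0] at h1

theorem fn_le (hU : GrowthData U θ C L m) (x : ℝ) : s.fn x ≤ (1 + |x|) * s.fn 1 := by
  have h := s.fn_mul_le hU 1 (l := 1 + |x|) (by linarith [abs_nonneg x])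
  rw [mul_one] at h
  exact (s.mono (by linarith [le_abs_self x])).trans h

theorem abs_fn_le (hU : GrowthData U θ C L m) (x : ℝ) :
    |s.fn x| ≤ (1 + |x|) * s.fn 1 + L * (1 + |x|) ^ m := by
  have h1 := s.fn_le hU x
  have h2 := (hU.lower x).trans (s.le_fn x)
  have h3 : 0 ≤ L * (1 + |x|) ^ m := mul_nonneg hU.lower_nonneg (by positivity)
  have h4 : 0 ≤ (1 + |x|) * s.fn 1 := mul_nonneg (by positivity) (s.fn_one_nonneg hU)
  exact abs_le.2 ⟨by linarith, by linarith⟩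

/-- The gain side: of concavity (exponent `1`) and elasticity (exponent `θ`), the smaller exponent
is used. -/
theorem fn_mul_le_rpow_min (hU : GrowthData U θ C L m) (x : ℝ) {l : ℝ} (hl : 1 ≤ l) :
    s.fn (l * x) ≤ l ^ min 1 θ * ((1 + |x|) * s.fn 1 + C) := by
  rcases le_total 1 θ with h | h
  · rw [min_eq_left h, Real.rpow_one]
    refine (s.fn_mul_le hU x hl).trans (mul_le_mul_of_nonneg_left ?_ (by linarith))
    linarith [s.fn_le hU x, hU.const_nonneg]
  · rw [min_eq_right h]
    refine (s.elastic x hl).trans (mul_le_mul_of_nonneg_left ?_ (by positivity))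
    linarith [s.fn_le hU x]

/-- The loss side, with the larger exponent. The level `-(C + 1)` is chosen so that the factor `g
(-depth) + C` in the elasticity estimate is at most `-1`. -/
theorem fn_neg_mul_depth (hU : GrowthData U θ C L m) {l : ℝ} (hl : 1 ≤ l) :
    s.fn (-(l * s.depth)) ≤ -l ^ max 1 θ := by
  have hd := s.fn_neg_depth
  rw [← mul_neg]
  rcases le_total 1 θ with h | h
  · rw [max_eq_right h]
    refine (s.elastic _ hl).trans ?_
    have : (0 : ℝ) ≤ l ^ θ := by positivity
    nlinarith
  · rw [max_eq_left h, Real.rpow_one]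
    refine (s.fn_mul_le hU _ hl).trans ?_
    nlinarith [hU.const_nonneg]

theorem fn_neg_mul_depth_le (hU : GrowthData U θ C L m) {l : ℝ} (hl : 1 ≤ l) :
    s.fn (-(l * s.depth)) ≤ -l := by
  refine (s.fn_neg_mul_depth hU hl).trans (neg_le_neg ?_)
  simpa using Real.rpow_le_rpow_of_exponent_le hl (le_max_left 1 θ)

theorem continuous_fn_uncurry : Continuous fun p : State U θ C × ℝ => p.1.fn p.2 :=
  ContinuousEval.continuous_eval.comp
    ((continuous_fst.comp (continuous_subtype_val.comp continuous_fst)).prodMk continuous_snd)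

theorem continuous_depth : Continuous fun p : State U θ C => p.depth :=
  continuous_snd.comp continuous_subtype_val

end State

/-! ### The one-step problem -/

section OneStep

variable {U : ℝ → ℝ} {θ C L : ℝ} {m : ℕ}
  {E : Type*} [NormedAddCommGroup E] [InnerProductSpace ℝ E] [FiniteDimensional ℝ E]
  [MeasurableSpace E] [BorelSpace E]

/-- A joint law of a regular utility function and an increment, whose integrability and
no-arbitrage constants are controlled by `A`. -/
structure GoodLaw (m : ℕ) (A : ℝ) (μ : Measure (State U θ C × E)) : Prop where
  one_le : 1 ≤ A
  integrable_pow : Integrable (fun z => (1 + ‖z.2‖) ^ m) μ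
  integrable_fn_one : Integrable (fun z => (1 + ‖z.2‖) * z.1.fn 1) μ
  integral_fn_one : ∫ z, (1 + ‖z.2‖) * z.1.fn 1 ∂μ ≤ A
  integrable_norm : Integrable (fun z => ‖z.2‖) μ
  integral_norm : ∫ z, ‖z.2‖ ∂μ ≤ A
  integrable_depth : Integrable (fun z => z.1.depth) μ
  integral_depth : ∫ z, z.1.depth ∂μ ≤ A
  noArbitrage : ∃ L : Submodule ℝ E, (∀ᵐ z ∂μ, z.2 ∈ L) ∧
    ∀ p ∈ L, ‖p‖ = 1 → 1 / A ≤ μ.real {z | inner ℝ p z.2 ≤ -(1 / A)}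

/-- The expected utility `∫ g (x + ⟨ξ, y⟩) dμ` under a joint law of utility and increment. -/
def expUtility (μ : Measure (State U θ C × E)) (x : ℝ) (ξ : E) : ℝ :=
  ∫ z, z.1.fn (x + inner ℝ ξ z.2) ∂μ

/-- The value `sup_ξ ∫ g (x + ⟨ξ, y⟩) dμ` of the one-step problem. -/
def stepValue (μ : Measure (State U θ C × E)) (x : ℝ) : ℝ := ⨆ ξ, expUtility μ x ξ

/-- The base of the power `radius`. -/
def radiusBase (θ C A x W : ℝ) : ℝ :=
  2 * ((1 + max x 0) * (A + C) + W) * A * (4 * A ^ 3) ^ (⌈max 1 θ⌉₊)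

/-- An a priori bound for strategies whose expected utility is at least `-W`. -/
def radius (θ C A x W : ℝ) : ℝ := radiusBase θ C A x W ^ (⌈(max 1 θ - min 1 θ)⁻¹⌉₊)

/-- A level at which the value of the one-step problem is below `-(C + 1)`. -/
def nextDepth (θ C A : ℝ) : ℝ :=
  16 * A * ((1 + radius θ C A 0 (C + 1)) * A + C + 1) + 8 * radius θ C A 0 (C + 1) * A + 8 * A + 1

theorem State.measurable_fn_inner :
    Measurable fun p : (ℝ × E) × (State U θ C × E) =>
      p.2.1.fn (p.1.1 + inner ℝ p.1.2 p.2.2) := by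
  refine Continuous.measurable ?_
  refine State.continuous_fn_uncurry.comp ((continuous_fst.comp continuous_snd).prodMk ?_)
  fun_prop

theorem State.measurable_fn_inner' (x : ℝ) (ξ : E) :
    Measurable fun z : State U θ C × E => z.1.fn (x + inner ℝ ξ z.2) :=
  State.measurable_fn_inner.comp (measurable_const (a := ((x, ξ) : ℝ × E)) |>.prodMk measurable_id)

theorem one_le_radiusBase {A x W : ℝ} (hA : 1 ≤ A) (hC : 0 ≤ C) (hW : 0 ≤ W) :
    1 ≤ radiusBase θ C A x W := by
  have h1 : (1 : ℝ) ≤ (4 * A ^ 3) ^ (⌈max 1 θ⌉₊) :=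
    one_le_pow₀ (by nlinarith [one_le_pow₀ hA (n := 3)])
  have h2 : 1 ≤ 2 * ((1 + max x 0) * (A + C) + W) := by nlinarith [le_max_right x 0]
  exact one_le_mul_of_one_le_of_one_le (one_le_mul_of_one_le_of_one_le h2 hA) h1

theorem radius_exponent_pos (hU : GrowthData U θ C L m) : 0 < max 1 θ - min 1 θ := by
  rcases lt_or_gt_of_ne hU.exponent_ne_one with h | h
  · rw [max_eq_left h.le, min_eq_right h.le]; linarith
  · rw [max_eq_right h.le, min_eq_left h.le]; linarith

theorem radiusBase_le_radius (hU : GrowthData U θ C L m) {A x W : ℝ} (hA : 1 ≤ A) (hW : 0 ≤ W) :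
    radiusBase θ C A x W ≤ radius θ C A x W := by
  refine le_self_pow₀ (one_le_radiusBase hA hU.const_nonneg hW) ?_
  have := Nat.ceil_pos.2 (inv_pos.2 (radius_exponent_pos hU))
  omega

theorem radius_nonneg (hU : GrowthData U θ C L m) {A x W : ℝ} (hA : 1 ≤ A) (hW : 0 ≤ W) :
    0 ≤ radius θ C A x W :=
  pow_nonneg (zero_le_one.trans (one_le_radiusBase hA hU.const_nonneg hW)) _

/-- If `l` exceeds `radius θ C A x W`, then the loss of order `l ^ max 1 θ` dominates the gain of
order `l ^ min 1 θ`. -/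
theorem gain_lt_loss (hU : GrowthData U θ C L m) {A x W l : ℝ} (hA : 1 ≤ A) (hW : 0 ≤ W)
    (hl : radius θ C A x W < l) :
    l ^ min 1 θ * ((1 + max x 0) * A + C) + W < 1 / (2 * A) * (l / (4 * A ^ 3)) ^ max 1 θ := by
  have hT1 := one_le_radiusBase (θ := θ) (x := x) hA hU.const_nonneg hW
  have hTR := radiusBase_le_radius (x := x) hU hA hW
  have hl1 : 1 < l := by linarith
  have hl0 : 0 < l := by linarith
  have hA0 : 0 < A := by linarith
  have hab := radius_exponent_pos hU
  set a := min 1 θ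
  set b := max 1 θ
  set T := radiusBase θ C A x W with hT
  have ha : 0 ≤ a := le_min zero_le_one hU.exponent_pos.le
  have hb : 0 ≤ b := zero_le_one.trans (le_max_left 1 θ)
  -- The ceiling in the definition of `radius` is at least `(b - a)⁻¹`, and the base is at least
  -- `1`.
  have h1 : T < l ^ (b - a) := by
    have e1 : T ≤ (radius θ C A x W) ^ (b - a) := by
      rw [radius, ← hT, ← Real.rpow_natCast, ← Real.rpow_mul (by linarith)]
      nth_rewrite 1 [← Real.rpow_one T]
      refine Real.rpow_le_rpow_of_exponent_le hT1 ?_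
      calc (1 : ℝ) = (b - a)⁻¹ * (b - a) := (inv_mul_cancel₀ hab.ne').symm
        _ ≤ _ := mul_le_mul_of_nonneg_right (Nat.le_ceil _) hab.le
    exact e1.trans_lt (Real.rpow_lt_rpow (radius_nonneg hU hA hW) hl hab)
  have hs : (4 * A ^ 3) ^ b ≤ (4 * A ^ 3) ^ (⌈b⌉₊) := by
    rw [← Real.rpow_natCast (4 * A ^ 3)]
    exact Real.rpow_le_rpow_of_exponent_le (by nlinarith [one_le_pow₀ hA (n := 3)])
      (Nat.le_ceil _)
  have hs0 : 0 < (4 * A ^ 3) ^ b := by positivity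
  have hla : 1 ≤ l ^ a := Real.one_le_rpow hl1.le ha
  have hx := le_max_right x 0
  have hQ : 0 ≤ (1 + max x 0) * (A + C) := by
    have := hU.const_nonneg
    positivity
  have h2 : l ^ a * ((1 + max x 0) * A + C) + W ≤ l ^ a * ((1 + max x 0) * (A + C) + W) := by
    have e1 : l ^ a * ((1 + max x 0) * A + C) ≤ l ^ a * ((1 + max x 0) * (A + C)) :=
      mul_le_mul_of_nonneg_left (by nlinarith [hU.const_nonneg]) (by linarith)
    nlinarith
  have h3 : 2 * ((1 + max x 0) * (A + C) + W) * A * (4 * A ^ 3) ^ b < l ^ (b - a) :=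
    lt_of_le_of_lt (mul_le_mul_of_nonneg_left hs (by positivity)) h1
  have h4 : l ^ b = l ^ a * l ^ (b - a) := by rw [← Real.rpow_add hl0]; ring_nf
  rw [Real.div_rpow hl0.le (by positivity), h4]
  refine h2.trans_lt ?_
  rw [div_mul_div_comm, one_mul, lt_div_iff₀ (by positivity)]
  have := mul_lt_mul_of_pos_left h3 (show 0 < l ^ a by linarith)
  linarith

theorem expUtility_congr {μ : Measure (State U θ C × E)} {x : ℝ} {ξ η : E}
    (h : ∀ᵐ z ∂μ, (inner ℝ ξ z.2 : ℝ) = inner ℝ η z.2) :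
    expUtility μ x ξ = expUtility μ x η :=
  integral_congr_ae (h.mono fun z hz => by simp only [hz])

/-! ### A priori bounds, maximizers, and stability of the class of states. -/

namespace GoodLaw

variable {A : ℝ} {μ : Measure (State U θ C × E)} [IsProbabilityMeasure μ]

theorem integrable_fn (hU : GrowthData U θ C L m) (h : GoodLaw m A μ) (x : ℝ) (ξ : E) :
    Integrable (fun z => z.1.fn (x + inner ℝ ξ z.2)) μ := by
  have key : ∀ z : State U θ C × E, 1 + |x + inner ℝ ξ z.2| ≤ (1 + |x| + ‖ξ‖) * (1 + ‖z.2‖) := by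
    intro z
    have h1 := abs_add_le x (inner ℝ ξ z.2)
    have h2 := abs_real_inner_le_norm ξ z.2
    nlinarith [norm_nonneg ξ, norm_nonneg z.2, abs_nonneg x,
      mul_nonneg (abs_nonneg x) (norm_nonneg z.2)]
  refine ((h.integrable_fn_one.const_mul (1 + |x| + ‖ξ‖)).add
    (h.integrable_pow.const_mul (L * (1 + |x| + ‖ξ‖) ^ m))).mono'
    (State.measurable_fn_inner' x ξ).aestronglyMeasurable (ae_of_all _ fun z => ?_)
  refine (z.1.abs_fn_le hU _).trans (add_le_add ?_ ?_)
  · simp only [← mul_assoc]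
    exact mul_le_mul_of_nonneg_right (key z) (z.1.fn_one_nonneg hU)
  · simp only [mul_assoc, ← mul_pow]
    exact mul_le_mul_of_nonneg_left (pow_le_pow_left₀ (by positivity) (key z) _) hU.lower_nonneg

theorem expUtility_zero_ge (hU : GrowthData U θ C L m) (h : GoodLaw m A μ) (x : ℝ) :
    U x ≤ expUtility μ x 0 := by
  have : ∫ _z, U x ∂μ ≤ expUtility μ x 0 :=
    integral_mono (integrable_const _) (h.integrable_fn hU x 0) fun z => by
      simpa using z.1.le_fn x
  simpa using this

/-- The a priori bound on strategies. -/
theorem norm_le_radius (hU : GrowthData U θ C L m) (h : GoodLaw m A μ) {ξ : E}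
    (hξ : ‖ξ‖ ≠ 0 → 1 / A ≤ μ.real {z | inner ℝ (‖ξ‖⁻¹ • ξ) z.2 ≤ -(1 / A)})
    {x W : ℝ} (hW : 0 ≤ W) (hle : -W ≤ expUtility μ x ξ) : ‖ξ‖ ≤ radius θ C A x W := by
  by_contra! hlt
  have hA := h.one_le
  have hA0 : 0 < A := by linarith
  have hC := hU.const_nonneg
  have hT1 := one_le_radiusBase (θ := θ) (x := x) hA hC hW
  have hTR := radiusBase_le_radius (x := x) hU hA hW
  have hA3 : 1 ≤ A ^ 3 := one_le_pow₀ hA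
  have hx0 := le_max_right x 0
  set l := ‖ξ‖ with hl_def
  have hl1 : 1 ≤ l := by linarith
  have hl0 : 0 < l := by linarith
  have hpow : 4 * A ^ 3 ≤ (4 * A ^ 3) ^ (⌈max 1 θ⌉₊) :=
    le_self_pow₀ (by linarith) (by
      have : 0 < ⌈max 1 θ⌉₊ := Nat.ceil_pos.2 (lt_of_lt_of_le one_pos (le_max_left 1 θ))
      omega)
  have hT2 : 2 * (1 + max x 0) * A * (4 * A ^ 3) ≤ radiusBase θ C A x W := by
    unfold radiusBase
    refine mul_le_mul ?_ hpow (by positivity) (by positivity)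
    refine mul_le_mul_of_nonneg_right ?_ hA0.le
    nlinarith [mul_nonneg (show 0 ≤ 1 + max x 0 by linarith) (show 0 ≤ A + C - 1 by linarith)]
  have hl2 : 2 * max x 0 * A ≤ l := by
    have : 2 * max x 0 * A ≤ 2 * (1 + max x 0) * A * (4 * A ^ 3) := by
      have e : 2 * max x 0 * A ≤ 2 * (1 + max x 0) * A := by nlinarith
      have e2 : 0 ≤ 2 * (1 + max x 0) * A := by positivity
      nlinarith
    linarith
  have hl3 : 4 * A ^ 3 ≤ l := by
    have : 4 * A ^ 3 ≤ 2 * (1 + max x 0) * A * (4 * A ^ 3) := by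
      have e : 1 ≤ 2 * (1 + max x 0) * A := by nlinarith
      nlinarith
    linarith
  -- On `B₁ \ B₂` the position loses at least `l / A`, of which at most half is covered by `x`, and
  -- the depth is below `2 * A ^ 2`: the wealth is at most `-(l / (4 * A ^ 3))` times the depth.
  -- Markov's inequality gives `B₂` mass at most `1 / (2 * A)`, half of the mass guaranteed for
  -- `B₁`.
  set p : E := l⁻¹ • ξ with hp
  set B₁ : Set (State U θ C × E) := {z | inner ℝ p z.2 ≤ -(1 / A)} with hB₁
  set B₂ : Set (State U θ C × E) := {z | 2 * A ^ 2 ≤ z.1.depth} with hB₂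
  have hmB₁ : MeasurableSet B₁ :=
    measurableSet_le (by fun_prop) measurable_const
  have hmB₂ : MeasurableSet B₂ := measurableSet_le measurable_const
    ((State.continuous_depth.comp continuous_fst).measurable)
  have hPB₂ : μ.real B₂ ≤ 1 / (2 * A) := by
    have e := mul_meas_ge_le_integral_of_nonneg (ae_of_all μ fun z : State U θ C × E =>
      zero_le_one.trans z.1.one_le_depth) h.integrable_depth (2 * A ^ 2)
    have e2 := e.trans h.integral_depth
    rw [le_div_iff₀ (by positivity)]
    have : A * (μ.real B₂ * (2 * A)) ≤ A * 1 := by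
      rw [mul_one]
      refine le_trans (le_of_eq ?_) e2
      ring
    exact le_of_mul_le_mul_left this hA0
  have hPB : 1 / (2 * A) ≤ μ.real (B₁ \ B₂) := by
    have e := measureReal_sdiff_add_inter (μ := μ) (s := B₁) hmB₂
    have e2 : μ.real (B₁ ∩ B₂) ≤ μ.real B₂ := measureReal_mono Set.inter_subset_right
    have e3 := hξ hl0.ne'
    have e4 : 1 / A = 1 / (2 * A) + 1 / (2 * A) := by field_simp; norm_num
    linarith
  set D : ℝ := (l / (4 * A ^ 3)) ^ max 1 θ with hD
  have hD0 : 0 ≤ D := by positivity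
  -- The gain bound holds everywhere and is nonnegative, so the loss `D` can be subtracted from it
  -- on `B₁ \ B₂`.
  have hpt : ∀ z : State U θ C × E, z.1.fn (x + inner ℝ ξ z.2) ≤
      l ^ min 1 θ * ((1 + max x 0) * ((1 + ‖z.2‖) * z.1.fn 1) + C)
        - (B₁ \ B₂).indicator (fun _ => D) z := by
    intro z
    have hf1 := z.1.fn_one_nonneg hU
    by_cases hz : z ∈ B₁ \ B₂
    · rw [Set.indicator_of_mem hz]
      have hz1 : inner ℝ p z.2 ≤ -(1 / A) := hz.1
      have hz2 : z.1.depth < 2 * A ^ 2 := not_le.1 hz.2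
      have hd := z.1.one_le_depth
      have hin : inner ℝ ξ z.2 ≤ -(l / A) := by
        have : inner ℝ ξ z.2 = l * inner ℝ p z.2 := by
          rw [hp, real_inner_smul_left, mul_inv_cancel_left₀ hl0.ne']
        rw [this]
        calc l * inner ℝ p z.2 ≤ l * (-(1 / A)) := mul_le_mul_of_nonneg_left hz1 hl0.le
          _ = -(l / A) := by ring
      have hxl : x ≤ l / (2 * A) := by
        rw [le_div_iff₀ (by positivity)]
        nlinarith [le_max_left x 0]
      have hlA : l / A = l / (2 * A) + l / (2 * A) := by field_simp; norm_num
      have hq : l / (4 * A ^ 3) ≤ l / (2 * A * z.1.depth) := by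
        refine div_le_div_of_nonneg_left hl0.le (by positivity) ?_
        nlinarith
      have hq1 : 1 ≤ l / (4 * A ^ 3) := by rwa [one_le_div (by positivity)]
      have e1 : z.1.fn (x + inner ℝ ξ z.2) ≤ z.1.fn (-(l / (2 * A * z.1.depth) * z.1.depth)) := by
        refine z.1.mono ?_
        have : l / (2 * A * z.1.depth) * z.1.depth = l / (2 * A) := by field_simp
        rw [this]; linarith
      have e2 := z.1.fn_neg_mul_depth hU (hq1.trans hq)
      have e3 : D ≤ (l / (2 * A * z.1.depth)) ^ max 1 θ :=
        Real.rpow_le_rpow (by positivity) hq (zero_le_one.trans (le_max_left 1 θ))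
      have e4 : 0 ≤ l ^ min 1 θ * ((1 + max x 0) * ((1 + ‖z.2‖) * z.1.fn 1) + C) := by positivity
      linarith
    · rw [Set.indicator_of_notMem hz, sub_zero]
      have hin := real_inner_le_norm ξ z.2
      have e1 : z.1.fn (x + inner ℝ ξ z.2) ≤ z.1.fn (l * (max x 0 + ‖z.2‖)) := by
        refine z.1.mono ?_
        nlinarith [le_max_left x 0]
      refine e1.trans ((z.1.fn_mul_le_rpow_min hU _ hl1).trans
        (mul_le_mul_of_nonneg_left ?_ (by positivity)))
      rw [abs_of_nonneg (by positivity), ← mul_assoc]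
      have : 1 + (max x 0 + ‖z.2‖) ≤ (1 + max x 0) * (1 + ‖z.2‖) := by
        nlinarith [mul_nonneg hx0 (norm_nonneg z.2)]
      linarith [mul_le_mul_of_nonneg_right this hf1]
  have hI1 : Integrable (fun z : State U θ C × E =>
      l ^ min 1 θ * ((1 + max x 0) * ((1 + ‖z.2‖) * z.1.fn 1) + C)) μ :=
    ((h.integrable_fn_one.const_mul _).add (integrable_const C)).const_mul _
  have hI2 : Integrable ((B₁ \ B₂).indicator (fun _ => D)) μ :=
    (integrable_const D).indicator (hmB₁.diff hmB₂)
  have hint : expUtility μ x ξ ≤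
      l ^ min 1 θ * ((1 + max x 0) * A + C) - 1 / (2 * A) * D := by
    refine (integral_mono (h.integrable_fn hU x ξ) (hI1.sub hI2) hpt).trans ?_
    simp only [Pi.sub_apply]
    rw [integral_sub hI1 hI2, integral_const_mul,
      integral_add (h.integrable_fn_one.const_mul _) (integrable_const C), integral_const_mul,
      integral_indicator_const _ (hmB₁.diff hmB₂)]
    simp only [integral_const, probReal_univ, smul_eq_mul, one_mul]
    refine sub_le_sub (mul_le_mul_of_nonneg_left ?_ (by positivity))
      (mul_le_mul_of_nonneg_right hPB hD0)
    linarith [mul_le_mul_of_nonneg_left h.integral_fn_one (show 0 ≤ 1 + max x 0 by linarith)]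
  have := gain_lt_loss hU hA hW hlt
  linarith

theorem expUtility_concave (hU : GrowthData U θ C L m) (h : GoodLaw m A μ) {x₁ x₂ : ℝ}
    {ξ₁ ξ₂ : E} {a b : ℝ} (ha : 0 ≤ a) (hb : 0 ≤ b) (hab : a + b = 1) :
    a * expUtility μ x₁ ξ₁ + b * expUtility μ x₂ ξ₂ ≤
      expUtility μ (a * x₁ + b * x₂) (a • ξ₁ + b • ξ₂) := by
  unfold expUtility
  rw [← integral_const_mul, ← integral_const_mul, ← integral_add
    ((h.integrable_fn hU x₁ ξ₁).const_mul a) ((h.integrable_fn hU x₂ ξ₂).const_mul b)]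
  refine integral_mono (((h.integrable_fn hU x₁ ξ₁).const_mul a).add
    ((h.integrable_fn hU x₂ ξ₂).const_mul b)) (h.integrable_fn hU _ _) fun z => ?_
  have := z.1.concave.2 (Set.mem_univ (x₁ + inner ℝ ξ₁ z.2)) (Set.mem_univ (x₂ + inner ℝ ξ₂ z.2))
    ha hb hab
  simp only [smul_eq_mul] at this
  refine this.trans (le_of_eq ?_)
  rw [inner_add_left, real_inner_smul_left, real_inner_smul_left]
  ring_nf

/-- A finite concave function on a finite-dimensional space is continuous. -/
theorem continuous_expUtility (hU : GrowthData U θ C L m) (h : GoodLaw m A μ) (x : ℝ) :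
    Continuous (expUtility μ x) := by
  rw [← continuousOn_univ]
  refine ConcaveOn.continuousOn isOpen_univ ⟨convex_univ, fun ξ₁ _ ξ₂ _ a b ha hb hab => ?_⟩
  have := h.expUtility_concave hU (x₁ := x) (x₂ := x) (ξ₁ := ξ₁) (ξ₂ := ξ₂) ha hb hab
  rwa [← add_mul, hab, one_mul] at this

omit [BorelSpace E] [IsProbabilityMeasure μ] in
/-- Every strategy can be replaced by one satisfying the no-arbitrage bound. -/
theorem exists_reduced (h : GoodLaw m A μ) (ξ : E) :
    ∃ η : E, (∀ᵐ z ∂μ, (inner ℝ ξ z.2 : ℝ) = inner ℝ η z.2) ∧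
      (‖η‖ ≠ 0 → 1 / A ≤ μ.real {z | inner ℝ (‖η‖⁻¹ • η) z.2 ≤ -(1 / A)}) := by
  obtain ⟨L, hL, hna⟩ := h.noArbitrage
  -- Projecting to the subspace carrying the increments leaves almost all gains unchanged and puts
  -- the direction where the no-arbitrage bound applies.
  refine ⟨L.starProjection ξ, ?_, fun hne => hna _ (L.smul_mem _ (by simp)) ?_⟩
  · filter_upwards [hL] with z hz
    have := Submodule.inner_starProjection_left_eq_right L ξ z.2
    rw [this, Submodule.starProjection_eq_self_iff.2 hz]
  · rw [norm_smul, norm_inv, norm_norm, inv_mul_cancel₀ hne]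

/-- `W` is such that the zero position has utility at least `-W`. Anything below `-W` is beaten by
zero; anything else lies, after reduction, in a compact ball. -/
theorem exists_max (hU : GrowthData U θ C L m) (h : GoodLaw m A μ) (x : ℝ) :
    ∃ ξ, ∀ η, expUtility μ x η ≤ expUtility μ x ξ := by
  have : ProperSpace E := FiniteDimensional.proper ℝ E
  set W := max 0 (-expUtility μ x 0)
  have hW : 0 ≤ W := le_max_left _ _
  have hW' : -W ≤ expUtility μ x 0 := by linarith [le_max_right 0 (-expUtility μ x 0)]
  obtain ⟨ξ, -, hξ⟩ := (isCompact_closedBall (0 : E) (radius θ C A x W)).exists_isMaxOn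
    (Metric.nonempty_closedBall.2 (radius_nonneg hU h.one_le hW))
    (h.continuous_expUtility hU x).continuousOn
  have h0 : expUtility μ x 0 ≤ expUtility μ x ξ :=
    hξ (Metric.mem_closedBall_self (radius_nonneg hU h.one_le hW))
  refine ⟨ξ, fun η => ?_⟩
  obtain ⟨η', hη', hna⟩ := h.exists_reduced η
  rw [expUtility_congr hη']
  by_cases hle : -W ≤ expUtility μ x η'
  · exact hξ (by simpa using h.norm_le_radius hU hna hW hle)
  · linarith

/-- The a priori bound on the increments of the wealth. -/
theorem ae_abs_inner_le (hU : GrowthData U θ C L m) (h : GoodLaw m A μ) {ξ : E} {x W : ℝ}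
    (hW : 0 ≤ W) (hle : -W ≤ expUtility μ x ξ) :
    ∀ᵐ z ∂μ, |inner ℝ ξ z.2| ≤ radius θ C A x W * ‖z.2‖ := by
  obtain ⟨η, hη, hna⟩ := h.exists_reduced ξ
  rw [expUtility_congr hη] at hle
  have hn := h.norm_le_radius hU hna hW hle
  filter_upwards [hη] with z hz
  rw [hz]
  exact (abs_real_inner_le_norm _ _).trans (mul_le_mul_of_nonneg_right hn (norm_nonneg _))

theorem bddAbove_expUtility (hU : GrowthData U θ C L m) (h : GoodLaw m A μ) (x : ℝ) :
    BddAbove (Set.range (expUtility μ x)) := by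
  obtain ⟨ξ, hξ⟩ := h.exists_max hU x
  exact ⟨_, Set.forall_mem_range.2 hξ⟩

theorem expUtility_le_stepValue (hU : GrowthData U θ C L m) (h : GoodLaw m A μ) (x : ℝ) (ξ : E) :
    expUtility μ x ξ ≤ stepValue μ x := le_ciSup (h.bddAbove_expUtility hU x) ξ

theorem exists_eq_stepValue (hU : GrowthData U θ C L m) (h : GoodLaw m A μ) (x : ℝ) :
    ∃ ξ, stepValue μ x = expUtility μ x ξ := by
  obtain ⟨ξ, hξ⟩ := h.exists_max hU x
  exact ⟨ξ, le_antisymm (ciSup_le hξ) (h.expUtility_le_stepValue hU x ξ)⟩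

theorem stepValue_ge (hU : GrowthData U θ C L m) (h : GoodLaw m A μ) (x : ℝ) :
    U x ≤ stepValue μ x :=
  (h.expUtility_zero_ge hU x).trans (h.expUtility_le_stepValue hU x 0)

theorem stepValue_concave (hU : GrowthData U θ C L m) (h : GoodLaw m A μ) :
    ConcaveOn ℝ Set.univ (stepValue μ) := by
  refine ⟨convex_univ, fun x₁ _ x₂ _ a b ha hb hab => ?_⟩
  obtain ⟨ξ₁, h₁⟩ := h.exists_eq_stepValue hU x₁
  obtain ⟨ξ₂, h₂⟩ := h.exists_eq_stepValue hU x₂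
  simp only [smul_eq_mul, h₁, h₂]
  exact (h.expUtility_concave hU ha hb hab).trans (h.expUtility_le_stepValue hU _ _)

theorem stepValue_mono (hU : GrowthData U θ C L m) (h : GoodLaw m A μ) :
    Monotone (stepValue μ) := by
  intro x₁ x₂ hx
  obtain ⟨ξ, hξ⟩ := h.exists_eq_stepValue hU x₁
  rw [hξ]
  refine le_trans ?_ (h.expUtility_le_stepValue hU x₂ ξ)
  exact integral_mono (h.integrable_fn hU _ _) (h.integrable_fn hU _ _)
    fun z => z.1.mono (by linarith)

/-- Scaling the initial wealth and the position together scales the terminal wealth, so the position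
`l⁻¹ • ξ` at `x` is compared with `ξ` at `l * x`. -/
theorem stepValue_elastic (hU : GrowthData U θ C L m) (h : GoodLaw m A μ) (x : ℝ) {l : ℝ}
    (hl : 1 ≤ l) : stepValue μ (l * x) ≤ l ^ θ * (stepValue μ x + C) := by
  obtain ⟨ξ, hξ⟩ := h.exists_eq_stepValue hU (l * x)
  have hl0 : l ≠ 0 := by linarith
  have key : expUtility μ (l * x) ξ ≤ l ^ θ * (expUtility μ x (l⁻¹ • ξ) + C) := by
    have hI := h.integrable_fn hU x (l⁻¹ • ξ)
    have : l ^ θ * (expUtility μ x (l⁻¹ • ξ) + C) =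
        ∫ z, l ^ θ * (z.1.fn (x + inner ℝ (l⁻¹ • ξ) z.2) + C) ∂μ := by
      rw [integral_const_mul, integral_add hI (integrable_const C)]
      simp [expUtility]
    rw [this]
    refine integral_mono (h.integrable_fn hU _ _)
      ((hI.add (integrable_const C)).const_mul _) fun z => ?_
    have e := z.1.elastic (x + inner ℝ (l⁻¹ • ξ) z.2) hl
    rwa [real_inner_smul_left, mul_add, mul_inv_cancel_left₀ hl0, ← real_inner_smul_left] at e
  rw [hξ]
  refine key.trans (mul_le_mul_of_nonneg_left ?_ (by positivity))
  linarith [h.expUtility_le_stepValue hU x (l⁻¹ • ξ)]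

/-- This polynomial bound in `A` carries moments backward in time. The a priori bound applies with
`W = 0` because the value at `1` is at least `U 1 ≥ 0`. -/
theorem stepValue_one_le (hU : GrowthData U θ C L m) (h : GoodLaw m A μ) :
    stepValue μ 1 ≤ (2 + radius θ C A 1 0) * A := by
  obtain ⟨ξ, hξ⟩ := h.exists_eq_stepValue hU 1
  have hU1 : 0 ≤ U 1 := hU.zero.symm.le.trans (hU.mono zero_le_one)
  have hR := radius_nonneg hU (x := 1) h.one_le le_rfl
  have hb := h.ae_abs_inner_le hU (ξ := ξ) (x := 1) le_rfl
    (by rw [← hξ, neg_zero]; exact hU1.trans (h.stepValue_ge hU 1))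
  set R := radius θ C A 1 0
  rw [hξ]
  calc expUtility μ 1 ξ ≤ ∫ z, (2 + R) * ((1 + ‖z.2‖) * z.1.fn 1) ∂μ := by
        refine integral_mono_ae (h.integrable_fn hU _ _) (h.integrable_fn_one.const_mul _) ?_
        filter_upwards [hb] with z hz
        refine (z.1.fn_le hU _).trans ?_
        rw [← mul_assoc]
        refine mul_le_mul_of_nonneg_right ?_ (z.1.fn_one_nonneg hU)
        have e := abs_add_le 1 (inner ℝ ξ z.2)
        rw [abs_one] at e
        nlinarith [norm_nonneg z.2]
    _ ≤ _ := by
        rw [integral_const_mul]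
        exact mul_le_mul_of_nonneg_left h.integral_fn_one (by linarith)

/-- If the value at `-N` exceeded `-(C + 1)`, its maximizer would obey the a priori bound with `W =
C + 1`; starting from a large debt, bounded positions still leave a large debt with probability at
least `1 / 2`. -/
theorem stepValue_neg_nextDepth (hU : GrowthData U θ C L m) (h : GoodLaw m A μ) :
    stepValue μ (-nextDepth θ C A) ≤ -(C + 1) := by
  by_contra! hlt
  obtain ⟨ξ, hξ⟩ := h.exists_eq_stepValue hU (-nextDepth θ C A)
  have hA := h.one_le
  have hC := hU.const_nonneg
  have hR := radius_nonneg (θ := θ) (x := 0) hU hA (show 0 ≤ C + 1 by linarith)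
  -- The radius sees only the positive part of the initial wealth, which makes the choice of
  -- `nextDepth` in terms of `radius` non-circular.
  have hR' : radius θ C A (-nextDepth θ C A) (C + 1) = radius θ C A 0 (C + 1) := by
    have hN : 0 ≤ nextDepth θ C A := by unfold nextDepth; positivity
    simp only [radius, radiusBase, max_self, max_eq_right (neg_nonpos.2 hN)]
  have hb := h.ae_abs_inner_le hU (ξ := ξ) (x := -nextDepth θ C A) (show 0 ≤ C + 1 by linarith)
    (by rw [← hξ]; exact hlt.le)
  rw [hR'] at hb
  rw [hξ] at hlt
  set N := nextDepth θ C A with hN_def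
  set R := radius θ C A 0 (C + 1) with hR_def
  have hN : N = 16 * A * ((1 + R) * A + C + 1) + 8 * R * A + 8 * A + 1 := rfl
  have hRA : 0 ≤ R * A := by positivity
  have hm1 : 0 ≤ 16 * A * ((1 + R) * A + C + 1) := by positivity
  have hN1 : 8 * R * A ≤ N := by linarith
  have hN2 : 8 * A ≤ N := by linarith
  have hN0 : 0 < N := by linarith
  -- Each set has mass at most `1 / 4` by Markov's inequality, for `B₁` because `8 * R * A ≤ N`. Off
  -- both, the wealth is at most `-(N / 2)` and the depth is below `4 * A`, so the utility is at
  -- most `-(N / (8 * A))`.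
  set B₁ : Set (State U θ C × E) := {z | N / 2 ≤ R * ‖z.2‖} with hB₁
  set B₂ : Set (State U θ C × E) := {z | 4 * A ≤ z.1.depth} with hB₂
  have hmB₁ : MeasurableSet B₁ := measurableSet_le measurable_const (by fun_prop)
  have hmB₂ : MeasurableSet B₂ := measurableSet_le measurable_const
    ((State.continuous_depth.comp continuous_fst).measurable)
  have hPB₂ : μ.real B₂ ≤ 1 / 4 := by
    have e := (mul_meas_ge_le_integral_of_nonneg (ae_of_all μ fun z : State U θ C × E =>
      zero_le_one.trans z.1.one_le_depth) h.integrable_depth (4 * A)).trans h.integral_depth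
    have : A * (4 * μ.real B₂) ≤ A * 1 := by
      rw [mul_one]; exact le_trans (le_of_eq (by ring)) e
    linarith [le_of_mul_le_mul_left this (by linarith)]
  have hPB₁ : μ.real B₁ ≤ 1 / 4 := by
    have e := mul_meas_ge_le_integral_of_nonneg (ae_of_all μ fun z : State U θ C × E =>
      mul_nonneg hR (norm_nonneg z.2)) (h.integrable_norm.const_mul R) (N / 2)
    rw [integral_const_mul] at e
    have e2 := e.trans (mul_le_mul_of_nonneg_left h.integral_norm hR)
    have : N * (4 * μ.real B₁) ≤ N * 1 := by
      linarith
    linarith [le_of_mul_le_mul_left this hN0]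
  have hPB : 1 / 2 ≤ μ.real (B₁ ∪ B₂)ᶜ := by
    rw [probReal_compl_eq_one_sub (hmB₁.union hmB₂)]
    have := measureReal_union_le (μ := μ) B₁ B₂
    linarith
  have hpt : ∀ᵐ z ∂μ, z.1.fn (-N + inner ℝ ξ z.2) ≤
      (1 + R) * ((1 + ‖z.2‖) * z.1.fn 1) - (B₁ ∪ B₂)ᶜ.indicator (fun _ => N / (8 * A)) z := by
    filter_upwards [hb] with z hz
    have hf1 := z.1.fn_one_nonneg hU
    have hin : inner ℝ ξ z.2 ≤ R * ‖z.2‖ := (le_abs_self _).trans hz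
    by_cases hzB : z ∈ (B₁ ∪ B₂)ᶜ
    · rw [Set.indicator_of_mem hzB]
      have hz1 : R * ‖z.2‖ < N / 2 := not_le.1 fun hh => hzB (Or.inl hh)
      have hz2 : z.1.depth < 4 * A := not_le.1 fun hh => hzB (Or.inr hh)
      have hd := z.1.one_le_depth
      have hq : N / (8 * A) ≤ N / (2 * z.1.depth) :=
        div_le_div_of_nonneg_left hN0.le (by linarith) (by linarith)
      have hq1 : 1 ≤ N / (8 * A) := by rwa [one_le_div (by linarith)]
      have e1 : z.1.fn (-N + inner ℝ ξ z.2) ≤ z.1.fn (-(N / (2 * z.1.depth) * z.1.depth)) := by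
        refine z.1.mono ?_
        have : N / (2 * z.1.depth) * z.1.depth = N / 2 := by field_simp
        rw [this]; linarith
      have e2 := z.1.fn_neg_mul_depth_le hU (hq1.trans hq)
      have e4 : 0 ≤ (1 + R) * ((1 + ‖z.2‖) * z.1.fn 1) := by positivity
      linarith
    · rw [Set.indicator_of_notMem hzB, sub_zero]
      have e1 : z.1.fn (-N + inner ℝ ξ z.2) ≤ z.1.fn (R * ‖z.2‖) := z.1.mono (by linarith)
      refine e1.trans ((z.1.fn_le hU _).trans ?_)
      rw [abs_of_nonneg (by positivity), ← mul_assoc]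
      refine mul_le_mul_of_nonneg_right ?_ hf1
      nlinarith [norm_nonneg z.2]
  have hI1 : Integrable (fun z : State U θ C × E => (1 + R) * ((1 + ‖z.2‖) * z.1.fn 1)) μ :=
    h.integrable_fn_one.const_mul _
  have hI2 : Integrable ((B₁ ∪ B₂)ᶜ.indicator (fun _ => N / (8 * A))) μ :=
    (integrable_const _).indicator (hmB₁.union hmB₂).compl
  have hint : expUtility μ (-N) ξ ≤ (1 + R) * A - 1 / 2 * (N / (8 * A)) := by
    refine (integral_mono_ae (h.integrable_fn hU _ ξ) (hI1.sub hI2) hpt).trans ?_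
    simp only [Pi.sub_apply]
    rw [integral_sub hI1 hI2, integral_const_mul,
      integral_indicator_const _ (hmB₁.union hmB₂).compl, smul_eq_mul]
    refine sub_le_sub (mul_le_mul_of_nonneg_left h.integral_fn_one (by linarith))
      (mul_le_mul_of_nonneg_right hPB (by positivity))
  have hfin : (1 + R) * A + C + 1 ≤ 1 / 2 * (N / (8 * A)) := by
    rw [show 1 / 2 * (N / (8 * A)) = N / (16 * A) by field_simp; norm_num,
      le_div_iff₀ (by linarith)]
    linarith
  linarith

theorem one_le_nextDepth (hU : GrowthData U θ C L m) (hA : 1 ≤ A) : 1 ≤ nextDepth θ C A := by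
  have hC := hU.const_nonneg
  have hR := radius_nonneg (θ := θ) (x := 0) hU hA (show 0 ≤ C + 1 by linarith)
  unfold nextDepth
  have : 0 ≤ 16 * A * ((1 + radius θ C A 0 (C + 1)) * A + C + 1) +
    8 * radius θ C A 0 (C + 1) * A + 8 * A := by positivity
  linarith

theorem continuous_stepValue (hU : GrowthData U θ C L m) (h : GoodLaw m A μ) :
    Continuous (stepValue μ) := by
  rw [← continuousOn_univ]
  exact (h.stepValue_concave hU).continuousOn isOpen_univ

/-- The value function of the one-step problem, as a regular utility function. -/
def next (hU : GrowthData U θ C L m) (h : GoodLaw m A μ) : State U θ C :=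
  ⟨(⟨stepValue μ, h.continuous_stepValue hU⟩, nextDepth θ C A), h.stepValue_concave hU,
    h.stepValue_mono hU, h.stepValue_ge hU, fun x _ hl => h.stepValue_elastic hU x hl,
    one_le_nextDepth hU h.one_le, h.stepValue_neg_nextDepth hU⟩

end GoodLaw
end OneStep

/-! ### Regular conditional laws -/

section RegularLaw

variable {Ω 𝒵 : Type*} {m mΩ : MeasurableSpace Ω} {m𝒵 : MeasurableSpace 𝒵}
  [StandardBorelSpace 𝒵] [Nonempty 𝒵] {P : Measure Ω} [IsFiniteMeasure P] {Z : Ω → 𝒵}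

/-- A regular conditional law of `Z` given the σ-algebra `m`. -/
def regularLaw (P : Measure Ω) [IsFiniteMeasure P] (m : MeasurableSpace Ω) (Z : Ω → 𝒵) :
    @Kernel Ω 𝒵 m m𝒵 :=
  @condDistrib Ω Ω 𝒵 _ _ _ mΩ m Z id P _

instance : @IsMarkovKernel Ω 𝒵 m m𝒵 (regularLaw P m Z) := by
  unfold regularLaw; infer_instance

instance (ω : Ω) : IsProbabilityMeasure (regularLaw P m Z ω) :=
  IsMarkovKernel.isProbabilityMeasure (mα := m) (κ := regularLaw P m Z) ω

theorem measurable_lintegral_regularLaw {F : Ω × 𝒵 → ℝ≥0∞} (hF : Measurable[m.prod m𝒵] F) :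
    Measurable[m] fun ω => ∫⁻ z, F (ω, z) ∂regularLaw P m Z ω :=
  @Measurable.lintegral_kernel_prod_right' Ω 𝒵 m m𝒵 (regularLaw P m Z) _ F hF

/-- Disintegration of the law of the pair formed by the identity map into `(Ω, m)` and `Z`; this is
why `F` may depend on `ω` in an `m`-measurable way. -/
theorem lintegral_comp_eq_lintegral_regularLaw (hm : m ≤ mΩ) (hZ : Measurable Z)
    {F : Ω × 𝒵 → ℝ≥0∞} (hF : Measurable[m.prod m𝒵] F) :
    ∫⁻ ω, F (ω, Z ω) ∂P = ∫⁻ ω, ∫⁻ z, F (ω, z) ∂regularLaw P m Z ω ∂P := by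
  have hid : @Measurable Ω Ω mΩ m id := measurable_id'' hm
  have key := compProd_map_condDistrib (μ := P) (X := (id : Ω → Ω)) (mβ := m) hZ.aemeasurable
  change _ ⊗ₘ regularLaw P m Z = _ at key
  have h1 := congrArg (fun μ => @lintegral _ (m.prod m𝒵) μ F) key
  rw [@Measure.lintegral_compProd Ω 𝒵 m m𝒵 _ _ inferInstance inferInstance F hF,
    @lintegral_map _ _ mΩ (m.prod m𝒵) P F _ hF
      (hid.prodMk hZ),
    @lintegral_map _ _ mΩ m P _ _
      (measurable_lintegral_regularLaw (P := P) (Z := Z) hF) hid] at h1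
  exact h1.symm

theorem condLExp_comp_ae_eq (hm : m ≤ mΩ) (hZ : Measurable Z)
    {F : Ω × 𝒵 → ℝ≥0∞} (hF : Measurable[m.prod m𝒵] F) :
    (fun ω => ∫⁻ z, F (ω, z) ∂regularLaw P m Z ω) =ᵐ[P] condLExp m P (fun ω => F (ω, Z ω)) := by
  refine ae_eq_condLExp hm P _ (measurable_lintegral_regularLaw hF) fun s hs => ?_
  have hs' : @MeasurableSet _ (m.prod m𝒵) (Prod.fst ⁻¹' s) :=
    @measurable_fst _ _ m m𝒵 s hs
  have h := lintegral_comp_eq_lintegral_regularLaw (P := P) hm hZ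
    (hF.indicator hs')
  rw [← lintegral_indicator (hm s hs), ← lintegral_indicator (hm s hs)]
  have e1 : ∀ ω, (Prod.fst ⁻¹' s).indicator F (ω, Z ω) = s.indicator (fun ω => F (ω, Z ω)) ω :=
    fun ω => by by_cases hω : ω ∈ s <;> simp [Set.indicator, hω]
  have e2 : ∀ ω, ∫⁻ z, (Prod.fst ⁻¹' s).indicator F (ω, z) ∂regularLaw P m Z ω =
      s.indicator (fun ω => ∫⁻ z, F (ω, z) ∂regularLaw P m Z ω) ω :=
    fun ω => by by_cases hω : ω ∈ s <;> simp [Set.indicator, hω]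
  simp only [e1, e2] at h
  exact h.symm

/-- Both sides say that the indicator of the complement has integral zero, and disintegration
equates the integrals. It transfers almost sure statements between `Z` and its conditional laws. -/
theorem ae_regularLaw_iff (hm : m ≤ mΩ) (hZ : Measurable Z) {s : Set (Ω × 𝒵)}
    (hs : @MeasurableSet _ (m.prod m𝒵) s) :
    (∀ᵐ ω ∂P, ∀ᵐ z ∂regularLaw P m Z ω, (ω, z) ∈ s) ↔ ∀ᵐ ω ∂P, (ω, Z ω) ∈ s := by
  have hF : @Measurable _ _ (m.prod m𝒵) _ (sᶜ.indicator (1 : Ω × 𝒵 → ℝ≥0∞)) :=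
    Measurable.indicator measurable_const hs.compl
  have h := lintegral_comp_eq_lintegral_regularLaw (P := P) hm hZ hF
  have hid : @Measurable (Ω × 𝒵) (Ω × 𝒵) (mΩ.prod m𝒵) (m.prod m𝒵) id :=
    measurable_id'' (sup_le_sup_right (MeasurableSpace.comap_mono hm) _)
  have hFm : Measurable fun ω => (sᶜ.indicator (1 : Ω × 𝒵 → ℝ≥0∞)) (ω, Z ω) :=
    (hF.comp hid).comp (measurable_id.prodMk hZ)
  have hFz : ∀ ω, Measurable fun z => (sᶜ.indicator (1 : Ω × 𝒵 → ℝ≥0∞)) (ω, z) := fun ω =>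
    hF.comp measurable_prodMk_left
  have e : ∀ p : Ω × 𝒵, (sᶜ.indicator (1 : Ω × 𝒵 → ℝ≥0∞)) p = 0 ↔ p ∈ s := fun p => by
    by_cases hp : p ∈ s <;> simp [hp]
  have l1 : (∀ᵐ ω ∂P, (ω, Z ω) ∈ s) ↔
      ∫⁻ ω, (sᶜ.indicator (1 : Ω × 𝒵 → ℝ≥0∞)) (ω, Z ω) ∂P = 0 := by
    rw [lintegral_eq_zero_iff hFm]
    simp only [Filter.EventuallyEq, Pi.zero_apply, e]
  have l2 : (∀ᵐ ω ∂P, ∀ᵐ z ∂regularLaw P m Z ω, (ω, z) ∈ s) ↔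
      ∫⁻ ω, ∫⁻ z, (sᶜ.indicator (1 : Ω × 𝒵 → ℝ≥0∞)) (ω, z) ∂regularLaw P m Z ω ∂P = 0 := by
    rw [lintegral_eq_zero_iff ((measurable_lintegral_regularLaw hF).mono hm le_rfl)]
    refine Filter.eventually_congr (ae_of_all _ fun ω => ?_)
    rw [Pi.zero_apply, lintegral_eq_zero_iff (hFz ω)]
    simp only [Filter.EventuallyEq, Pi.zero_apply, e]
  rw [l1, l2, h]

theorem condExp_comp_ae_eq {F : Type*} [NormedAddCommGroup F] [NormedSpace ℝ F] [CompleteSpace F]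
    (hm : m ≤ mΩ) (hZ : Measurable Z) {f : Ω × 𝒵 → F}
    (hf : @StronglyMeasurable _ _ _ (m.prod m𝒵) f) (hint : Integrable (fun ω => f (ω, Z ω)) P) :
    P[fun ω => f (ω, Z ω) | m] =ᵐ[P] fun ω => ∫ z, f (ω, z) ∂regularLaw P m Z ω := by
  have h := condExp_prod_ae_eq_integral_condDistrib (μ := P) (X := (id : Ω → Ω)) (mβ := m)
    (measurable_id'' hm) hZ.aemeasurable hf hint
  rwa [MeasurableSpace.comap_id] at h

theorem integrable_regularLaw (hm : m ≤ mΩ) (hZ : Measurable Z) {f : Ω × 𝒵 → ℝ}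
    (hf : Measurable[m.prod m𝒵] f) (hint : Integrable (fun ω => f (ω, Z ω)) P) :
    ∀ᵐ ω ∂P, Integrable (fun z => f (ω, z)) (regularLaw P m Z ω) := by
  have hF : @Measurable _ _ (m.prod m𝒵) _ fun p => ‖f p‖ₑ :=
    measurable_enorm.comp hf
  have h := lintegral_comp_eq_lintegral_regularLaw (P := P) hm hZ hF
  have hfin := hint.2
  rw [HasFiniteIntegral, h] at hfin
  filter_upwards [ae_lt_top ((measurable_lintegral_regularLaw hF).mono hm le_rfl) hfin.ne]
    with ω hω
  refine ⟨?_, hω⟩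
  exact (hf.comp measurable_prodMk_left).aestronglyMeasurable

theorem measurable_integral_regularLaw {F : Type*} [NormedAddCommGroup F] [NormedSpace ℝ F]
    [MeasurableSpace F] [BorelSpace F] [SecondCountableTopology F] {f : Ω × 𝒵 → F}
    (hf : Measurable[m.prod m𝒵] f) :
    Measurable[m] fun ω => ∫ z, f (ω, z) ∂regularLaw P m Z ω := by
  exact (StronglyMeasurable.integral_kernel_prod_right' (κ := regularLaw P m Z)
    hf.stronglyMeasurable).measurable

theorem integral_comp_eq_integral_regularLaw (hm : m ≤ mΩ) (hZ : Measurable Z) {f : Ω × 𝒵 → ℝ}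
    (hf : Measurable[m.prod m𝒵] f) (hint : Integrable (fun ω => f (ω, Z ω)) P) :
    Integrable (fun ω => ∫ z, f (ω, z) ∂regularLaw P m Z ω) P ∧
      ∫ ω, f (ω, Z ω) ∂P = ∫ ω, ∫ z, f (ω, z) ∂regularLaw P m Z ω ∂P := by
  have h := condExp_comp_ae_eq hm hZ hf.stronglyMeasurable hint
  exact ⟨integrable_condExp.congr h, by rw [← integral_condExp hm, integral_congr_ae h]⟩

end RegularLaw

/-! ### The linear span of a law -/

section MomentOperator

variable {E : Type*} [NormedAddCommGroup E] [InnerProductSpace ℝ E] [FiniteDimensional ℝ E]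
  [MeasurableSpace E] [BorelSpace E] {ν : Measure E} [IsProbabilityMeasure ν]

/-- The second moment operator `v ↦ ∫ ⟨v, y - b⟩ (y - b) dν` of a law around the point `b`. -/
def momentOp (ν : Measure E) (b v : E) : E := ∫ y, (inner ℝ v (y - b) : ℝ) • (y - b) ∂ν

theorem integrable_momentOp (h : Integrable (fun y => ‖y‖ ^ 2) ν) (b v : E) :
    Integrable (fun y => (inner ℝ v (y - b) : ℝ) • (y - b)) ν := by
  refine ((h.const_mul (2 * ‖v‖)).add (integrable_const (2 * ‖v‖ * ‖b‖ ^ 2))).mono'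
    (by fun_prop) (ae_of_all _ fun y => ?_)
  rw [norm_smul]
  have h1 := norm_inner_le_norm (𝕜 := ℝ) v (y - b)
  have h2 : ‖y - b‖ ≤ ‖y‖ + ‖b‖ := norm_sub_le y b
  have h3 : ‖y - b‖ * ‖y - b‖ ≤ 2 * ‖y‖ ^ 2 + 2 * ‖b‖ ^ 2 := by
    nlinarith [norm_nonneg (y - b), sq_nonneg (‖y‖ - ‖b‖)]
  calc ‖(inner ℝ v (y - b) : ℝ)‖ * ‖y - b‖ ≤ ‖v‖ * ‖y - b‖ * ‖y - b‖ :=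
        mul_le_mul_of_nonneg_right h1 (norm_nonneg _)
    _ = ‖v‖ * (‖y - b‖ * ‖y - b‖) := by ring
    _ ≤ ‖v‖ * (2 * ‖y‖ ^ 2 + 2 * ‖b‖ ^ 2) := mul_le_mul_of_nonneg_left h3 (norm_nonneg _)
    _ = 2 * ‖v‖ * ‖y‖ ^ 2 + 2 * ‖v‖ * ‖b‖ ^ 2 := by ring

/-- The second moment operator as a linear map. -/
def momentMap (h : Integrable (fun y => ‖y‖ ^ 2) ν) (b : E) : E →ₗ[ℝ] E where
  toFun := momentOp ν b
  map_add' v w := by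
    simp only [momentOp, inner_add_left, add_smul]
    exact integral_add (integrable_momentOp h b v) (integrable_momentOp h b w)
  map_smul' r v := by
    simp only [momentOp, real_inner_smul_left, mul_smul, integral_smul, RingHom.id_apply]

theorem inner_momentOp (h : Integrable (fun y => ‖y‖ ^ 2) ν) (b v w : E) :
    inner ℝ w (momentOp ν b v) = ∫ y, (inner ℝ v (y - b) : ℝ) * inner ℝ w (y - b) ∂ν := by
  rw [momentOp, ← integral_inner (integrable_momentOp h b v)]
  simp only [real_inner_smul_right]

/-- The quadratic form of the operator is the integral of a square. -/
theorem ae_inner_eq_zero_of_inner_momentOp (h : Integrable (fun y => ‖y‖ ^ 2) ν) {b v : E}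
    (hv : inner ℝ v (momentOp ν b v) = 0) : ∀ᵐ y ∂ν, (inner ℝ v (y - b) : ℝ) = 0 := by
  rw [inner_momentOp h] at hv
  have hint : Integrable (fun y => (inner ℝ v (y - b) : ℝ) * inner ℝ v (y - b)) ν := by
    have := (integrable_momentOp h b v).const_inner (𝕜 := ℝ) v
    simpa only [real_inner_smul_right] using this
  rw [integral_eq_zero_iff_of_nonneg (fun y => mul_self_nonneg _) hint] at hv
  exact hv.mono fun y hy => mul_self_eq_zero.1 hy

theorem momentOp_mem (h : Integrable (fun y => ‖y‖ ^ 2) ν) {b : E} {K : Submodule ℝ E}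
    (hK : ∀ᵐ y ∂ν, y - b ∈ K) (v : E) : momentOp ν b v ∈ K := by
  rw [← Submodule.orthogonal_orthogonal K]
  intro w hw
  rw [inner_momentOp h]
  refine integral_eq_zero_of_ae (hK.mono fun y hy => ?_)
  have : (inner ℝ w (y - b) : ℝ) = 0 := by
    rw [real_inner_comm]; exact hw _ hy
  simp [this]

/-- The range of the second moment operator around `0` is the linear span of the support. -/
theorem range_momentMap (h : Integrable (fun y => ‖y‖ ^ 2) ν) :
    LinearMap.range (momentMap h 0) = Submodule.span ℝ ν.support := by
  refine le_antisymm ?_ ?_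
  · rintro _ ⟨v, rfl⟩
    refine momentOp_mem h ?_ v
    filter_upwards [Measure.support_mem_ae (μ := ν)] with y hy
    simpa using Submodule.subset_span hy
  -- A vector orthogonal to the range is orthogonal to almost every point; this is a closed
  -- condition, hence it holds on the whole support.
  · rw [← Submodule.orthogonal_le_orthogonal_iff]
    intro w hw
    have h0 : (inner ℝ w (momentOp ν 0 w) : ℝ) = 0 := by
      rw [real_inner_comm]; exact hw _ ⟨w, rfl⟩
    have h1 := ae_inner_eq_zero_of_inner_momentOp h h0
    simp only [sub_zero] at h1
    have hcl : IsClosed {y : E | (inner ℝ w y : ℝ) = 0} :=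
      isClosed_eq (by fun_prop) continuous_const
    have hsup : ν.support ⊆ {y : E | (inner ℝ w y : ℝ) = 0} :=
      Measure.support_subset_of_isClosed hcl h1
    have hle : Submodule.span ℝ ν.support ≤ (Submodule.span ℝ {w})ᗮ := by
      rw [Submodule.span_le]
      intro y hy
      exact Submodule.mem_orthogonal_singleton_iff_inner_right.2 (hsup hy)
    intro y hy
    rw [real_inner_comm]
    exact Submodule.mem_orthogonal_singleton_iff_inner_right.1 (hle hy)

/-- The mean belongs to the affine span of the support. -/
theorem integral_mem_affineSpan_support (h : Integrable (fun y : E => y) ν) :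
    ∫ y, y ∂ν ∈ affineSpan ℝ ν.support := by
  refine (affineSpan ℝ ν.support).convex.integral_mem
    (AffineSubspace.closed_of_finiteDimensional _) ?_ h
  filter_upwards [Measure.support_mem_ae (μ := ν)] with y hy
  exact subset_affineSpan ℝ _ hy

/-- If the mean is in the range of the covariance operator, then the affine span of the support
is a linear subspace. -/
theorem zero_mem_affineSpan_support (h1 : Integrable (fun y : E => y) ν)
    (h : Integrable (fun y => ‖y‖ ^ 2) ν)
    (hb : ∫ y, y ∂ν ∈ LinearMap.range (momentMap h (∫ y, y ∂ν))) :
    (0 : E) ∈ affineSpan ℝ ν.support := by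
  have hm := integral_mem_affineSpan_support h1
  obtain ⟨v, hv⟩ := hb
  -- The range of the covariance operator lies in the direction of the span, so the mean can be
  -- subtracted from itself without leaving the span.
  have hdir : ∫ y, y ∂ν ∈ (affineSpan ℝ ν.support).direction := by
    have := momentOp_mem h (b := ∫ y, y ∂ν) (K := (affineSpan ℝ ν.support).direction) (by
      filter_upwards [Measure.support_mem_ae (μ := ν)] with y hy
      exact AffineSubspace.vsub_mem_direction (subset_affineSpan ℝ _ hy) hm) v
    rwa [← hv]
  have := AffineSubspace.vadd_mem_of_mem_direction (Submodule.neg_mem _ hdir) hm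
  simpa using this

/-- A vector `p` which is the component of the mean orthogonal to the range of the covariance
operator has a constant inner product with almost all points. -/
theorem ae_inner_eq_norm_sq (h : Integrable (fun y => ‖y‖ ^ 2) ν) {p : E}
    (hp : ∀ v, inner ℝ p (momentOp ν (∫ y, y ∂ν) v) = (0 : ℝ))
    (hb : ∫ y, y ∂ν - p ∈ LinearMap.range (momentMap h (∫ y, y ∂ν))) :
    ∀ᵐ y ∂ν, (inner ℝ p y : ℝ) = ‖p‖ ^ 2 := by
  filter_upwards [ae_inner_eq_zero_of_inner_momentOp h (hp p)] with y hy
  obtain ⟨v, hv⟩ := hb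
  have h2 : (inner ℝ p (∫ y, y ∂ν - p) : ℝ) = 0 := by rw [← hv]; exact hp v
  rw [inner_sub_right] at hy h2
  rw [← real_inner_self_eq_norm_sq]
  linarith

/-- Reverse Fatou: the limit superior of the events has mass at least `κ` and is contained in the
limiting event, where the strict inequality becomes weak. -/
theorem le_measureReal_of_tendsto {p : ℕ → E} {q : E}
    (hp : Filter.Tendsto p Filter.atTop (nhds q)) {β κ : ℝ}
    (hκ : ∀ n, κ ≤ ν.real {y | (inner ℝ (p n) y : ℝ) < β}) :
    κ ≤ ν.real {y | (inner ℝ q y : ℝ) ≤ β} := by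
  let t : ℕ → Set E := fun n => ⋃ k ≥ n, {y | (inner ℝ (p k) y : ℝ) < β}
  have hmeas : ∀ k, MeasurableSet {y | (inner ℝ (p k) y : ℝ) < β} := fun k =>
    measurableSet_lt (by fun_prop) measurable_const
  have hanti : Antitone t := fun i j hij =>
    Set.biUnion_subset_biUnion_left fun k hk => le_trans hij hk
  have hlim := tendsto_measure_iInter_atTop (μ := ν) (s := t)
    (fun n => (MeasurableSet.biUnion (Set.to_countable _) fun k _ => hmeas k).nullMeasurableSet)
    hanti ⟨0, measure_ne_top _ _⟩
  have hlim' := (ENNReal.tendsto_toReal (measure_ne_top _ _)).comp hlim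
  have h1 : κ ≤ (ν (⋂ n, t n)).toReal := ge_of_tendsto' hlim' fun n =>
    (hκ n).trans (measureReal_mono (h₂ := measure_ne_top _ _) fun y hy =>
      Set.mem_iUnion₂.2 ⟨n, le_rfl, hy⟩)
  refine h1.trans (measureReal_mono fun y hy => ?_)
  simp only [Set.mem_iInter, t, Set.mem_iUnion, exists_prop] at hy
  by_contra hlt
  have hlt' : β < inner ℝ q y := not_le.1 hlt
  have hc : Filter.Tendsto (fun n => (inner ℝ (p n) y : ℝ)) Filter.atTop (nhds (inner ℝ q y)) :=
    hp.inner tendsto_const_nhds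
  obtain ⟨n, hn⟩ := Filter.eventually_atTop.1 (hc.eventually (lt_mem_nhds hlt'))
  obtain ⟨k, hk, hky⟩ := hy n
  exact lt_asymm (hn k hk) hky

end MomentOperator

/-- The Gram-Schmidt process preserves measurability. -/
theorem measurable_gramSchmidt {Ω : Type*} {mΩ : MeasurableSpace Ω} {E : Type*}
    [NormedAddCommGroup E] [InnerProductSpace ℝ E] [FiniteDimensional ℝ E] [MeasurableSpace E]
    [BorelSpace E] {n : ℕ} {f : Fin n → Ω → E} (hf : ∀ i, Measurable (f i)) (i : Fin n) :
    Measurable fun ω => InnerProductSpace.gramSchmidt ℝ (fun j => f j ω) i := by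
  induction i using WellFoundedLT.induction with
  | ind i ih =>
    simp only [InnerProductSpace.gramSchmidt_def ℝ _ i, Submodule.starProjection_singleton]
    refine (hf i).sub (Finset.measurable_sum _ fun j hj => ?_)
    have hj' := ih j (Finset.mem_Iio.1 hj)
    exact ((hj'.inner (hf i)).div (hj'.norm.pow_const 2)).smul hj'

/-! ### Consequences of the absence of arbitrage -/

section Directions

variable {Ω E : Type*} {m mΩ : MeasurableSpace Ω} [NormedAddCommGroup E] [InnerProductSpace ℝ E]
  [FiniteDimensional ℝ E] [MeasurableSpace E] [BorelSpace E] [StandardBorelSpace E]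
  {P : Measure Ω} [IsProbabilityMeasure P] {Y : Ω → E}

theorem measurable_momentOp_regularLaw {b v : Ω → E} (hb : Measurable[m] b)
    (hv : Measurable[m] v) :
    Measurable[m] fun ω => momentOp (regularLaw P m Y ω) (b ω) (v ω) := by
  have h1 : Measurable[m.prod inferInstance] fun p : Ω × E => p.2 - b p.1 :=
    measurable_snd.sub (hb.comp measurable_fst)
  have h2 : Measurable[m.prod inferInstance] fun p : Ω × E => v p.1 := hv.comp measurable_fst
  exact measurable_integral_regularLaw (P := P) (Z := Y) ((h2.inner h1).smul h1)

theorem ae_integrable_norm_pow_regularLaw (hm : m ≤ mΩ) (hY : Measurable Y)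
    (hmom : HasAllMoments P fun ω => ‖Y ω‖) (j : ℕ) :
    ∀ᵐ ω ∂P, Integrable (fun y => ‖y‖ ^ j) (regularLaw P m Y ω) :=
  integrable_regularLaw hm hY (f := fun p : Ω × E => ‖p.2‖ ^ j)
    ((measurable_norm.pow_const j).comp measurable_snd) (hmom.pow j).integrable

/-- A measurable field of vectors, which are the components of the conditional means orthogonal
to the directions of the affine spans of the supports of the conditional laws. -/
theorem exists_orthogonal_component (hm : m ≤ mΩ) (hY : Measurable Y)
    (hmom : HasAllMoments P fun ω => ‖Y ω‖) :
    ∃ p : Ω → E, Measurable[m] p ∧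
      (∀ᵐ ω ∂P, ∀ᵐ y ∂regularLaw P m Y ω, (inner ℝ (p ω) y : ℝ) = ‖p ω‖ ^ 2) ∧
      ∀ᵐ ω ∂P, p ω = 0 → (0 : E) ∈ affineSpan ℝ (regularLaw P m Y ω).support := by
  let e := (stdOrthonormalBasis ℝ E)
  let n := Module.finrank ℝ E
  let b : Ω → E := fun ω => ∫ y, y ∂regularLaw P m Y ω
  have hb : Measurable[m] b :=
    measurable_integral_regularLaw (f := fun p : Ω × E => p.2) measurable_snd
  -- Gram–Schmidt on the images of a basis under the covariance operator, followed by the mean: the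
  -- last vector is the component of the mean orthogonal to the range. Explicit formulas keep the
  -- choice measurable.
  let f : Fin (n + 1) → Ω → E := Fin.snoc (α := fun _ => Ω → E)
    (fun i ω => momentOp (regularLaw P m Y ω) (b ω) (e i)) b
  have hf : ∀ i, Measurable[m] (f i) := by
    refine Fin.lastCases ?_ fun i => ?_
    · simpa only [f, Fin.snoc_last] using hb
    · simpa only [f, Fin.snoc_castSucc] using measurable_momentOp_regularLaw hb measurable_const
  let p : Ω → E := fun ω => InnerProductSpace.gramSchmidt ℝ (fun i => f i ω) (Fin.last n)
  have hp : Measurable[m] p := measurable_gramSchmidt hf (Fin.last n)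
  have hsub : ∀ ω (h : Integrable (fun y => ‖y‖ ^ 2) (regularLaw P m Y ω)),
      b ω - p ω ∈ LinearMap.range (momentMap h (b ω)) := by
    intro ω h
    have h1 : b ω - p ω ∈ Submodule.span ℝ
        (InnerProductSpace.gramSchmidt ℝ (fun i => f i ω) '' Set.Iio (Fin.last n)) := by
      have hbf : b ω = f (Fin.last n) ω := by simp only [f, Fin.snoc_last]
      simp only [p]
      rw [hbf, InnerProductSpace.gramSchmidt_def ℝ (fun i => f i ω), sub_sub_cancel]
      refine Submodule.sum_mem _ fun j hj => ?_
      rw [Submodule.starProjection_singleton]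
      exact Submodule.smul_mem _ _ (Submodule.subset_span ⟨j, Finset.mem_Iio.1 hj, rfl⟩)
    rw [InnerProductSpace.span_gramSchmidt_Iio] at h1
    refine Submodule.span_le.2 ?_ h1
    rintro _ ⟨j, hj, rfl⟩
    obtain ⟨i, rfl⟩ := Fin.exists_castSucc_eq.2 (ne_of_lt hj)
    simp only [f, Fin.snoc_castSucc]
    exact ⟨e i, rfl⟩
  have horth : ∀ ω, Integrable (fun y => ‖y‖ ^ 2) (regularLaw P m Y ω) →
      ∀ v, inner ℝ (p ω) (momentOp (regularLaw P m Y ω) (b ω) v) = (0 : ℝ) := by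
    intro ω h v
    have hv : momentOp (regularLaw P m Y ω) (b ω) v =
        ∑ i, (inner ℝ (e i) v : ℝ) • momentOp (regularLaw P m Y ω) (b ω) (e i) := by
      change momentMap h (b ω) v = ∑ i, (inner ℝ (e i) v : ℝ) • momentMap h (b ω) (e i)
      conv_lhs => rw [← e.sum_repr' v, map_sum]
      simp only [map_smul]
    rw [hv, inner_sum]
    refine Finset.sum_eq_zero fun i _ => ?_
    rw [real_inner_smul_right]
    have := InnerProductSpace.gramSchmidt_inv_triangular ℝ (fun i => f i ω)
      (Fin.castSucc_lt_last i)
    simp only [f, Fin.snoc_castSucc] at this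
    exact mul_eq_zero_of_right _ this
  have hint := ae_integrable_norm_pow_regularLaw hm hY hmom 2
  have hint1 := ae_integrable_norm_pow_regularLaw hm hY hmom 1
  refine ⟨p, hp, ?_, ?_⟩
  · filter_upwards [hint] with ω h
    exact ae_inner_eq_norm_sq h (horth ω h) (hsub ω h)
  · filter_upwards [hint, hint1] with ω h h1 hpω
    have h1' : Integrable (fun y : E => y) (regularLaw P m Y ω) := by
      simp only [pow_one] at h1
      exact (integrable_norm_iff (by fun_prop)).1 h1
    refine zero_mem_affineSpan_support h1' h ?_
    have := hsub ω h
    rwa [hpω, sub_zero] at this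

/-- A sequence of measurable fields of unit vectors which is dense in the unit spheres of the
linear spans of the supports of the conditional laws. -/
theorem exists_dense_directions (hm : m ≤ mΩ) (hY : Measurable Y)
    (hmom : HasAllMoments P fun ω => ‖Y ω‖) :
    ∃ p : ℕ → Ω → E, (∀ n, Measurable[m] (p n)) ∧ ∀ᵐ ω ∂P,
      (∀ n, p n ω ∈ Submodule.span ℝ (regularLaw P m Y ω).support) ∧
      (∀ n, Submodule.span ℝ (regularLaw P m Y ω).support ≠ ⊥ → ‖p n ω‖ = 1) ∧
      ∀ q ∈ Submodule.span ℝ (regularLaw P m Y ω).support, ‖q‖ = 1 →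
        ∃ u : ℕ → ℕ, Filter.Tendsto (fun k => p (u k) ω) Filter.atTop (nhds q) := by
  classical
  let c := TopologicalSpace.denseSeq E
  have hc : DenseRange c := TopologicalSpace.denseRange_denseSeq E
  let a : ℕ → Ω → E := fun n ω => momentOp (regularLaw P m Y ω) 0 (c n)
  have ha : ∀ n, Measurable[m] (a n) := fun n =>
    measurable_momentOp_regularLaw (b := fun _ => 0) measurable_const measurable_const
  have ha0 : ∀ n, MeasurableSet[m] {ω | a n ω = 0} := fun n => ha n (measurableSet_singleton 0)
  have hex : ∀ ω, ∃ n, a n ω ≠ 0 ∨ ∀ i, a i ω = 0 := fun ω => by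
    by_cases h : ∀ i, a i ω = 0
    · exact ⟨0, Or.inr h⟩
    · push Not at h
      obtain ⟨n, hn⟩ := h
      exact ⟨n, Or.inl hn⟩
  let j : Ω → ℕ := fun ω => Nat.find (hex ω)
  have hj : Measurable[m] j := @measurable_find Ω m _ _ hex fun n => by
    have e : {ω | a n ω ≠ 0 ∨ ∀ i, a i ω = 0} = {ω | a n ω = 0}ᶜ ∪ ⋂ i, {ω | a i ω = 0} := by
      ext ω; simp
    rw [e]
    exact (ha0 n).compl.union (MeasurableSet.iInter fun i => ha0 i)
  have hjm : Measurable[m] fun ω => a (j ω) ω := by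
    have h1 : Measurable[m.prod inferInstance] fun q : Ω × ℕ => a q.2 q.1 :=
      measurable_from_prod_countable_left fun n => ha n
    exact h1.comp (measurable_id.prodMk hj)
  -- Zero vectors cannot be normalized and are replaced by the first nonzero `a j`, which exists
  -- unless the span is trivial.
  let v : ℕ → Ω → E := fun n ω => if a n ω = 0 then a (j ω) ω else a n ω
  have hv : ∀ n, Measurable[m] (v n) := fun n => Measurable.ite (ha0 n) hjm (ha n)
  refine ⟨fun n ω => ‖v n ω‖⁻¹ • v n ω, fun n =>
    ((measurable_norm.inv).comp (hv n)).smul (hv n), ?_⟩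
  filter_upwards [ae_integrable_norm_pow_regularLaw hm hY hmom 2] with ω h
  have hrange := range_momentMap h
  have hmem : ∀ n, a n ω ∈ Submodule.span ℝ (regularLaw P m Y ω).support := fun n => by
    rw [← hrange]; exact ⟨c n, rfl⟩
  have hcont : Continuous (momentMap h 0) := LinearMap.continuous_of_finiteDimensional _
  refine ⟨fun n => Submodule.smul_mem _ _ ?_, fun n hne => ?_, fun q hq hq1 => ?_⟩
  · by_cases hn : a n ω = 0 <;> simp only [v, hn, if_true, if_false] <;> exact hmem _
  · have hne0 : v n ω ≠ 0 := by
      by_cases hn : a n ω = 0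
      · simp only [v, hn, if_true]
        rcases Nat.find_spec (hex ω) with h1 | h1
        · exact h1
        · exfalso
          apply hne
          rw [← hrange, LinearMap.range_eq_bot]
          ext1 x
          exact hc.induction_on (p := fun x => momentMap h 0 x = 0) x
            (isClosed_eq hcont continuous_const) h1
      · simp only [v, hn, if_false, ne_eq, not_false_eq_true]
    rw [norm_smul, norm_inv, norm_norm, inv_mul_cancel₀ (norm_ne_zero_iff.2 hne0)]
  · rw [← hrange] at hq
    obtain ⟨w, rfl⟩ := hq
    obtain ⟨s, hs, hsw⟩ := mem_closure_iff_seq_limit.1 (hc w)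
    choose u hu using hs
    have h1 : Filter.Tendsto (fun k => a (u k) ω) Filter.atTop (nhds (momentMap h 0 w)) := by
      have := (hcont.tendsto w).comp hsw
      refine this.congr fun k => ?_
      simp only [Function.comp_apply, ← hu k]
      rfl
    have hne : momentMap h 0 w ≠ 0 := fun h0 => by simp [h0] at hq1
    -- The limit is a unit vector, so the replacement does not occur eventually.
    have h2 : ∀ᶠ k in Filter.atTop, a (u k) ω = v (u k) ω := by
      filter_upwards [h1.eventually (isOpen_ne.mem_nhds hne)] with k hk
      have hk' : a (u k) ω ≠ 0 := hk
      simp only [v, hk', if_false]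
    have h3 := h1.congr' h2
    have h4 := (h3.norm.inv₀ (by rw [hq1]; exact one_ne_zero)).smul h3
    rw [hq1, inv_one, one_smul] at h4
    exact ⟨u, h4⟩

end Directions

/-! ### No-arbitrage in terms of the conditional laws. -/

section Market

variable {Ω : Type*} {mΩ : MeasurableSpace Ω} {P : Measure Ω} [IsProbabilityMeasure P]
  {T d : ℕ} {ℱ : Filtration ℕ mΩ} {S : ℕ → Ω → EuclideanSpace ℝ (Fin d)}

theorem measurable_increment (hS : ∀ t ≤ T, Measurable[ℱ t] (S t)) {t : ℕ} (ht : t ≤ T) :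
    Measurable[ℱ t] (increment S t) := by
  cases t with
  | zero => exact hS 0 ht
  | succ t => exact (hS _ ht).sub ((hS t (by omega)).mono (ℱ.mono t.le_succ) le_rfl)

theorem wealth_single {t : ℕ} (ht : t < T) (p : Ω → EuclideanSpace ℝ (Fin d)) (c : ℝ) (ω : Ω) :
    wealth S c (fun s => if s = t + 1 then p else 0) T ω =
      c + inner ℝ (p ω) (increment S (t + 1) ω) := by
  unfold wealth
  congr 1
  rw [Finset.sum_eq_single t]
  · simp
  · intro i _ hi
    simp [hi]
  · intro h
    exact absurd (Finset.mem_range.2 ht) h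

/-- Absence of arbitrage makes the affine spans linear. -/
theorem NoArbitrage.ae_zero_mem_affineSpan (hna : NoArbitrage P ℱ S T)
    (hS : ∀ t ≤ T, Measurable[ℱ t] (S t)) {t : ℕ} (ht : t < T)
    (hmom : HasAllMoments P fun ω => ‖increment S (t + 1) ω‖) :
    ∀ᵐ ω ∂P, (0 : EuclideanSpace ℝ (Fin d)) ∈
      affineSpan ℝ (regularLaw P (ℱ t) (increment S (t + 1)) ω).support := by
  have hY : Measurable (increment S (t + 1)) := (measurable_increment hS ht).mono (ℱ.le _) le_rfl
  obtain ⟨p, hp, hpY, hp0⟩ := exists_orthogonal_component (ℱ.le t) hY hmom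
  have hmeas : MeasurableSet[(ℱ t).prod inferInstance]
      {q : Ω × EuclideanSpace ℝ (Fin d) | (inner ℝ (p q.1) q.2 : ℝ) = ‖p q.1‖ ^ 2} := by
    have h1 : Measurable[(ℱ t).prod inferInstance]
        fun q : Ω × EuclideanSpace ℝ (Fin d) => p q.1 := hp.comp measurable_fst
    exact measurableSet_eq_fun (h1.inner measurable_snd) ((measurable_norm.pow_const 2).comp h1)
  have hpY' := (ae_regularLaw_iff (ℱ.le t) hY hmeas).1 hpY
  have hstrat : IsStrategy ℱ T (fun s => if s = t + 1 then p else 0) := fun s _ => by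
    by_cases hst : s = t
    · subst hst
      simpa using hp
    · simp only [add_left_inj, hst, if_false]
      exact measurable_const (a := 0)
  -- Holding `p` for one period earns the sure amount `‖p‖ ^ 2`, so absence of arbitrage forces `p =
  -- 0`.
  have hw : ∀ᵐ ω ∂P, wealth S 0 (fun s => if s = t + 1 then p else 0) T ω = ‖p ω‖ ^ 2 := by
    filter_upwards [hpY'] with ω hω
    rw [wealth_single ht, zero_add]
    exact hω
  have hzero := hna _ hstrat (hw.mono fun ω hω => by rw [hω]; positivity)
  filter_upwards [hw, hzero, hp0] with ω h1 h2 h3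
  refine h3 ?_
  rw [h1] at h2
  simpa using h2

/-- The quantitative no-arbitrage bound, simultaneously for all directions. -/
theorem IsNABound.ae_forall_direction (hna : NoArbitrage P ℱ S T)
    (hS : ∀ t ≤ T, Measurable[ℱ t] (S t)) {t : ℕ} (ht : t < T)
    (hmom : HasAllMoments P fun ω => ‖increment S (t + 1) ω‖) {β κ : Ω → ℝ}
    (hb : IsNABound P ℱ S t β κ) :
    ∀ᵐ ω ∂P, ∀ q ∈ Submodule.span ℝ (regularLaw P (ℱ t) (increment S (t + 1)) ω).support,
      ‖q‖ = 1 → κ ω ≤ (regularLaw P (ℱ t) (increment S (t + 1)) ω).real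
        {y | (inner ℝ q y : ℝ) ≤ -β ω} := by
  have hY : Measurable (increment S (t + 1)) := (measurable_increment hS ht).mono (ℱ.le _) le_rfl
  obtain ⟨hβ, hκ, -, -, hbound⟩ := hb
  obtain ⟨p, hp, hdense⟩ := exists_dense_directions (ℱ.le t) hY hmom
  -- An affine span containing the origin is the linear span, whose unit sphere the dense fields
  -- describe.
  have hspan : ∀ᵐ ω ∂P, ∀ x, x ∈ nextSpan P ℱ S t ω ↔
      x ∈ Submodule.span ℝ (regularLaw P (ℱ t) (increment S (t + 1)) ω).support := by
    filter_upwards [hna.ae_zero_mem_affineSpan hS ht hmom] with ω hω x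
    have h1 := affineSpan_insert_zero (k := ℝ)
      (regularLaw P (ℱ t) (increment S (t + 1)) ω).support
    rw [affineSpan_insert_eq_affineSpan ℝ hω] at h1
    exact Set.ext_iff.1 h1 x
  have hnt : ∀ᵐ ω ∂P, Nontriv P ℱ S t ω ↔
      Submodule.span ℝ (regularLaw P (ℱ t) (increment S (t + 1)) ω).support ≠ ⊥ := by
    filter_upwards [hspan] with ω hω
    rw [Nontriv, not_iff_not, Submodule.eq_bot_iff]
    constructor
    · intro h x hx
      have : x ∈ (nextSpan P ℱ S t ω : Set _) := (hω x).2 hx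
      rw [h] at this
      exact this
    · intro h
      ext x
      exact ⟨fun hx => h x ((hω x).1 hx), fun hx => (hω x).2 (by
        rw [Set.mem_singleton_iff.1 hx]; exact Submodule.zero_mem _)⟩
  have hunit : ∀ n, p n ∈ unitDirections P ℱ S t := fun n => by
    refine ⟨hp n, ?_, ?_⟩
    · filter_upwards [hspan, hdense] with ω h1 h2
      exact (h1 _).2 (h2.1 n)
    · filter_upwards [hnt, hdense] with ω h1 h2 h3
      exact h2.2.1 n (h1.1 h3)
  have hcond : ∀ n, ∀ᵐ ω ∂P, (P⟦{ω' | inner ℝ (p n ω') (increment S (t + 1) ω') < -β ω'} | ℱ t⟧) ω =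
      (regularLaw P (ℱ t) (increment S (t + 1)) ω).real {y | (inner ℝ (p n ω) y : ℝ) < -β ω} := by
    intro n
    let s : Set (Ω × EuclideanSpace ℝ (Fin d)) := {q | (inner ℝ (p n q.1) q.2 : ℝ) < -β q.1}
    have hs : MeasurableSet[(ℱ t).prod inferInstance] s := by
      have h1 : Measurable[(ℱ t).prod inferInstance]
        fun q : Ω × EuclideanSpace ℝ (Fin d) => p n q.1 := (hp n).comp measurable_fst
      exact measurableSet_lt (h1.inner measurable_snd) (hβ.comp measurable_fst).neg
    have hf : Measurable[(ℱ t).prod inferInstance] (s.indicator fun _ => (1 : ℝ)) :=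
      measurable_const.indicator hs
    have hid : @Measurable (Ω × EuclideanSpace ℝ (Fin d)) (Ω × EuclideanSpace ℝ (Fin d))
        (mΩ.prod inferInstance) ((ℱ t).prod inferInstance) id :=
      measurable_id'' (sup_le_sup_right (MeasurableSpace.comap_mono (ℱ.le t)) _)
    have hint : Integrable (fun ω => s.indicator (fun _ => (1 : ℝ)) (ω, increment S (t + 1) ω)) P := by
      refine (integrable_const (1 : ℝ)).mono'
        ((hf.comp hid).comp (measurable_id.prodMk hY)).aestronglyMeasurable (ae_of_all _ fun ω => ?_)
      by_cases h : (ω, increment S (t + 1) ω) ∈ s <;> simp [h]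
    filter_upwards [condExp_comp_ae_eq (ℱ.le t) hY hf.stronglyMeasurable hint] with ω hω
    have hsec : MeasurableSet {y : EuclideanSpace ℝ (Fin d) | (inner ℝ (p n ω) y : ℝ) < -β ω} :=
      measurableSet_lt (by fun_prop) measurable_const
    have e2 : ∫ z, s.indicator (fun _ => (1 : ℝ)) (ω, z)
        ∂regularLaw P (ℱ t) (increment S (t + 1)) ω =
        (regularLaw P (ℱ t) (increment S (t + 1)) ω).real
          {y | (inner ℝ (p n ω) y : ℝ) < -β ω} := by
      have : (fun z => s.indicator (fun _ => (1 : ℝ)) (ω, z)) =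
          {y : EuclideanSpace ℝ (Fin d) | (inner ℝ (p n ω) y : ℝ) < -β ω}.indicator 1 := by
        ext z
        simp [Set.indicator_apply, s]
      rw [this, integral_indicator_one hsec]
    rw [← e2, ← hω]
    rfl
  -- Only countably many fields are involved, so a single null set suffices; the remaining
  -- directions follow by passing to the limit.
  have hall : ∀ᵐ ω ∂P, ∀ n, Nontriv P ℱ S t ω → κ ω ≤
      (regularLaw P (ℱ t) (increment S (t + 1)) ω).real {y | (inner ℝ (p n ω) y : ℝ) < -β ω} := by
    rw [ae_all_iff]
    intro n
    filter_upwards [hbound _ (hunit n), hcond n] with ω h1 h2 h3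
    rw [← h2]
    exact h1 h3
  filter_upwards [hall, hnt, hdense] with ω h1 h2 h3 q hq hq1
  obtain ⟨u, hu⟩ := h3.2.2 q hq hq1
  refine le_measureReal_of_tendsto hu fun n => h1 _ (h2.2 fun h0 => ?_)
  rw [h0, Submodule.mem_bot] at hq
  simp [hq] at hq1

end Market

/-! ### The conditional one-step problem -/

section Moments

variable {Ω 𝒵 : Type*} {m mΩ : MeasurableSpace Ω} {m𝒵 : MeasurableSpace 𝒵}
  [StandardBorelSpace 𝒵] [Nonempty 𝒵] {P : Measure Ω} [IsProbabilityMeasure P] {Z : Ω → 𝒵}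

theorem HasAllMoments.integral_regularLaw (hm : m ≤ mΩ) (hZ : Measurable Z) {f : 𝒵 → ℝ}
    (hf : Measurable f) (h : HasAllMoments P fun ω => f (Z ω)) :
    HasAllMoments P fun ω => ∫ z, f z ∂regularLaw P m Z ω := by
  have h1 := condExp_comp_ae_eq hm hZ (f := fun p : Ω × 𝒵 => f p.2)
    (hf.comp measurable_snd).stronglyMeasurable h.integrable
  exact fun n => (memLp_congr_ae h1).1 (h.condExp m n)

theorem HasAllMoments.max_zero {X : Ω → ℝ} (h : HasAllMoments P X) :
    HasAllMoments P fun ω => max (X ω) 0 :=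
  h.mono ((h 0).1.sup aestronglyMeasurable_const) (ae_of_all _ fun ω => by
    rw [abs_of_nonneg (le_max_right _ _)]
    exact max_le (le_abs_self _) (abs_nonneg _))

/-- The exponents in `radius` are ceilings, so it is polynomial in `A`, the positive part of `X`,
and `W`. -/
theorem HasAllMoments.radius {θ C : ℝ} {A X W : Ω → ℝ} (hA : HasAllMoments P A)
    (hX : HasAllMoments P X) (hW : HasAllMoments P W) :
    HasAllMoments P fun ω => radius θ C (A ω) (X ω) (W ω) := by
  refine HasAllMoments.pow ?_ _
  exact (((((hasAllMoments_const 1).add hX.max_zero).mul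
    (hA.add (hasAllMoments_const C))).add hW).const_mul 2 |>.mul hA).mul
      (((hA.pow 3).const_mul 4).pow _)

theorem HasAllMoments.nextDepth {θ C : ℝ} {A : Ω → ℝ} (hA : HasAllMoments P A) :
    HasAllMoments P fun ω => nextDepth θ C (A ω) := by
  have hR := hA.radius (θ := θ) (C := C) (hasAllMoments_const 0) (hasAllMoments_const (C + 1))
  exact (((hA.const_mul 16).mul (((((hasAllMoments_const 1).add hR).mul hA).add
    (hasAllMoments_const C)).add (hasAllMoments_const 1))).add ((hR.const_mul 8).mul hA)).add
      (hA.const_mul 8) |>.add (hasAllMoments_const 1)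

end Moments

theorem continuous_nextDepth (θ C : ℝ) : Continuous (nextDepth θ C) := by
  unfold nextDepth radius radiusBase
  fun_prop

/-! ### From the value function at one date to that at the preceding date. -/

section Step

variable {U : ℝ → ℝ} {θ C L : ℝ} {r : ℕ} {Ω : Type*} {m mΩ : MeasurableSpace Ω}
  {P : Measure Ω} [IsProbabilityMeasure P] {E : Type*} [NormedAddCommGroup E]
  [InnerProductSpace ℝ E] [FiniteDimensional ℝ E] [MeasurableSpace E] [BorelSpace E]
  [StandardBorelSpace E] [Nonempty (State U θ C)] {X : Ω → State U θ C} {Y : Ω → E}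

/-- Continuity in the position reduces the supremum to a countable one, which makes the value
measurable in `ω`. -/
theorem GoodLaw.stepValue_eq_iSup (hU : GrowthData U θ C L r) {A : ℝ}
    {μ : Measure (State U θ C × E)} [IsProbabilityMeasure μ] (h : GoodLaw r A μ) (x : ℝ) :
    stepValue μ x = ⨆ n, expUtility μ x (TopologicalSpace.denseSeq E n) := by
  obtain ⟨ξ, hξ⟩ := h.exists_eq_stepValue hU x
  refine le_antisymm ?_ (ciSup_le fun n => h.expUtility_le_stepValue hU x _)
  rw [hξ]
  have hbdd : BddAbove (Set.range fun n => expUtility μ x (TopologicalSpace.denseSeq E n)) :=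
    (h.bddAbove_expUtility hU x).mono (Set.range_subset_iff.2 fun n => Set.mem_range_self _)
  exact (TopologicalSpace.denseRange_denseSeq E).induction_on
    (p := fun ξ => expUtility μ x ξ ≤ ⨆ n, expUtility μ x (TopologicalSpace.denseSeq E n)) ξ
    (isClosed_le (h.continuous_expUtility hU x) continuous_const) fun n => le_ciSup hbdd n

theorem measurable_expUtility_regularLaw {Z : Ω → State U θ C × E} {x : Ω → ℝ} {ξ : Ω → E}
    (hx : Measurable[m] x) (hξ : Measurable[m] ξ) :
    Measurable[m] fun ω => expUtility (regularLaw P m Z ω) (x ω) (ξ ω) := by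
  have h1 : Measurable[m.prod inferInstance] fun p : Ω × (State U θ C × E) =>
      ((x p.1, ξ p.1), p.2) :=
    ((hx.comp measurable_fst).prodMk (hξ.comp measurable_fst)).prodMk measurable_snd
  exact measurable_integral_regularLaw (f := fun p : Ω × (State U θ C × E) =>
    p.2.1.fn (x p.1 + inner ℝ (ξ p.1) p.2.2)) (State.measurable_fn_inner.comp h1)

/-- The conditional joint laws of a regular random utility function and an increment satisfy the
hypotheses of the one-step problem, with constants having finite moments of all orders. -/
theorem ae_goodLaw (hU : GrowthData U θ C L r) (hm : m ≤ mΩ) (hX : Measurable X)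
    (hY : Measurable Y) (hX1 : HasAllMoments P fun ω => (X ω).fn 1)
    (hXd : HasAllMoments P fun ω => (X ω).depth) (hYm : HasAllMoments P fun ω => ‖Y ω‖)
    {β κ : Ω → ℝ} (hβm : Measurable[m] β) (hκm : Measurable[m] κ) (hβ : ∀ᵐ ω ∂P, 0 < β ω)
    (hκ : ∀ᵐ ω ∂P, 0 < κ ω) (hβ' : HasAllMoments P fun ω => 1 / β ω)
    (hκ' : HasAllMoments P fun ω => 1 / κ ω)
    (hdir : ∀ᵐ ω ∂P, ∀ q ∈ Submodule.span ℝ (regularLaw P m Y ω).support,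
      ‖q‖ = 1 → κ ω ≤ (regularLaw P m Y ω).real {y | (inner ℝ q y : ℝ) ≤ -β ω}) :
    ∃ A : Ω → ℝ, Measurable[m] A ∧ HasAllMoments P A ∧
      ∀ᵐ ω ∂P, GoodLaw r (A ω) (regularLaw P m (fun ω => (X ω, Y ω)) ω) := by
  set Z : Ω → State U θ C × E := fun ω => (X ω, Y ω) with hZdef
  have hZ : Measurable Z := hX.prodMk hY
  have hev : Continuous fun z : State U θ C × E => z.1.fn 1 :=
    State.continuous_fn_uncurry.comp (continuous_fst.prodMk continuous_const)
  have mf1 : Measurable fun z : State U θ C × E => (1 + ‖z.2‖) * z.1.fn 1 :=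
    ((continuous_const.add continuous_snd.norm).mul hev).measurable
  have mf2 : Measurable fun z : State U θ C × E => ‖z.2‖ := continuous_snd.norm.measurable
  have mf3 : Measurable fun z : State U θ C × E => z.1.depth :=
    (State.continuous_depth.comp continuous_fst).measurable
  have mf4 : Measurable fun z : State U θ C × E => (1 + ‖z.2‖) ^ r :=
    ((continuous_const.add continuous_snd.norm).pow r).measurable
  have k1 : HasAllMoments P fun ω => (1 + ‖(Z ω).2‖) * (Z ω).1.fn 1 :=
    ((hasAllMoments_const 1).add hYm).mul hX1
  have k4 : HasAllMoments P fun ω => (1 + ‖(Z ω).2‖) ^ r :=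
    ((hasAllMoments_const 1).add hYm).pow r
  let I1 : Ω → ℝ := fun ω => ∫ z, (1 + ‖z.2‖) * z.1.fn 1 ∂regularLaw P m Z ω
  let I2 : Ω → ℝ := fun ω => ∫ z, ‖z.2‖ ∂regularLaw P m Z ω
  let I3 : Ω → ℝ := fun ω => ∫ z, z.1.depth ∂regularLaw P m Z ω
  have mI : ∀ {f : State U θ C × E → ℝ}, Measurable f →
      Measurable[m] fun ω => ∫ z, f z ∂regularLaw P m Z ω := fun hf =>
    measurable_integral_regularLaw (f := fun p => _) (hf.comp measurable_snd)
  -- A single constant dominating each of the required ones: it bounds the three integrals, and `1 /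
  -- A` is below both `β` and `κ`.
  let A : Ω → ℝ := fun ω => 1 + |1 / β ω| + |1 / κ ω| + I1 ω + I2 ω + I3 ω
  have h1β : Measurable[m] fun ω => 1 / β ω := hβm.const_div 1
  have h1κ : Measurable[m] fun ω => 1 / κ ω := hκm.const_div 1
  have hAm : Measurable[m] A :=
    (((((measurable_norm.comp h1β).const_add 1).add (measurable_norm.comp h1κ)).add
      (mI mf1)).add (mI mf2)).add (mI mf3)
  have hAmom : HasAllMoments P A :=
    (((((hasAllMoments_const 1).add hβ'.abs).add hκ'.abs).add
      (k1.integral_regularLaw hm hZ mf1)).add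
      (HasAllMoments.integral_regularLaw hm hZ mf2 hYm)).add
      (HasAllMoments.integral_regularLaw hm hZ mf3 hXd)
  have hint : ∀ {f : State U θ C × E → ℝ}, Measurable f → HasAllMoments P (fun ω => f (Z ω)) →
      ∀ᵐ ω ∂P, Integrable f (regularLaw P m Z ω) := fun hf h =>
    integrable_regularLaw hm hZ (f := fun p => _) (hf.comp measurable_snd) h.integrable
  -- The directional bound concerns the law of `Y` alone; by uniqueness of conditional laws it is
  -- almost surely the marginal of the joint law.
  have hmap : ∀ᵐ ω ∂P, regularLaw P m Y ω = (regularLaw P m Z ω).map Prod.snd := by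
    have h := @condDistrib_comp Ω Ω (State U θ C × E) _ _ _ mΩ P _ Z m E _ _ _ id
      hZ.aemeasurable Prod.snd measurable_snd
    have htrim : ∀ᵐ ω ∂(P.trim hm), regularLaw P m Y ω =
        ((regularLaw P m Z).map Prod.snd) ω := by
      rw [trim_eq_map]; exact h
    filter_upwards [ae_of_ae_trim hm htrim] with ω hω
    rw [hω]
    exact Kernel.map_apply _ measurable_snd ω
  refine ⟨A, hAm, hAmom, ?_⟩
  filter_upwards [hint mf1 k1, hint mf2 hYm, hint mf3 hXd, hint mf4 k4, hmap, hdir, hβ, hκ]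
    with ω i1 i2 i3 i4 hmapω hdirω hβω hκω
  have n1 : 0 ≤ I1 ω := integral_nonneg fun z =>
    mul_nonneg (by positivity) (z.1.fn_one_nonneg hU)
  have n2 : 0 ≤ I2 ω := integral_nonneg fun z => norm_nonneg _
  have n3 : 0 ≤ I3 ω := integral_nonneg fun z => zero_le_one.trans z.1.one_le_depth
  have nβ : 0 < 1 / β ω := by positivity
  have nκ : 0 < 1 / κ ω := by positivity
  have hA : A ω = 1 + 1 / β ω + 1 / κ ω + I1 ω + I2 ω + I3 ω := by
    simp only [A, abs_of_pos nβ, abs_of_pos nκ]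
  have hAβ : 1 / A ω ≤ β ω := by
    rw [one_div_le (by linarith) hβω]; linarith
  have hAκ : 1 / A ω ≤ κ ω := by
    rw [one_div_le (by linarith) hκω]; linarith
  refine ⟨by linarith, i4, i1, by change I1 ω ≤ _; linarith, i2, by change I2 ω ≤ _; linarith,
    i3, by change I3 ω ≤ _; linarith, Submodule.span ℝ (regularLaw P m Y ω).support, ?_, ?_⟩
  · have hs := Measure.support_mem_ae (μ := regularLaw P m Y ω)
    have hs' : ∀ᵐ y ∂(regularLaw P m Y ω),
        y ∈ Submodule.span ℝ (regularLaw P m Y ω).support := by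
      filter_upwards [hs] with y hy using Submodule.subset_span hy
    have hs'' : ∀ᵐ y ∂((regularLaw P m Z ω).map Prod.snd),
        y ∈ Submodule.span ℝ (regularLaw P m Y ω).support := hmapω ▸ hs'
    exact ae_of_ae_map measurable_snd.aemeasurable hs''
  · intro q hq hq1
    refine hAκ.trans ((hdirω q hq hq1).trans ?_)
    rw [hmapω, map_measureReal_apply measurable_snd
      (measurableSet_le (by fun_prop) measurable_const)]
    refine measureReal_mono fun z hz => ?_
    have hz' : (inner ℝ q z.2 : ℝ) ≤ -β ω := hz
    change (inner ℝ q z.2 : ℝ) ≤ -(1 / A ω)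
    linarith

/-- The conditional value function of a regular random utility function is a regular random
utility function. -/
theorem exists_state_stepValue (hU : GrowthData U θ C L r) (hm : m ≤ mΩ)
    (hnull : ∀ s, MeasurableSet s → P s = 0 → MeasurableSet[m] s)
    {Z : Ω → State U θ C × E} {A : Ω → ℝ} (hA : Measurable[m] A) (hAm : HasAllMoments P A)
    (hgood : ∀ᵐ ω ∂P, GoodLaw r (A ω) (regularLaw P m Z ω)) :
    ∃ X' : Ω → State U θ C, Measurable[m] X' ∧
      HasAllMoments P (fun ω => (X' ω).fn 1) ∧ HasAllMoments P (fun ω => (X' ω).depth) ∧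
      ∀ᵐ ω ∂P, (X' ω).fn = stepValue (regularLaw P m Z ω) := by
  classical
  -- The null events belong to `m`, so a fixed state can be substituted on the exceptional set
  -- without losing `m`-measurability.
  obtain ⟨N, hN, hNm, hN0⟩ := exists_measurable_superset_of_null (ae_iff.1 hgood)
  have hNm' : MeasurableSet[m] N := hnull N hNm hN0
  have hg : ∀ ω, ω ∉ N → GoodLaw r (A ω) (regularLaw P m Z ω) := fun ω hω => by
    by_contra h
    exact hω (hN h)
  let s₀ : State U θ C := Classical.arbitrary _
  let X' : Ω → State U θ C := fun ω => if h : ω ∈ N then s₀ else (hg ω h).next hU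
  have hfn : ∀ ω x, (X' ω).fn x = if ω ∈ N then s₀.fn x else
      ⨆ n, expUtility (regularLaw P m Z ω) x (TopologicalSpace.denseSeq E n) := fun ω x => by
    by_cases h : ω ∈ N
    · simp only [X', h, dite_true, if_true]
    · simp only [X', h, dite_false, if_false]
      exact (hg ω h).stepValue_eq_iSup hU x
  have hdep : ∀ ω, (X' ω).depth = if ω ∈ N then s₀.depth else nextDepth θ C (A ω) := fun ω => by
    by_cases h : ω ∈ N
    · simp only [X', h, dite_true, if_true]
    · simp only [X', h, dite_false, if_false]
      rfl
  have hmeas_fn : ∀ x, Measurable[m] fun ω => (X' ω).fn x := fun x => by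
    simp only [hfn]
    exact Measurable.ite hNm' measurable_const (Measurable.iSup fun n =>
      measurable_expUtility_regularLaw measurable_const measurable_const)
  have hmeas_dep : Measurable[m] fun ω => (X' ω).depth := by
    simp only [hdep]
    exact Measurable.ite hNm' measurable_const ((continuous_nextDepth θ C).measurable.comp hA)
  have hX' : Measurable[m] X' :=
    Measurable.subtype_mk ((measurable_continuousMap_of_eval hmeas_fn).prodMk hmeas_dep)
  have hNae : ∀ᵐ ω ∂P, ω ∉ N := measure_eq_zero_iff_ae_notMem.1 hN0
  have hstep : ∀ᵐ ω ∂P, (X' ω).fn = stepValue (regularLaw P m Z ω) := by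
    filter_upwards [hNae] with ω hω
    simp only [X', hω, dite_false]
    rfl
  refine ⟨X', hX', ?_, ?_, hstep⟩
  · have hmom := ((hasAllMoments_const (P := P) 2).add (hAm.radius (θ := θ) (C := C)
      (hasAllMoments_const 1) (hasAllMoments_const 0))).mul hAm
    refine hmom.mono ((hmeas_fn 1).mono hm le_rfl).aestronglyMeasurable ?_
    filter_upwards [hNae, hstep] with ω hω hs
    rw [abs_of_nonneg ((X' ω).fn_one_nonneg hU), hs]
    exact ((hg ω hω).stepValue_one_le hU).trans (le_abs_self _)
  · refine (hAm.nextDepth (θ := θ) (C := C)).mono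
      ((hmeas_dep).mono hm le_rfl).aestronglyMeasurable ?_
    filter_upwards [hNae] with ω hω
    rw [hdep, if_neg hω]

end Step

/-! ### Extended expectations -/

theorem extExp_of_integrable {Ω : Type*} {mΩ : MeasurableSpace Ω} {P : Measure Ω} {X : Ω → ℝ}
    (h : Integrable X P) : extExp P X = ((∫ ω, X ω ∂P : ℝ) : EReal) := by
  rw [extExp, integral_eq_lintegral_pos_part_sub_lintegral_neg_part h, EReal.coe_sub]
  have h1 : ∫⁻ ω, ENNReal.ofReal (X ω) ∂P ≠ ⊤ := h.lintegral_lt_top.ne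
  have h2 : ∫⁻ ω, ENNReal.ofReal (-X ω) ∂P ≠ ⊤ := h.neg.lintegral_lt_top.ne
  rw [EReal.coe_ennreal_toReal h1, EReal.coe_ennreal_toReal h2]

/-! ### The growth of the utility function -/

section Utility

variable {U : ℝ → ℝ}

theorem ConcaveOn.mul_le_of_map_zero (hc : ConcaveOn ℝ Set.univ U) (h0 : U 0 = 0) (x : ℝ) {l : ℝ}
    (hl : 1 ≤ l) : U (l * x) ≤ l * U x := by
  have hl0 : 0 < l := by linarith
  have h := hc.2 (Set.mem_univ (l * x)) (Set.mem_univ 0) (show (0 : ℝ) ≤ l⁻¹ by positivity)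
    (show (0 : ℝ) ≤ 1 - l⁻¹ by linarith [inv_le_one_of_one_le₀ hl]) (by ring)
  simp only [smul_eq_mul, mul_zero, add_zero, h0] at h
  rwa [inv_mul_cancel_left₀ hl0.ne', inv_mul_le_iff₀ hl0] at h

/-- Either condition of reasonable asymptotic elasticity yields a global elasticity estimate. -/
theorem exists_elasticity (h : ElasticAtTop U ∨ ElasticAtBot U) :
    ConcaveOn ℝ Set.univ U ∧ Monotone U ∧ U 0 = 0 ∧ ∃ θ C : ℝ, 0 < θ ∧ θ ≠ 1 ∧ 0 ≤ C ∧
      ∀ x l : ℝ, 1 ≤ l → U (l * x) ≤ l ^ θ * (U x + C) := by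
  rcases h with ⟨hc, hm, h0, x₀, hx₀, γ, hγ0, hγ1, hγ⟩ | ⟨hc, hm, h0, x₀, hx₀, α, hα, hαU⟩
  · have hC : 0 ≤ U x₀ := h0.symm.le.trans (hm hx₀.le)
    -- Above `x₀` this is the hypothesis; on `[0, x₀]` monotonicity reduces to `x₀`, whence `C = U
    -- x₀`; below `0`, concavity suffices because `U x ≤ 0` and `l ^ γ ≤ l`.
    refine ⟨hc, hm, h0, γ, U x₀, hγ0, hγ1.ne, hC, fun x l hl => ?_⟩
    have hlγ : 0 ≤ l ^ γ := by positivity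
    rcases le_total x₀ x with hx | hx
    · exact (hγ x hx l hl).trans (mul_le_mul_of_nonneg_left (by linarith) hlγ)
    · rcases le_total 0 x with hx0 | hx0
      · have hUx : 0 ≤ U x := h0.symm.le.trans (hm hx0)
        refine (hm (mul_le_mul_of_nonneg_left hx (by linarith))).trans
          ((hγ x₀ le_rfl l hl).trans (mul_le_mul_of_nonneg_left (by linarith) hlγ))
      · have hUx : U x ≤ 0 := (hm hx0).trans h0.le
        have hl1 : l ^ γ ≤ l := by
          simpa using Real.rpow_le_rpow_of_exponent_le hl hγ1.le
        refine (ConcaveOn.mul_le_of_map_zero hc h0 x hl).trans ?_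
        nlinarith
  · have hC : 0 ≤ -U x₀ := by linarith [(hm hx₀).trans h0.le]
    -- Below `x₀` this is the hypothesis; above `0`, concavity suffices because `l ≤ l ^ (1 + α)`;
    -- in between, `U (l * x) ≤ 0 ≤ U x + C` with `C = -U x₀`.
    refine ⟨hc, hm, h0, 1 + α, -U x₀, by linarith, by linarith, hC, fun x l hl => ?_⟩
    have hlγ : 0 ≤ l ^ (1 + α) := by positivity
    rcases le_total x x₀ with hx | hx
    · exact (hαU x hx l hl).trans (mul_le_mul_of_nonneg_left (by linarith) hlγ)
    · rcases le_total 0 x with hx0 | hx0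
      · have hUx : 0 ≤ U x := h0.symm.le.trans (hm hx0)
        have hl1 : l ≤ l ^ (1 + α) := by
          simpa using Real.rpow_le_rpow_of_exponent_le hl (show (1 : ℝ) ≤ 1 + α by linarith)
        refine (ConcaveOn.mul_le_of_map_zero hc h0 x hl).trans ?_
        nlinarith
      · have h1 : U (l * x) ≤ 0 := by
          rw [← h0]; exact hm (mul_nonpos_of_nonneg_of_nonpos (by linarith) hx0)
        have h2 := hm hx
        exact h1.trans (mul_nonneg hlγ (by linarith))

theorem deriv_le_of_rpow_bound {k K : ℝ} (hK : 0 ≤ K) (hk : 0 ≤ k)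
    (h_upper : ∀ x : ℝ, deriv U x ≤ K * (|x| ^ k + 1)) (x : ℝ) :
    deriv U x ≤ 2 * K * (1 + |x|) ^ (⌈k⌉₊) := by
  refine (h_upper x).trans ?_
  have h1 : |x| ^ k ≤ (1 + |x|) ^ (⌈k⌉₊) := by
    rw [← Real.rpow_natCast]
    exact (Real.rpow_le_rpow (abs_nonneg x) (by linarith) hk).trans
      (Real.rpow_le_rpow_of_exponent_le (by linarith [abs_nonneg x]) (Nat.le_ceil k))
  have h2 : 1 ≤ (1 + |x|) ^ (⌈k⌉₊) := one_le_pow₀ (by linarith [abs_nonneg x])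
  nlinarith

/-- The mean value theorem between `x < 0` and `0`; the factor `|x|` raises the degree by one. -/
theorem lower_bound_of_deriv_le (h0 : U 0 = 0) (hm : Monotone U) (hd : Differentiable ℝ U)
    {L : ℝ} (hL : 0 ≤ L) {r : ℕ} (h : ∀ x, deriv U x ≤ L * (1 + |x|) ^ r) (x : ℝ) :
    -(L * (1 + |x|) ^ (r + 1)) ≤ U x := by
  rcases le_or_gt 0 x with hx | hx
  · have : 0 ≤ U x := h0.symm.le.trans (hm hx)
    have : 0 ≤ L * (1 + |x|) ^ (r + 1) := by positivity
    linarith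
  · obtain ⟨c, ⟨hc1, hc2⟩, hc⟩ := exists_deriv_eq_slope U hx hd.continuous.continuousOn
      hd.differentiableOn
    rw [h0, eq_div_iff (by linarith)] at hc
    have h1 : |c| ≤ |x| := by rw [abs_of_neg hc2, abs_of_neg hx]; linarith
    have h2 : deriv U c ≤ L * (1 + |x|) ^ r := (h c).trans (by gcongr)
    have h3 : deriv U c * (0 - x) ≤ L * (1 + |x|) ^ r * (1 + |x|) := by
      refine mul_le_mul h2 (by rw [abs_of_neg hx]; linarith) (by linarith) (by positivity)
    rw [pow_succ, ← mul_assoc]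
    linarith

/-- The starting point of the backward recursion. Strict monotonicity gives `U (-1) < 0`, and
concavity then gives `U (-n) ≤ n * U (-1)`, from which the depth is read off. -/
theorem exists_state_of_utility (hc : ConcaveOn ℝ Set.univ U) (hm : StrictMono U) (h0 : U 0 = 0)
    {θ C : ℝ} (hel : ∀ x l : ℝ, 1 ≤ l → U (l * x) ≤ l ^ θ * (U x + C)) :
    ∃ s : State U θ C, s.fn = U := by
  have hcont : Continuous U := by
    rw [← continuousOn_univ]
    exact hc.continuousOn isOpen_univ
  have hneg : U (-1) < 0 := by rw [← h0]; exact hm (by norm_num)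
  set n : ℝ := max 1 ((C + 1) / (-U (-1))) with hn
  have hn1 : 1 ≤ n := le_max_left _ _
  refine ⟨⟨(⟨U, hcont⟩, n), hc, hm.monotone, fun x => le_rfl, hel, hn1, ?_⟩, rfl⟩
  have h1 := ConcaveOn.mul_le_of_map_zero hc h0 (-1) hn1
  have h2 : (C + 1) / (-U (-1)) ≤ n := le_max_right _ _
  rw [div_le_iff₀ (by linarith)] at h2
  change U (-n) ≤ -(C + 1)
  rw [mul_neg_one] at h1
  linarith

end Utility

/-! ### The value process -/

/-- Dependent choice backward from a terminal value. -/
theorem exists_backward_sequence {α : Type*} {p : ℕ → α → Prop} {R : ℕ → α → α → Prop} (T : ℕ)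
    (a : α) (ha : p T a) (h : ∀ t < T, ∀ x, p (t + 1) x → ∃ y, p t y ∧ R t y x) :
    ∃ f : ℕ → α, f T = a ∧ (∀ t ≤ T, p t (f t)) ∧ ∀ t < T, R t (f t) (f (t + 1)) := by
  induction T generalizing a with
  | zero => exact ⟨fun _ => a, rfl, fun t ht => by
      obtain rfl : t = 0 := by omega
      exact ha, fun t ht => by omega⟩
  | succ T ih =>
    obtain ⟨y, hy, hR⟩ := h T (by omega) a ha
    obtain ⟨f, hfT, hfp, hfR⟩ := ih y hy fun t ht => h t (by omega)
    refine ⟨fun t => if t = T + 1 then a else f t, by simp, fun t ht => ?_, fun t ht => ?_⟩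
    · by_cases htT : t = T + 1
      · subst htT; simpa using ha
      · simpa [htT] using hfp t (by omega)
    · by_cases htT : t = T
      · subst htT; simpa [hfT] using hR
      · have h1 : t ≠ T + 1 := by omega
        have h2 : t + 1 ≠ T + 1 := by omega
        simpa [h1, h2, htT] using hfR t (by omega)

section Value

variable {U : ℝ → ℝ} {θ C L : ℝ} {r : ℕ} {Ω : Type*} {mΩ : MeasurableSpace Ω}
  {P : Measure Ω} [IsProbabilityMeasure P] {T d : ℕ} {ℱ : Filtration ℕ mΩ}
  {S : ℕ → Ω → EuclideanSpace ℝ (Fin d)} [Nonempty (State U θ C)]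

/-- The conditional joint law of the value function at time `t + 1` and of the increment of the
prices, given the information at time `t`. -/
def stepLaw (P : Measure Ω) [IsProbabilityMeasure P] (ℱ : Filtration ℕ mΩ)
    (S : ℕ → Ω → EuclideanSpace ℝ (Fin d)) (X : ℕ → Ω → State U θ C) (t : ℕ) (ω : Ω) :
    Measure (State U θ C × EuclideanSpace ℝ (Fin d)) :=
  regularLaw P (ℱ t) (fun ω => (X (t + 1) ω, increment S (t + 1) ω)) ω

instance (X : ℕ → Ω → State U θ C) (t : ℕ) (ω : Ω) :
    IsProbabilityMeasure (stepLaw P ℱ S X t ω) := by unfold stepLaw; infer_instance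

/-- `X` is the process of the value functions `U_t`, and `A` is the process of the constants of
the one-step problems. -/
structure IsValueProcess (P : Measure Ω) [IsProbabilityMeasure P] (ℱ : Filtration ℕ mΩ)
    (S : ℕ → Ω → EuclideanSpace ℝ (Fin d)) (T r : ℕ) (X : ℕ → Ω → State U θ C)
    (A : ℕ → Ω → ℝ) : Prop where
  terminal : ∀ ω, (X T ω).fn = U
  measurable : ∀ t ≤ T, Measurable[ℱ t] (X t)
  moments : ∀ t ≤ T, HasAllMoments P fun ω => (X t ω).fn 1
  measurable_const : ∀ t < T, Measurable[ℱ t] (A t)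
  moments_const : ∀ t < T, HasAllMoments P (A t)
  goodLaw : ∀ t < T, ∀ᵐ ω ∂P, GoodLaw r (A t ω) (stepLaw P ℱ S X t ω)
  step : ∀ t < T, ∀ᵐ ω ∂P, (X t ω).fn = stepValue (stepLaw P ℱ S X t ω)

theorem exists_isValueProcess (hU : GrowthData U θ C L r) {s : State U θ C} (hs : s.fn = U)
    (h_null : ∀ s : Set Ω, MeasurableSet s → P s = 0 → MeasurableSet[ℱ 0] s)
    (hS : ∀ t ≤ T, Measurable[ℱ t] (S t))
    (hmom : ∀ t ≤ T, HasAllMoments P (fun ω => ‖increment S t ω‖))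
    (hna : NoArbitrage P ℱ S T) {β κ : ℕ → Ω → ℝ}
    (hb : ∀ t < T, IsNABound P ℱ S t (β t) (κ t))
    (hβ : ∀ t < T, HasAllMoments P (fun ω => 1 / β t ω))
    (hκ : ∀ t < T, HasAllMoments P (fun ω => 1 / κ t ω)) :
    ∃ (X : ℕ → Ω → State U θ C) (A : ℕ → Ω → ℝ), IsValueProcess P ℱ S T r X A := by
  obtain ⟨f, hfT, hfp, hfR⟩ := exists_backward_sequence (α := Ω → State U θ C)
    (p := fun t X => Measurable[ℱ t] X ∧ HasAllMoments P (fun ω => (X ω).fn 1) ∧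
      HasAllMoments P (fun ω => (X ω).depth))
    (R := fun t X' X => ∃ A : Ω → ℝ, Measurable[ℱ t] A ∧ HasAllMoments P A ∧
      (∀ᵐ ω ∂P, GoodLaw r (A ω)
        (regularLaw P (ℱ t) (fun ω => (X ω, increment S (t + 1) ω)) ω)) ∧
      ∀ᵐ ω ∂P, (X' ω).fn =
        stepValue (regularLaw P (ℱ t) (fun ω => (X ω, increment S (t + 1) ω)) ω))
    T (fun _ => s) ⟨measurable_const, hasAllMoments_const _, hasAllMoments_const _⟩ (by
      rintro t ht X ⟨hX, hX1, hXd⟩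
      have hY : Measurable (increment S (t + 1)) :=
        (measurable_increment hS ht).mono (ℱ.le _) le_rfl
      obtain ⟨hβm, hκm, hβ0, hκ0, -⟩ := hb t ht
      obtain ⟨A, hA, hAm, hgood⟩ := ae_goodLaw hU (ℱ.le t) (hX.mono (ℱ.le _) le_rfl) hY hX1 hXd
        (hmom (t + 1) ht) hβm hκm hβ0 hκ0 (hβ t ht) (hκ t ht)
        ((hb t ht).ae_forall_direction hna hS ht (hmom (t + 1) ht))
      obtain ⟨X', h1, h2, h3, h4⟩ := exists_state_stepValue hU (ℱ.le t)
        (fun s hs hs0 => ℱ.mono (Nat.zero_le t) _ (h_null s hs hs0)) hA hAm hgood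
      exact ⟨X', ⟨h1, h2, h3⟩, A, hA, hAm, hgood, h4⟩)
  choose A hA using hfR
  refine ⟨f, fun t => if ht : t < T then A t ht else 0, fun ω => by rw [hfT]; exact hs,
    fun t ht => (hfp t ht).1, fun t ht => (hfp t ht).2.1, fun t ht => ?_, fun t ht => ?_,
    fun t ht => ?_, fun t ht => (hA t ht).2.2.2⟩
  · simp only [ht, dite_true]; exact (hA t ht).1
  · simp only [ht, dite_true]; exact (hA t ht).2.1
  · simp only [ht, dite_true]; exact (hA t ht).2.2.1

namespace IsValueProcess

variable {X : ℕ → Ω → State U θ C} {A : ℕ → Ω → ℝ}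

theorem measurable_pair (hX : IsValueProcess P ℱ S T r X A) (hS : ∀ t ≤ T, Measurable[ℱ t] (S t))
    {t : ℕ} (ht : t < T) : Measurable fun ω => (X (t + 1) ω, increment S (t + 1) ω) :=
  ((hX.measurable _ ht).mono (ℱ.le _) le_rfl).prodMk
    ((measurable_increment hS ht).mono (ℱ.le _) le_rfl)

theorem measurable_integrand {t : ℕ} {x : Ω → ℝ} {ξ : Ω → EuclideanSpace ℝ (Fin d)}
    (hx : Measurable[ℱ t] x) (hξ : Measurable[ℱ t] ξ) :
    Measurable[(ℱ t).prod inferInstance] fun p : Ω × (State U θ C × EuclideanSpace ℝ (Fin d)) =>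
      p.2.1.fn (x p.1 + inner ℝ (ξ p.1) p.2.2) := by
  have h1 : Measurable[(ℱ t).prod inferInstance]
      fun p : Ω × (State U θ C × EuclideanSpace ℝ (Fin d)) => ((x p.1, ξ p.1), p.2) :=
    ((hx.comp measurable_fst).prodMk (hξ.comp measurable_fst)).prodMk measurable_snd
  exact State.measurable_fn_inner.comp h1

/-- The sign `σ = ±1` treats the positive and negative parts together. -/
theorem condLExp_eq (hX : IsValueProcess P ℱ S T r X A) (hS : ∀ t ≤ T, Measurable[ℱ t] (S t))
    {t : ℕ} (ht : t < T) (x : ℝ) {ξ : Ω → EuclideanSpace ℝ (Fin d)} (hξ : Measurable[ℱ t] ξ)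
    (σ : ℝ) : ∀ᵐ ω ∂P, condLExp (ℱ t) P (fun ω => ENNReal.ofReal
        (σ * (X (t + 1) ω).fn (x + inner ℝ (ξ ω) (increment S (t + 1) ω)))) ω =
      ∫⁻ z, ENNReal.ofReal (σ * z.1.fn (x + inner ℝ (ξ ω) z.2)) ∂stepLaw P ℱ S X t ω := by
  have hF := ENNReal.measurable_ofReal.comp ((measurable_const_mul σ).comp
    (measurable_integrand (U := U) (θ := θ) (C := C) (t := t) (x := fun _ => x)
      _root_.measurable_const hξ))
  filter_upwards [condLExp_comp_ae_eq (P := P) (ℱ.le t) (hX.measurable_pair hS ht) hF] with ω hω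
  exact hω.symm

theorem condLExp_pos_neg (hX : IsValueProcess P ℱ S T r X A)
    (hS : ∀ t ≤ T, Measurable[ℱ t] (S t)) {t : ℕ} (ht : t < T) (x : ℝ)
    {ξ : Ω → EuclideanSpace ℝ (Fin d)} (hξ : Measurable[ℱ t] ξ) :
    ∀ᵐ ω ∂P, condLExp (ℱ t) P (fun ω => ENNReal.ofReal
          ((X (t + 1) ω).fn (x + inner ℝ (ξ ω) (increment S (t + 1) ω)))) ω =
        ∫⁻ z, ENNReal.ofReal (z.1.fn (x + inner ℝ (ξ ω) z.2)) ∂stepLaw P ℱ S X t ω ∧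
      condLExp (ℱ t) P (fun ω => ENNReal.ofReal
          (-(X (t + 1) ω).fn (x + inner ℝ (ξ ω) (increment S (t + 1) ω)))) ω =
        ∫⁻ z, ENNReal.ofReal (-z.1.fn (x + inner ℝ (ξ ω) z.2)) ∂stepLaw P ℱ S X t ω := by
  have h1 := hX.condLExp_eq hS ht x hξ 1
  have h2 := hX.condLExp_eq hS ht x hξ (-1)
  simp only [one_mul, neg_mul] at h1 h2
  filter_upwards [h1, h2] with ω e1 e2 using ⟨e1, e2⟩

theorem extCondExp_eq (hU : GrowthData U θ C L r) (hX : IsValueProcess P ℱ S T r X A)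
    (hS : ∀ t ≤ T, Measurable[ℱ t] (S t)) {t : ℕ} (ht : t < T) (x : ℝ)
    {ξ : Ω → EuclideanSpace ℝ (Fin d)} (hξ : Measurable[ℱ t] ξ) :
    ∀ᵐ ω ∂P, extCondExp P (ℱ t)
        (fun ω => (X (t + 1) ω).fn (x + inner ℝ (ξ ω) (increment S (t + 1) ω))) ω =
      (expUtility (stepLaw P ℱ S X t ω) x (ξ ω) : EReal) := by
  filter_upwards [hX.condLExp_pos_neg hS ht x hξ, hX.goodLaw t ht] with ω hω hg
  rw [extCondExp, hω.1, hω.2]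
  exact extExp_of_integrable (hg.integrable_fn hU x (ξ ω))

/-- The value functions are well defined. -/
theorem isValueFunction (hU : GrowthData U θ C L r) (hX : IsValueProcess P ℱ S T r X A)
    (hS : ∀ t ≤ T, Measurable[ℱ t] (S t)) :
    IsValueFunction P ℱ S T U (fun t x ω => (X t ω).fn x) where
  terminal x ω := by rw [hX.terminal]
  measurable t ht x :=
    ((State.continuous_fn_uncurry.comp (continuous_id.prodMk continuous_const)).measurable).comp
      (hX.measurable t ht)
  regular t _ := ae_of_all _ fun ω => ⟨(X t ω).mono, (X t ω).concave⟩
  wellDefined t ht x ξ hξ := by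
    filter_upwards [hX.condLExp_pos_neg hS ht x hξ, hX.goodLaw t ht] with ω hω hg
    left
    rw [hω.1]
    exact (hg.integrable_fn hU x (ξ ω)).lintegral_lt_top.ne
  essSup t ht x := by
    have hmeas : Measurable fun ω => (X t ω).fn x :=
      ((State.continuous_fn_uncurry.comp (continuous_id.prodMk continuous_const)).measurable).comp
        ((hX.measurable t ht.le).mono (ℱ.le t) le_rfl)
    refine ⟨hmeas.coe_real_ereal, fun ξ hξ => ?_, fun Z hZ hle => ?_⟩
    · filter_upwards [hX.extCondExp_eq hU hS ht x hξ, hX.goodLaw t ht, hX.step t ht]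
        with ω h1 h2 h3
      rw [h1, h3]
      exact EReal.coe_le_coe_iff.2 (h2.expUtility_le_stepValue hU x (ξ ω))
    -- Constant positions from a dense sequence already determine the essential supremum, by
    -- continuity of the expected utility in the position.
    · have hall : ∀ᵐ ω ∂P, ∀ n, (expUtility (stepLaw P ℱ S X t ω) x
          (TopologicalSpace.denseSeq (EuclideanSpace ℝ (Fin d)) n) : EReal) ≤ Z ω := by
        rw [ae_all_iff]
        intro n
        have hc : Measurable[ℱ t] fun _ : Ω =>
          TopologicalSpace.denseSeq (EuclideanSpace ℝ (Fin d)) n := _root_.measurable_const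
        filter_upwards [hle _ hc, hX.extCondExp_eq hU hS ht x hc] with ω h1 h2
        rwa [h2] at h1
      filter_upwards [hall, hX.goodLaw t ht, hX.step t ht] with ω h1 h2 h3
      obtain ⟨ξ, hξ⟩ := h2.exists_eq_stepValue hU x
      rw [h3, hξ]
      exact (TopologicalSpace.denseRange_denseSeq _).induction_on
        (p := fun ξ => (expUtility (stepLaw P ℱ S X t ω) x ξ : EReal) ≤ Z ω) ξ
        (isClosed_le (continuous_coe_real_ereal.comp (h2.continuous_expUtility hU x))
          continuous_const) h1

theorem wellPosed (hU : GrowthData U θ C L r) (hX : IsValueProcess P ℱ S T r X A)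
    (hS : ∀ t ≤ T, Measurable[ℱ t] (S t)) : WellPosed P ℱ S T U := by
  refine ⟨_, hX.isValueFunction hU hS, fun x => ?_⟩
  have h : Integrable (fun ω => (1 + |x|) * (X 0 ω).fn 1) P :=
    (hX.moments 0 (Nat.zero_le T)).integrable.const_mul _
  refine lt_of_le_of_lt (lintegral_mono fun ω => ENNReal.ofReal_le_ofReal ?_) h.lintegral_lt_top
  exact (X 0 ω).fn_le hU x

end IsValueProcess
end Value

/-! ### Expected values along a strategy -/

theorem ofReal_neg_integral_le {α : Type*} {mα : MeasurableSpace α} {μ : Measure α} {f : α → ℝ}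
    (hf : Integrable f μ) :
    ENNReal.ofReal (-∫ x, f x ∂μ) ≤ ∫⁻ x, ENNReal.ofReal (-f x) ∂μ := by
  rw [integral_eq_lintegral_pos_part_sub_lintegral_neg_part hf]
  refine ENNReal.ofReal_le_of_le_toReal ?_
  linarith [ENNReal.toReal_nonneg (a := ∫⁻ x, ENNReal.ofReal (f x) ∂μ)]

theorem lintegral_ofReal_le_add {α : Type*} {mα : MeasurableSpace α} {μ : Measure α} {f : α → ℝ}
    (hf : Integrable f μ) {a : ℝ} (h : ∫ x, f x ∂μ ≤ a) :
    ∫⁻ x, ENNReal.ofReal (f x) ∂μ ≤ ENNReal.ofReal a + ∫⁻ x, ENNReal.ofReal (-f x) ∂μ := by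
  have h1 : ∫⁻ x, ENNReal.ofReal (f x) ∂μ ≠ ⊤ := hf.lintegral_lt_top.ne
  have h2 : ∫⁻ x, ENNReal.ofReal (-f x) ∂μ ≠ ⊤ := hf.neg.lintegral_lt_top.ne
  rw [integral_eq_lintegral_pos_part_sub_lintegral_neg_part hf] at h
  rw [← ENNReal.ofReal_toReal h1, ← ENNReal.ofReal_toReal h2]
  exact (ENNReal.ofReal_le_ofReal (by linarith)).trans ENNReal.ofReal_add_le

theorem wealth_zero {Ω : Type*} {d : ℕ} (S : ℕ → Ω → EuclideanSpace ℝ (Fin d)) (c : ℝ)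
    (φ : ℕ → Ω → EuclideanSpace ℝ (Fin d)) : wealth S c φ 0 = fun _ => c := by
  funext ω
  simp [wealth]

theorem wealth_succ {Ω : Type*} {d : ℕ} (S : ℕ → Ω → EuclideanSpace ℝ (Fin d)) (c : ℝ)
    (φ : ℕ → Ω → EuclideanSpace ℝ (Fin d)) (t : ℕ) (ω : Ω) :
    wealth S c φ (t + 1) ω =
      wealth S c φ t ω + inner ℝ (φ (t + 1) ω) (increment S (t + 1) ω) := by
  rw [wealth, wealth, Finset.sum_range_succ, add_assoc]

section Along

variable {U : ℝ → ℝ} {θ C L : ℝ} {r : ℕ} {Ω : Type*} {mΩ : MeasurableSpace Ω}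
  {P : Measure Ω} [IsProbabilityMeasure P] {T d : ℕ} {ℱ : Filtration ℕ mΩ}
  {S : ℕ → Ω → EuclideanSpace ℝ (Fin d)}

theorem measurable_wealth (hS : ∀ t ≤ T, Measurable[ℱ t] (S t))
    {φ : ℕ → Ω → EuclideanSpace ℝ (Fin d)} (hφ : IsStrategy ℱ T φ) (c : ℝ) {t : ℕ} (ht : t ≤ T) :
    Measurable[ℱ t] (wealth S c φ t) := by
  induction t with
  | zero => rw [wealth_zero]; exact _root_.measurable_const
  | succ t ih =>
    have h1 := (ih (by omega)).mono (ℱ.mono (Nat.le_succ t)) le_rfl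
    have h2 := (hφ t (by omega)).mono (ℱ.mono (Nat.le_succ t)) le_rfl
    have h3 := measurable_increment hS ht
    have e : wealth S c φ (t + 1) = fun ω =>
        wealth S c φ t ω + inner ℝ (φ (t + 1) ω) (increment S (t + 1) ω) :=
      funext fun ω => wealth_succ S c φ t ω
    rw [e]
    exact h1.add (h2.inner h3)

variable [Nonempty (State U θ C)] {X : ℕ → Ω → State U θ C} {A : ℕ → Ω → ℝ}

namespace IsValueProcess

theorem measurable_fn (hX : IsValueProcess P ℱ S T r X A) {t : ℕ} (ht : t ≤ T) {V : Ω → ℝ}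
    (hV : Measurable[ℱ t] V) : Measurable[ℱ t] fun ω => (X t ω).fn (V ω) :=
  State.continuous_fn_uncurry.measurable.comp ((hX.measurable t ht).prodMk hV)

section OneStep

variable {t : ℕ} {V : Ω → ℝ} {ξ : Ω → EuclideanSpace ℝ (Fin d)}

/-- The one-step supermartingale inequality, in pointwise form. -/
theorem ae_expUtility_le (hU : GrowthData U θ C L r) (hX : IsValueProcess P ℱ S T r X A)
    (ht : t < T) (V : Ω → ℝ) (ξ : Ω → EuclideanSpace ℝ (Fin d)) :
    ∀ᵐ ω ∂P, expUtility (stepLaw P ℱ S X t ω) (V ω) (ξ ω) ≤ (X t ω).fn (V ω) := by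
  filter_upwards [hX.goodLaw t ht, hX.step t ht] with ω h1 h2
  rw [h2]
  exact h1.expUtility_le_stepValue hU _ _

theorem lintegral_next (hX : IsValueProcess P ℱ S T r X A) (hS : ∀ t ≤ T, Measurable[ℱ t] (S t))
    (ht : t < T) (hV : Measurable[ℱ t] V) (hξ : Measurable[ℱ t] ξ) (σ : ℝ) :
    ∫⁻ ω, ENNReal.ofReal
        (σ * (X (t + 1) ω).fn (V ω + inner ℝ (ξ ω) (increment S (t + 1) ω))) ∂P =
      ∫⁻ ω, ∫⁻ z, ENNReal.ofReal (σ * z.1.fn (V ω + inner ℝ (ξ ω) z.2))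
        ∂stepLaw P ℱ S X t ω ∂P := by
  have hF := ENNReal.measurable_ofReal.comp ((measurable_const_mul σ).comp
    (measurable_integrand (U := U) (θ := θ) (C := C) hV hξ))
  exact lintegral_comp_eq_lintegral_regularLaw (ℱ.le t) (hX.measurable_pair hS ht) hF

/-- The supermartingale inequality combined with Jensen's inequality for the negative part. -/
theorem lintegral_neg_le (hU : GrowthData U θ C L r) (hX : IsValueProcess P ℱ S T r X A)
    (hS : ∀ t ≤ T, Measurable[ℱ t] (S t)) (ht : t < T) (hV : Measurable[ℱ t] V)
    (hξ : Measurable[ℱ t] ξ) :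
    ∫⁻ ω, ENNReal.ofReal (-(X t ω).fn (V ω)) ∂P ≤ ∫⁻ ω, ENNReal.ofReal
      (-(X (t + 1) ω).fn (V ω + inner ℝ (ξ ω) (increment S (t + 1) ω))) ∂P := by
  have h := hX.lintegral_next hS ht hV hξ (-1)
  simp only [neg_one_mul] at h
  rw [h]
  refine lintegral_mono_ae ?_
  filter_upwards [hX.ae_expUtility_le hU ht V ξ, hX.goodLaw t ht] with ω h1 h2
  exact (ENNReal.ofReal_le_ofReal (neg_le_neg h1)).trans
    (ofReal_neg_integral_le (h2.integrable_fn hU _ _))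

/-- The conditional mean is at most the present value, so the positive part of the next value is
controlled by the present value and the next negative part. -/
theorem integrable_next (hU : GrowthData U θ C L r) (hX : IsValueProcess P ℱ S T r X A)
    (hS : ∀ t ≤ T, Measurable[ℱ t] (S t)) (ht : t < T) (hV : Measurable[ℱ t] V)
    (hξ : Measurable[ℱ t] ξ) (hint : Integrable (fun ω => (X t ω).fn (V ω)) P)
    (hneg : ∫⁻ ω, ENNReal.ofReal
      (-(X (t + 1) ω).fn (V ω + inner ℝ (ξ ω) (increment S (t + 1) ω))) ∂P < ⊤) :
    Integrable (fun ω => (X (t + 1) ω).fn (V ω + inner ℝ (ξ ω) (increment S (t + 1) ω))) P := by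
  have hV' := hV.mono (ℱ.mono (Nat.le_succ t)) le_rfl
  have hξ' := hξ.mono (ℱ.mono (Nat.le_succ t)) le_rfl
  have hmeas : Measurable fun ω =>
      (X (t + 1) ω).fn (V ω + inner ℝ (ξ ω) (increment S (t + 1) ω)) :=
    (hX.measurable_fn (Nat.succ_le_of_lt ht)
    (hV'.add (hξ'.inner (measurable_increment hS (Nat.succ_le_of_lt ht))))).mono (ℱ.le _) le_rfl
  have hp := hX.lintegral_next hS ht hV hξ 1
  have hn := hX.lintegral_next hS ht hV hξ (-1)
  simp only [one_mul, neg_one_mul] at hp hn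
  have hpos : ∫⁻ ω, ENNReal.ofReal
      ((X (t + 1) ω).fn (V ω + inner ℝ (ξ ω) (increment S (t + 1) ω))) ∂P < ⊤ := by
    rw [hp]
    have hle : ∀ᵐ ω ∂P, ∫⁻ z, ENNReal.ofReal (z.1.fn (V ω + inner ℝ (ξ ω) z.2))
          ∂stepLaw P ℱ S X t ω ≤ ENNReal.ofReal ((X t ω).fn (V ω)) +
        ∫⁻ z, ENNReal.ofReal (-z.1.fn (V ω + inner ℝ (ξ ω) z.2)) ∂stepLaw P ℱ S X t ω := by
      filter_upwards [hX.ae_expUtility_le hU ht V ξ, hX.goodLaw t ht] with ω h1 h2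
      exact lintegral_ofReal_le_add (h2.integrable_fn hU _ _) h1
    refine (lintegral_mono_ae hle).trans_lt ?_
    have hm : Measurable fun ω => ENNReal.ofReal ((X t ω).fn (V ω)) :=
      ENNReal.measurable_ofReal.comp ((hX.measurable_fn ht.le hV).mono (ℱ.le _) le_rfl)
    rw [lintegral_add_left hm, ← hn]
    exact ENNReal.add_lt_top.2 ⟨hint.lintegral_lt_top, hneg⟩
  refine ⟨hmeas.aestronglyMeasurable, ?_⟩
  rw [hasFiniteIntegral_iff_norm]
  have hle : ∀ x : ℝ, ENNReal.ofReal ‖x‖ ≤ ENNReal.ofReal x + ENNReal.ofReal (-x) := fun x => by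
    rcases le_total 0 x with hx | hx
    · rw [Real.norm_of_nonneg hx]; exact le_self_add
    · rw [Real.norm_of_nonpos hx]; exact le_add_self
  refine (lintegral_mono fun ω => hle _).trans_lt ?_
  rw [lintegral_add_left (hmeas.ennreal_ofReal)]
  exact ENNReal.add_lt_top.2 ⟨hpos, hneg⟩

theorem integral_next (hX : IsValueProcess P ℱ S T r X A)
    (hS : ∀ t ≤ T, Measurable[ℱ t] (S t)) (ht : t < T) (hV : Measurable[ℱ t] V)
    (hξ : Measurable[ℱ t] ξ)
    (hint : Integrable
      (fun ω => (X (t + 1) ω).fn (V ω + inner ℝ (ξ ω) (increment S (t + 1) ω))) P) :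
    Integrable (fun ω => expUtility (stepLaw P ℱ S X t ω) (V ω) (ξ ω)) P ∧
      ∫ ω, (X (t + 1) ω).fn (V ω + inner ℝ (ξ ω) (increment S (t + 1) ω)) ∂P =
        ∫ ω, expUtility (stepLaw P ℱ S X t ω) (V ω) (ξ ω) ∂P :=
  integral_comp_eq_integral_regularLaw (ℱ.le t) (hX.measurable_pair hS ht)
    (measurable_integrand (U := U) (θ := θ) (C := C) hV hξ) hint

theorem moments_fn (hU : GrowthData U θ C L r) (hX : IsValueProcess P ℱ S T r X A)
    (ht : t ≤ T) (hV : Measurable[ℱ t] V) (hVm : HasAllMoments P V) :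
    HasAllMoments P fun ω => (X t ω).fn (V ω) := by
  have hb := (((hasAllMoments_const 1).add hVm.abs).mul (hX.moments t ht)).add
    ((((hasAllMoments_const 1).add hVm.abs).pow r).const_mul L)
  refine hb.mono ((hX.measurable_fn ht hV).mono (ℱ.le _) le_rfl).aestronglyMeasurable
    (ae_of_all _ fun ω => ((X t ω).abs_fn_le hU (V ω)).trans (le_abs_self _))

/-- The gain of an almost optimal position has finite moments of all orders. -/
theorem moments_next (hU : GrowthData U θ C L r) (hX : IsValueProcess P ℱ S T r X A)
    (hS : ∀ t ≤ T, Measurable[ℱ t] (S t))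
    (hmom : ∀ t ≤ T, HasAllMoments P (fun ω => ‖increment S t ω‖)) (ht : t < T)
    (hV : Measurable[ℱ t] V) (hξ : Measurable[ℱ t] ξ) (hVm : HasAllMoments P V)
    (hopt : ∀ᵐ ω ∂P, (X t ω).fn (V ω) ≤ expUtility (stepLaw P ℱ S X t ω) (V ω) (ξ ω)) :
    HasAllMoments P fun ω => V ω + inner ℝ (ξ ω) (increment S (t + 1) ω) := by
  -- Since `U_t(V) ≥ U(V)`, the polynomial lower bound on `U` supplies the `W` of the a priori
  -- estimate. That estimate bounds the gain, not `ξ` itself, whose component outside the span is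
  -- arbitrary.
  have hW : HasAllMoments P fun ω => L * (1 + |V ω|) ^ r :=
    (((hasAllMoments_const 1).add hVm.abs).pow r).const_mul L
  have hR := ((hX.moments_const t ht).radius (θ := θ) (C := C) hVm hW).mul (hmom (t + 1) ht)
  have hbound : ∀ᵐ ω ∂P, ∀ᵐ z ∂stepLaw P ℱ S X t ω, |(inner ℝ (ξ ω) z.2 : ℝ)| ≤
      radius θ C (A t ω) (V ω) (L * (1 + |V ω|) ^ r) * ‖z.2‖ := by
    filter_upwards [hopt, hX.goodLaw t ht] with ω h1 h2
    have hL := hU.lower_nonneg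
    exact h2.ae_abs_inner_le hU (by positivity)
      (((hU.lower _).trans ((X t ω).le_fn _)).trans h1)
  have hAm := hX.measurable_const t ht
  have hrad : Measurable[ℱ t] fun ω =>
      radius θ C (A t ω) (V ω) (L * (1 + |V ω|) ^ r) := by
    have hc : Continuous fun p : ℝ × ℝ => radius θ C p.1 p.2 (L * (1 + |p.2|) ^ r) := by
      unfold radius radiusBase
      fun_prop
    exact hc.measurable.comp (hAm.prodMk hV)
  have hset : MeasurableSet[(ℱ t).prod inferInstance]
      {p : Ω × (State U θ C × EuclideanSpace ℝ (Fin d)) | |(inner ℝ (ξ p.1) p.2.2 : ℝ)| ≤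
        radius θ C (A t p.1) (V p.1) (L * (1 + |V p.1|) ^ r) * ‖p.2.2‖} := by
    refine measurableSet_le ?_ ?_
    · exact measurable_norm.comp (Measurable.inner (𝕜 := ℝ) (hξ.comp measurable_fst)
        (measurable_snd.comp measurable_snd))
    · exact (hrad.comp measurable_fst).mul
        (measurable_norm.comp (measurable_snd.comp measurable_snd))
  have hae := (ae_regularLaw_iff (P := P) (ℱ.le t) (hX.measurable_pair hS ht) hset).1 hbound
  have hmeas := Measurable.inner (𝕜 := ℝ) (hξ.mono (ℱ.le t) le_rfl)
    ((measurable_increment hS (Nat.succ_le_of_lt ht)).mono (ℱ.le _) le_rfl)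
  refine hVm.add (hR.mono hmeas.aestronglyMeasurable ?_)
  filter_upwards [hae] with ω hω
  exact hω.trans (le_abs_self _)

/-- Measurable selection needs its assumptions for every `ω`, so the objective is set to zero on an
exceptional null event, which lies in `ℱ t`. -/
theorem exists_argmax (hU : GrowthData U θ C L r) (hX : IsValueProcess P ℱ S T r X A)
    (h_null : ∀ s : Set Ω, MeasurableSet s → P s = 0 → MeasurableSet[ℱ 0] s)
    (ht : t < T) (hV : Measurable[ℱ t] V) :
    ∃ ξ : Ω → EuclideanSpace ℝ (Fin d), Measurable[ℱ t] ξ ∧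
      ∀ᵐ ω ∂P, (X t ω).fn (V ω) ≤ expUtility (stepLaw P ℱ S X t ω) (V ω) (ξ ω) := by
  classical
  obtain ⟨N, hN, hNm, hN0⟩ := exists_measurable_superset_of_null (ae_iff.1 (hX.goodLaw t ht))
  have hNm' : MeasurableSet[ℱ t] N := ℱ.mono (Nat.zero_le t) _ (h_null N hNm hN0)
  have hg : ∀ ω, ω ∉ N → GoodLaw r (A t ω) (stepLaw P ℱ S X t ω) := fun ω hω => by
    by_contra h
    exact hω (hN h)
  obtain ⟨ξ, hξ, hmax⟩ := exists_measurable_argmax (mΩ := ℱ t)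
    (fun ω (η : EuclideanSpace ℝ (Fin d)) =>
      if ω ∈ N then 0 else expUtility (stepLaw P ℱ S X t ω) (V ω) η)
    (fun η => Measurable.ite hNm' _root_.measurable_const
      (measurable_expUtility_regularLaw hV _root_.measurable_const))
    (fun ω => by
      by_cases h : ω ∈ N
      · simp only [h, if_true]; exact continuous_const
      · simp only [h, if_false]; exact (hg ω h).continuous_expUtility hU _)
    (fun ω => by
      by_cases h : ω ∈ N
      · simp [h]
      · obtain ⟨ξ, hξ⟩ := (hg ω h).exists_eq_stepValue hU (V ω)
        refine ⟨ξ, fun η => ?_⟩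
        simp only [h, if_false]
        rw [← hξ]
        exact (hg ω h).expUtility_le_stepValue hU _ _)
  refine ⟨ξ, hξ, ?_⟩
  filter_upwards [measure_eq_zero_iff_ae_notMem.1 hN0, hX.step t ht] with ω h1 h2
  obtain ⟨η, hη⟩ := (hg ω h1).exists_eq_stepValue hU (V ω)
  have h := hmax ω η
  simp only [h1, if_false] at h
  rwa [h2, hη]

end OneStep

/-! ### Comparison of whole strategies with the value at time zero. -/

variable {φ : ℕ → Ω → EuclideanSpace ℝ (Fin d)} {c : ℝ}

theorem integrable_along (hU : GrowthData U θ C L r) (hX : IsValueProcess P ℱ S T r X A)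
    (hS : ∀ t ≤ T, Measurable[ℱ t] (S t)) (hφ : IsStrategy ℱ T φ)
    (hneg : ∫⁻ ω, ENNReal.ofReal (-U (wealth S c φ T ω)) ∂P < ⊤) :
    ∀ t ≤ T, Integrable (fun ω => (X t ω).fn (wealth S c φ t ω)) P := by
  -- Finiteness of negative parts propagates backward from `T`; integrability then propagates
  -- forward from the constant initial wealth.
  have hn : ∀ t ≤ T, ∫⁻ ω, ENNReal.ofReal (-(X t ω).fn (wealth S c φ t ω)) ∂P < ⊤ := by
    intro t ht
    induction ht using Nat.decreasingInduction with
    | self => simpa only [hX.terminal] using hneg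
    | of_succ t ht ih =>
      simp only [wealth_succ] at ih
      exact (hX.lintegral_neg_le hU hS ht (measurable_wealth hS hφ c ht.le) (hφ t ht)).trans_lt ih
  intro t ht
  induction t with
  | zero =>
    exact (hX.moments_fn hU ht (measurable_wealth hS hφ c ht)
      (by rw [wealth_zero]; exact hasAllMoments_const c)).integrable
  | succ t ih =>
    have h := hn (t + 1) ht
    simp only [wealth_succ] at h ⊢
    exact hX.integrable_next hU hS ht (measurable_wealth hS hφ c (by omega)) (hφ t ht)
      (ih (by omega)) h

theorem integral_succ_le (hU : GrowthData U θ C L r) (hX : IsValueProcess P ℱ S T r X A)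
    (hS : ∀ t ≤ T, Measurable[ℱ t] (S t)) (hφ : IsStrategy ℱ T φ)
    (hint : ∀ t ≤ T, Integrable (fun ω => (X t ω).fn (wealth S c φ t ω)) P) {t : ℕ} (ht : t < T) :
    ∫ ω, (X (t + 1) ω).fn (wealth S c φ (t + 1) ω) ∂P ≤
      ∫ ω, (X t ω).fn (wealth S c φ t ω) ∂P := by
  have h := hint (t + 1) ht
  simp only [wealth_succ] at h ⊢
  obtain ⟨h1, h2⟩ := hX.integral_next hS ht (measurable_wealth hS hφ c ht.le) (hφ t ht) h
  rw [h2]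
  exact integral_mono_ae h1 (hint t ht.le) (hX.ae_expUtility_le hU ht _ _)

theorem integral_antitone (hU : GrowthData U θ C L r) (hX : IsValueProcess P ℱ S T r X A)
    (hS : ∀ t ≤ T, Measurable[ℱ t] (S t)) (hφ : IsStrategy ℱ T φ)
    (hint : ∀ t ≤ T, Integrable (fun ω => (X t ω).fn (wealth S c φ t ω)) P) {s t : ℕ}
    (hst : s ≤ t) (ht : t ≤ T) :
    ∫ ω, (X t ω).fn (wealth S c φ t ω) ∂P ≤ ∫ ω, (X s ω).fn (wealth S c φ s ω) ∂P := by
  induction t, hst using Nat.le_induction with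
  | base => exact le_rfl
  | succ t _ ih => exact (hX.integral_succ_le hU hS hφ hint ht).trans (ih (by omega))

/-- The expected utility of every strategy is at most the expected value at time `0`. -/
theorem extExp_le (hU : GrowthData U θ C L r) (hX : IsValueProcess P ℱ S T r X A)
    (hS : ∀ t ≤ T, Measurable[ℱ t] (S t)) (hφ : IsStrategy ℱ T φ) :
    extExp P (fun ω => U (wealth S c φ T ω)) ≤ ((∫ ω, (X 0 ω).fn c ∂P : ℝ) : EReal) := by
  -- With an infinite negative part `extExp` is `⊥`, even for `⊤ - ⊤`, so admissibility is not
  -- required.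
  rcases eq_or_ne (∫⁻ ω, ENNReal.ofReal (-U (wealth S c φ T ω)) ∂P) ⊤ with h | h
  · rw [extExp, h, EReal.coe_ennreal_top, EReal.sub_top]
    exact bot_le
  · have hint := hX.integrable_along hU hS hφ (lt_top_iff_ne_top.2 h)
    have hT := hint T le_rfl
    simp only [hX.terminal] at hT
    rw [extExp_of_integrable hT, EReal.coe_le_coe_iff]
    simpa only [hX.terminal, wealth_zero] using
      hX.integral_antitone hU hS hφ hint (Nat.zero_le T) le_rfl

/-- Strategies attaining the expected value at time `0` have gains with finite moments of all
orders. -/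
theorem moments_wealth (hU : GrowthData U θ C L r) (hX : IsValueProcess P ℱ S T r X A)
    (hS : ∀ t ≤ T, Measurable[ℱ t] (S t))
    (hmom : ∀ t ≤ T, HasAllMoments P (fun ω => ‖increment S t ω‖)) (hφ : IsStrategy ℱ T φ)
    (hge : ((∫ ω, (X 0 ω).fn c ∂P : ℝ) : EReal) ≤ extExp P (fun ω => U (wealth S c φ T ω))) :
    ∀ t ≤ T, HasAllMoments P (wealth S c φ t) := by
  have h : ∫⁻ ω, ENNReal.ofReal (-U (wealth S c φ T ω)) ∂P ≠ ⊤ := fun h => by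
    rw [extExp, h, EReal.coe_ennreal_top, EReal.sub_top, le_bot_iff] at hge
    exact EReal.coe_ne_bot _ hge
  have hint := hX.integrable_along hU hS hφ (lt_top_iff_ne_top.2 h)
  have hT := hint T le_rfl
  simp only [hX.terminal] at hT
  rw [extExp_of_integrable hT, EReal.coe_le_coe_iff] at hge
  intro t ht
  induction t with
  | zero => rw [wealth_zero]; exact hasAllMoments_const c
  | succ t ih =>
    have hV := measurable_wealth hS hφ c (show t ≤ T by omega)
    have h1 := hX.integral_antitone hU hS hφ hint (Nat.zero_le t) (by omega)
    have h2 := hX.integral_antitone hU hS hφ hint ht le_rfl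
    simp only [hX.terminal] at h2
    simp only [wealth_zero] at h1
    have hi := hint (t + 1) ht
    simp only [wealth_succ] at h2 hi
    obtain ⟨h3, h4⟩ := hX.integral_next hS ht hV (hφ t ht) hi
    have hle := hX.ae_expUtility_le hU ht (wealth S c φ t) (φ (t + 1))
    -- The expectations decrease from time `0` to `T` but have equal ends, so all coincide; the
    -- pointwise one-step inequality is then an almost sure equality.
    have heq := (integral_eq_iff_of_ae_le h3 (hint t (by omega)) hle).1
      (le_antisymm (integral_mono_ae h3 (hint t (by omega)) hle) (by
        rw [← h4]; exact h1.trans (hge.trans h2)))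
    have hmn := hX.moments_next hU hS hmom ht hV (hφ t ht) (ih (by omega))
      (by filter_upwards [heq] with ω hω using hω.ge)
    have e : wealth S c φ (t + 1) = fun ω =>
        wealth S c φ t ω + inner ℝ (φ (t + 1) ω) (increment S (t + 1) ω) :=
      funext fun ω => wealth_succ S c φ t ω
    rwa [e]

theorem exists_strategy (hU : GrowthData U θ C L r) (hX : IsValueProcess P ℱ S T r X A)
    (h_null : ∀ s : Set Ω, MeasurableSet s → P s = 0 → MeasurableSet[ℱ 0] s)
    (hS : ∀ t ≤ T, Measurable[ℱ t] (S t))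
    (hmom : ∀ t ≤ T, HasAllMoments P (fun ω => ‖increment S t ω‖)) (c : ℝ) :
    ∃ φ, IsStrategy ℱ T φ ∧ Integrable (fun ω => U (wealth S c φ T ω)) P ∧
      ∫ ω, U (wealth S c φ T ω) ∂P = ∫ ω, (X 0 ω).fn c ∂P := by
  choose! F hFm hF using fun (t : ℕ) (V : Ω → ℝ) (ht : t < T) (hV : Measurable[ℱ t] V) =>
    hX.exists_argmax hU h_null ht hV
  -- Wealth and strategy are built together: `V` is the wealth obtained by using at each date the
  -- maximizer for the current wealth. The shift in `φ` makes its entry at `t + 1` depend on `V t`;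
  -- the entry at `0` never enters.
  let V : ℕ → Ω → ℝ := fun t => Nat.rec (fun _ => c)
    (fun t V ω => V ω + inner ℝ (F t V ω) (increment S (t + 1) ω)) t
  let φ : ℕ → Ω → EuclideanSpace ℝ (Fin d) := fun t => F (t - 1) (V (t - 1))
  have hVw : ∀ t, wealth S c φ t = V t := fun t => by
    induction t with
    | zero => funext ω; simp [wealth, V]
    | succ t ih => funext ω; rw [wealth_succ, ih]; rfl
  have hVm : ∀ t ≤ T, Measurable[ℱ t] (V t) := fun t ht => by
    induction t with
    | zero => exact _root_.measurable_const
    | succ t ih =>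
      have h1 := ih (by omega)
      exact (h1.mono (ℱ.mono (Nat.le_succ t)) le_rfl).add
        (((hFm t _ ht h1).mono (ℱ.mono (Nat.le_succ t)) le_rfl).inner
          (measurable_increment hS ht))
  have hVmom : ∀ t ≤ T, HasAllMoments P (V t) := fun t ht => by
    induction t with
    | zero => exact hasAllMoments_const c
    | succ t ih =>
      exact hX.moments_next hU hS hmom ht (hVm t (by omega)) (hFm t _ ht (hVm t (by omega)))
        (ih (by omega)) (hF t _ ht (hVm t (by omega)))
  have hint : ∀ t ≤ T, Integrable (fun ω => (X t ω).fn (V t ω)) P := fun t ht =>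
    (hX.moments_fn hU ht (hVm t ht) (hVmom t ht)).integrable
  have hval : ∀ t ≤ T, ∫ ω, (X t ω).fn (V t ω) ∂P = ∫ ω, (X 0 ω).fn c ∂P := fun t ht => by
    induction t with
    | zero => rfl
    | succ t ih =>
      have h1 := hVm t (by omega)
      obtain ⟨-, h2⟩ := hX.integral_next hS ht h1 (hFm t _ ht h1) (hint (t + 1) ht)
      refine h2.trans (Eq.trans (integral_congr_ae ?_) (ih (by omega)))
      filter_upwards [hF t _ ht h1, hX.ae_expUtility_le hU ht (V t) (F t (V t))] with ω h3 h4
      exact le_antisymm h4 h3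
  refine ⟨φ, fun t ht => hFm t _ ht (hVm t ht.le), ?_, ?_⟩
  · simpa only [hVw, hX.terminal] using hint T le_rfl
  · simpa only [hVw, hX.terminal] using hval T le_rfl

theorem optValue_eq (hU : GrowthData U θ C L r) (hX : IsValueProcess P ℱ S T r X A)
    (h_null : ∀ s : Set Ω, MeasurableSet s → P s = 0 → MeasurableSet[ℱ 0] s)
    (hS : ∀ t ≤ T, Measurable[ℱ t] (S t))
    (hmom : ∀ t ≤ T, HasAllMoments P (fun ω => ‖increment S t ω‖)) (c : ℝ) :
    optValue P ℱ S T U c = ((∫ ω, (X 0 ω).fn c ∂P : ℝ) : EReal) ∧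
      ∃ φ, IsOptimal P ℱ S T U c φ := by
  obtain ⟨φ, hφ, hint, hval⟩ := hX.exists_strategy hU h_null hS hmom c
  have hadm : φ ∈ admissible P ℱ S T U c := ⟨hφ, Or.inl hint.lintegral_lt_top.ne⟩
  have hext := extExp_of_integrable hint
  rw [hval] at hext
  have hopt : optValue P ℱ S T U c = ((∫ ω, (X 0 ω).fn c ∂P : ℝ) : EReal) :=
    le_antisymm (iSup₂_le fun ψ hψ => hX.extExp_le hU hS hψ.1)
      (hext ▸ le_iSup₂ (f := fun ψ (_ : ψ ∈ admissible P ℱ S T U c) =>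
        extExp P (fun ω => U (wealth S c ψ T ω))) φ hadm)
  exact ⟨hopt, φ, hadm, by rw [hopt, hext], by rw [hext]; exact EReal.coe_lt_top _⟩

end IsValueProcess
end Along

/-! ### The martingale measure -/

section MartingaleMeasure

variable {Ω : Type*} {mΩ : MeasurableSpace Ω} {P : Measure Ω} [IsProbabilityMeasure P]

theorem HasAllMoments.deriv_comp {U : ℝ → ℝ} (hd : Continuous (deriv U)) (hpos : ∀ x, 0 ≤ deriv U x)
    {L : ℝ} {r : ℕ} (hL : ∀ x, deriv U x ≤ L * (1 + |x|) ^ r) {V : Ω → ℝ} (hV : HasAllMoments P V) :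
    HasAllMoments P fun ω => deriv U (V ω) :=
  ((((hasAllMoments_const 1).add hV.abs).pow r).const_mul L).mono
    (hd.comp_aestronglyMeasurable (hV 0).1) (ae_of_all _ fun ω => by
      rw [abs_of_nonneg (hpos _)]
      exact (hL _).trans (le_abs_self _))

/-- First order condition for the maximality of an expected utility. -/
theorem integral_deriv_mul_eq_zero {U : ℝ → ℝ} (hUd : Differentiable ℝ U)
    (hd : Continuous (deriv U)) (hpos : ∀ x, 0 ≤ deriv U x) {L : ℝ} {r : ℕ}
    (hL : ∀ x, deriv U x ≤ L * (1 + |x|) ^ r) {V Y : Ω → ℝ} (hV : HasAllMoments P V)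
    (hY : HasAllMoments P Y) (hint : Integrable (fun ω => U (V ω)) P)
    (hmax : ∀ ε : ℝ, ∫ ω, U (V ω + ε * Y ω) ∂P ≤ ∫ ω, U (V ω) ∂P) :
    ∫ ω, deriv U (V ω) * Y ω ∂P = 0 := by
  have hL0 : 0 ≤ L := by simpa using (hpos 0).trans (hL 0)
  have hb : HasAllMoments P fun ω => L * (1 + (|V ω| + |Y ω|)) ^ r * |Y ω| :=
    ((((hasAllMoments_const 1).add (hV.abs.add hY.abs)).pow r).const_mul L).mul hY.abs
  have hVs : AEStronglyMeasurable V P := (hV 0).1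
  have hYs : AEStronglyMeasurable Y P := (hY 0).1
  -- For `|ε| < 1` the derivative is dominated by a polynomial in `|V|` and `|Y|`.
  obtain ⟨-, h⟩ := hasDerivAt_integral_of_dominated_loc_of_deriv_le (μ := P) (x₀ := (0 : ℝ))
    (F := fun ε ω => U (V ω + ε * Y ω)) (F' := fun ε ω => deriv U (V ω + ε * Y ω) * Y ω)
    (bound := fun ω => L * (1 + (|V ω| + |Y ω|)) ^ r * |Y ω|)
    (Metric.ball_mem_nhds (0 : ℝ) one_pos)
    (Filter.Eventually.of_forall fun ε =>
      hUd.continuous.comp_aestronglyMeasurable (hVs.add (hYs.const_mul ε)))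
    (by simpa using hint)
    ((hd.comp_aestronglyMeasurable (hVs.add (hYs.const_mul 0))).mul hYs)
    (ae_of_all _ fun ω ε hε => by
      rw [Metric.mem_ball, dist_zero_right, Real.norm_eq_abs] at hε
      rw [Real.norm_eq_abs, abs_mul, abs_of_nonneg (hpos _)]
      refine mul_le_mul_of_nonneg_right ((hL _).trans ?_) (abs_nonneg _)
      have h1 : |V ω + ε * Y ω| ≤ |V ω| + |Y ω| := by
        refine (abs_add_le _ _).trans (add_le_add le_rfl ?_)
        rw [abs_mul]
        exact mul_le_of_le_one_left (abs_nonneg _) hε.le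
      gcongr)
    hb.integrable
    (ae_of_all _ fun ω ε _ => by
      have h1 : HasDerivAt (fun ε : ℝ => V ω + ε * Y ω) (Y ω) ε := by
        simpa using ((hasDerivAt_id ε).mul_const (Y ω)).const_add (V ω)
      exact (hUd _).hasDerivAt.comp ε h1)
  have hloc : IsLocalMax (fun ε : ℝ => ∫ ω, U (V ω + ε * Y ω) ∂P) 0 :=
    Filter.Eventually.of_forall fun ε => by simpa using hmax ε
  simpa using hloc.hasDerivAt_eq_zero h

variable {T d : ℕ} {ℱ : Filtration ℕ mΩ} {S : ℕ → Ω → EuclideanSpace ℝ (Fin d)}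

theorem integrable_mul_norm_of_increment {D : Ω → ℝ} (hD : HasAllMoments P D)
    (hS : ∀ t ≤ T, Measurable[ℱ t] (S t))
    (hmom : ∀ t ≤ T, HasAllMoments P (fun ω => ‖increment S t ω‖)) {t : ℕ} (ht : t ≤ T) :
    Integrable (fun ω => D ω • S t ω) P := by
  have hi : ∀ t ≤ T, Integrable (fun ω => D ω • increment S t ω) P := fun t ht => by
    refine (hD.mul (hmom t ht)).integrable.mono ((hD 0).1.smul
      ((measurable_increment hS ht).mono (ℱ.le _) le_rfl).aestronglyMeasurable) ?_
    exact ae_of_all _ fun ω => by simp [norm_smul]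
  induction t with
  | zero => exact hi 0 ht
  | succ t ih =>
    refine ((ih (by omega)).add (hi (t + 1) ht)).congr (ae_of_all _ fun ω => ?_)
    simp [increment, smul_sub]

/-- A density which is orthogonal to the gains of all the simple one-period strategies is the
density of an equivalent martingale measure. -/
theorem isEquivMartingaleMeasure_withDensity {D : Ω → ℝ} (hDm : Measurable D) (hD0 : ∀ ω, 0 < D ω)
    (hD : HasAllMoments P D) (hS : ∀ t ≤ T, Measurable[ℱ t] (S t))
    (hmom : ∀ t ≤ T, HasAllMoments P (fun ω => ‖increment S t ω‖))
    (horth : ∀ t < T, ∀ B, MeasurableSet[ℱ t] B → ∀ e : EuclideanSpace ℝ (Fin d),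
      ∫ ω in B, D ω * inner ℝ e (increment S (t + 1) ω) ∂P = 0) :
    IsEquivMartingaleMeasure P
      (P.withDensity fun ω => ENNReal.ofReal (D ω / ∫ ω', D ω' ∂P)) ℱ S T := by
  set c : ℝ := ∫ ω, D ω ∂P with hc
  have hc0 : 0 < c := by
    rw [hc, integral_pos_iff_support_of_nonneg (fun ω => (hD0 ω).le) hD.integrable]
    have : Function.support D = Set.univ := by
      ext ω; simp [(hD0 ω).ne']
    rw [this, measure_univ]
    exact one_pos
  have hf0 : ∀ ω, 0 < D ω / c := fun ω => div_pos (hD0 ω) hc0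
  have hfm : Measurable fun ω => ENNReal.ofReal (D ω / c) :=
    ENNReal.measurable_ofReal.comp (hDm.div_const c)
  have hfm' : HasAllMoments P fun ω => D ω / c := by
    simpa [div_eq_mul_inv, mul_comm] using hD.const_mul c⁻¹
  set Q := P.withDensity fun ω => ENNReal.ofReal (D ω / c) with hQ
  have hprob : IsProbabilityMeasure Q := ⟨by
    rw [hQ, withDensity_apply _ MeasurableSet.univ, Measure.restrict_univ,
      ← ofReal_integral_eq_lintegral_ofReal hfm'.integrable (ae_of_all _ fun ω => (hf0 ω).le),
      integral_div, ← hc, div_self hc0.ne', ENNReal.ofReal_one]⟩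
  have hint : ∀ t ≤ T, Integrable (S t) Q := fun t ht => by
    rw [hQ, integrable_withDensity_iff_integrable_smul' hfm
      (ae_of_all _ fun ω => ENNReal.ofReal_lt_top)]
    simp only [ENNReal.toReal_ofReal (hf0 _).le]
    exact integrable_mul_norm_of_increment hfm' hS hmom ht
  have hstep : ∀ t < T, ∀ B, MeasurableSet[ℱ t] B →
      ∫ ω in B, S (t + 1) ω ∂Q = ∫ ω in B, S t ω ∂Q := by
    intro t ht B hB
    have hincr : Integrable (increment S (t + 1)) (Q.restrict B) :=
      ((hint (t + 1) ht).sub (hint t ht.le)).integrableOn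
    have hz : ∫ ω in B, increment S (t + 1) ω ∂Q = 0 := by
      -- The orthogonality relation is applied with `e` equal to the vector integral itself.
      rw [← inner_self_eq_zero (𝕜 := ℝ), ← integral_inner hincr, hQ,
        setIntegral_withDensity_eq_setIntegral_toReal_smul hfm
          (ae_of_all _ fun ω => ENNReal.ofReal_lt_top) _ (ℱ.le t _ hB)]
      simp only [ENNReal.toReal_ofReal (hf0 _).le, smul_eq_mul, div_mul_eq_mul_div]
      rw [integral_div, horth t ht B hB, zero_div]
    have hsub : ∫ ω in B, increment S (t + 1) ω ∂Q =
        ∫ ω in B, S (t + 1) ω ∂Q - ∫ ω in B, S t ω ∂Q :=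
      integral_sub (hint (t + 1) ht).integrableOn (hint t ht.le).integrableOn
    exact sub_eq_zero.1 (hsub.symm.trans hz)
  refine ⟨hprob, withDensity_absolutelyContinuous _ _,
    withDensity_absolutelyContinuous' hfm.aemeasurable (ae_of_all _ fun ω =>
      (ENNReal.ofReal_pos.2 (hf0 ω)).ne'), hint, fun s t hst ht => ?_⟩
  refine (ae_eq_condExp_of_forall_setIntegral_eq (ℱ.le s) (hint t ht)
    (fun B _ _ => (hint s (hst.trans ht)).integrableOn) (fun B hB _ => ?_)
    (hS s (hst.trans ht)).aestronglyMeasurable).symm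
  induction t, hst using Nat.le_induction with
  | base => rfl
  | succ t hst ih => exact (ih (by omega)).trans (hstep t ht B (ℱ.mono hst _ hB)).symm

end MartingaleMeasure

/-- By concavity the tangent slope at `x` is at least the chord slope on `[x, x + 1]`, which is
positive. -/
theorem deriv_pos_of_concave_strictMono {U : ℝ → ℝ} (hc : ConcaveOn ℝ Set.univ U)
    (hm : StrictMono U) (hd : Differentiable ℝ U) (x : ℝ) : 0 < deriv U x := by
  have h := hc.slope_le_of_hasDerivAt (Set.mem_univ x) (Set.mem_univ (x + 1)) (by linarith)
    (hd x).hasDerivAt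
  refine lt_of_lt_of_le ?_ h
  rw [slope_def_field]
  have := hm (show x < x + 1 by linarith)
  exact div_pos (by linarith) (by linarith)

theorem wealth_add_smul {Ω : Type*} {T d : ℕ} (S : ℕ → Ω → EuclideanSpace ℝ (Fin d)) (c ε : ℝ)
    (φ ψ : ℕ → Ω → EuclideanSpace ℝ (Fin d)) (ω : Ω) :
    wealth S c (fun s ω => φ s ω + ε • ψ s ω) T ω =
      wealth S c φ T ω + ε * wealth S 0 ψ T ω := by
  simp only [wealth, inner_add_left, real_inner_smul_left, Finset.sum_add_distrib,
    ← Finset.mul_sum]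
  ring

/-! ### First order condition at an optimal strategy. -/

section Optimal

variable {U : ℝ → ℝ} {θ C L : ℝ} {r : ℕ} {Ω : Type*} {mΩ : MeasurableSpace Ω}
  {P : Measure Ω} [IsProbabilityMeasure P] {T d : ℕ} {ℱ : Filtration ℕ mΩ}
  {S : ℕ → Ω → EuclideanSpace ℝ (Fin d)} [Nonempty (State U θ C)]
  {X : ℕ → Ω → State U θ C} {A : ℕ → Ω → ℝ}

/-- The marginal utility of an optimal strategy defines an equivalent martingale measure. -/
theorem IsOptimal.isEquivMartingaleMeasure (hU : GrowthData U θ C L r)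
    (hX : IsValueProcess P ℱ S T r X A)
    (h_null : ∀ s : Set Ω, MeasurableSet s → P s = 0 → MeasurableSet[ℱ 0] s)
    (hS : ∀ t ≤ T, Measurable[ℱ t] (S t))
    (hmom : ∀ t ≤ T, HasAllMoments P (fun ω => ‖increment S t ω‖))
    (hUd : Differentiable ℝ U) (hd : Continuous (deriv U)) (hpos : ∀ x, 0 < deriv U x)
    (hL : ∀ x, deriv U x ≤ L * (1 + |x|) ^ r) {c : ℝ}
    {φ : ℕ → Ω → EuclideanSpace ℝ (Fin d)} (h : IsOptimal P ℱ S T U c φ) :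
    Integrable (fun ω => deriv U (wealth S c φ T ω)) P ∧
      IsEquivMartingaleMeasure P (marginalMeasure P U (wealth S c φ T)) ℱ S T := by
  obtain ⟨⟨hφ, -⟩, hopt, -⟩ := h
  have hoptv := (hX.optValue_eq hU h_null hS hmom c).1
  have hV := hX.moments_wealth hU hS hmom hφ (by rw [← hopt, hoptv]) T le_rfl
  have hVm := (measurable_wealth hS hφ c le_rfl).mono (ℱ.le T) le_rfl
  have hUV : ∀ {V : Ω → ℝ}, Measurable[ℱ T] V → HasAllMoments P V →
      Integrable (fun ω => U (V ω)) P := fun h1 h2 => by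
    simpa only [hX.terminal] using (hX.moments_fn hU le_rfl h1 h2).integrable
  have hD := hV.deriv_comp hd (fun x => (hpos x).le) hL
  refine ⟨hD.integrable, ?_⟩
  refine isEquivMartingaleMeasure_withDensity (hd.measurable.comp hVm) (fun ω => hpos _) hD hS hmom
    fun t ht B hB e => ?_
  -- The optimal strategy is perturbed by `ε` times the one-period position `e` held on the event
  -- `B`; the universal upper bound makes `ε = 0` a maximum.
  let p : Ω → EuclideanSpace ℝ (Fin d) := B.indicator fun _ => e
  have hp : Measurable[ℱ t] p := _root_.measurable_const.indicator hB
  let ψ : ℕ → Ω → EuclideanSpace ℝ (Fin d) := fun s => if s = t + 1 then p else 0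
  have hψ : IsStrategy ℱ T ψ := fun s hs => by
    by_cases hst : s = t
    · subst hst; simpa [ψ] using hp
    · have : s + 1 ≠ t + 1 := by omega
      simp only [ψ, this, if_false]
      exact _root_.measurable_const
  have hw : ∀ ω, wealth S 0 ψ T ω = inner ℝ (p ω) (increment S (t + 1) ω) := fun ω => by
    rw [wealth_single ht, zero_add]
  have hY : HasAllMoments P (wealth S 0 ψ T) := by
    refine ((hmom (t + 1) ht).const_mul ‖e‖).mono
      ((measurable_wealth hS hψ 0 le_rfl).mono (ℱ.le T) le_rfl).aestronglyMeasurable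
      (ae_of_all _ fun ω => ?_)
    rw [hw, abs_of_nonneg (by positivity : 0 ≤ ‖e‖ * ‖increment S (t + 1) ω‖)]
    exact (abs_real_inner_le_norm _ _).trans
      (mul_le_mul_of_nonneg_right (norm_indicator_le_norm_self _ _) (norm_nonneg _))
  have key := integral_deriv_mul_eq_zero hUd hd (fun x => (hpos x).le) hL hV hY
    (hUV (measurable_wealth hS hφ c le_rfl) hV) fun ε => by
      have hs : IsStrategy ℱ T fun s ω => φ s ω + ε • ψ s ω := fun s hs =>
        (hφ s hs).add ((hψ s hs).const_smul ε)
      have hle := hX.extExp_le (c := c) hU hS hs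
      rw [← hoptv, hopt] at hle
      simp only [wealth_add_smul] at hle
      have hi := hUV (V := fun ω => wealth S c φ T ω + ε * wealth S 0 ψ T ω)
        ((measurable_wealth hS hφ c le_rfl).add ((measurable_wealth hS hψ 0 le_rfl).const_mul ε))
        (hV.add (hY.const_mul ε))
      rw [extExp_of_integrable (hUV (measurable_wealth hS hφ c le_rfl) hV),
        extExp_of_integrable hi, EReal.coe_le_coe_iff] at hle
      exact hle
  rw [← integral_indicator (ℱ.le t _ hB), ← key]
  refine integral_congr_ae (ae_of_all _ fun ω => ?_)
  simp only [hw, p]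
  by_cases hω : ω ∈ B <;> simp [hω]

end Optimal

end UtilityMax

end

theorem proposition7p1 {Ω : Type*} {mΩ : MeasurableSpace Ω} (P : Measure Ω)
    [IsProbabilityMeasure P] (T d : ℕ) (ℱ : Filtration ℕ mΩ)
    (h_null : ∀ s : Set Ω, MeasurableSet s → P s = 0 → MeasurableSet[ℱ 0] s)
    (S : ℕ → Ω → EuclideanSpace ℝ (Fin d)) (h_adapted : ∀ t ≤ T, Measurable[ℱ t] (S t))
    (U : ℝ → ℝ) (h_elastic : UtilityMax.ElasticAtTop U ∨ UtilityMax.ElasticAtBot U)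
    (h_smooth : ContDiff ℝ 1 U) (h_strict : StrictMono U)
    (k l M K : ℝ) (hk : 0 ≤ k) (hl : 0 ≤ l) (hM : 0 ≤ M) (hK : 0 ≤ K)
    (h_lower : ∀ x : ℝ, 1 ≤ |x| → M * |x| ^ (-l) ≤ deriv U x)
    (h_upper : ∀ x : ℝ, deriv U x ≤ K * (|x| ^ k + 1))
    (h_moments : ∀ t ≤ T,
      UtilityMax.HasAllMoments P (fun ω => ‖UtilityMax.increment S t ω‖))
    (h_na : UtilityMax.NoArbitrage P ℱ S T)
    (β κ : ℕ → Ω → ℝ) (h_bound : ∀ t < T, UtilityMax.IsNABound P ℱ S t (β t) (κ t))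
    (h_beta : ∀ t < T, UtilityMax.HasAllMoments P (fun ω => 1 / β t ω))
    (h_kappa : ∀ t < T, UtilityMax.HasAllMoments P (fun ω => 1 / κ t ω)) :
    UtilityMax.WellPosed P ℱ S T U ∧
    ∀ c : ℝ, (∃ φ, UtilityMax.IsOptimal P ℱ S T U c φ) ∧
      ∀ φ, UtilityMax.IsOptimal P ℱ S T U c φ →
        Integrable (fun ω => deriv U (UtilityMax.wealth S c φ T ω)) P ∧
        UtilityMax.IsEquivMartingaleMeasure P
          (UtilityMax.marginalMeasure P U (UtilityMax.wealth S c φ T)) ℱ S T := by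
  obtain ⟨hc, hm, h0, θ, C, hθ, hθ1, hC, hel⟩ := UtilityMax.exists_elasticity h_elastic
  have hdiff : Differentiable ℝ U := h_smooth.differentiable (by norm_num)
  have hd : Continuous (deriv U) := h_smooth.continuous_deriv le_rfl
  have hpos := UtilityMax.deriv_pos_of_concave_strictMono hc h_strict hdiff
  have hL := UtilityMax.deriv_le_of_rpow_bound hK hk h_upper
  -- The exponent is raised by one so that the bound on the derivative and the lower bound on `U`
  -- share the same degree.
  have hL' : ∀ x, deriv U x ≤ 2 * K * (1 + |x|) ^ (⌈k⌉₊ + 1) := fun x =>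
    (hL x).trans (mul_le_mul_of_nonneg_left
      (pow_le_pow_right₀ (by linarith [abs_nonneg x]) (Nat.le_succ _)) (by positivity))
  have hU : UtilityMax.GrowthData U θ C (2 * K) (⌈k⌉₊ + 1) :=
    ⟨h0, hm, hθ, hθ1, hC, by positivity,
      UtilityMax.lower_bound_of_deriv_le h0 hm hdiff (by positivity) hL⟩
  obtain ⟨s, hs⟩ := UtilityMax.exists_state_of_utility hc h_strict h0 hel
  have : Nonempty (UtilityMax.State U θ C) := ⟨s⟩
  obtain ⟨X, A, hX⟩ := UtilityMax.exists_isValueProcess hU hs h_null h_adapted h_moments h_na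
    h_bound h_beta h_kappa
  exact ⟨hX.wellPosed hU h_adapted, fun c =>
    ⟨(hX.optValue_eq hU h_null h_adapted h_moments c).2, fun φ hφ =>
      hφ.isEquivMartingaleMeasure hU hX h_null h_adapted h_moments hdiff hd hpos hL'⟩⟩
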